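/- Let $M$ be a compact connected $n$-dimensional manifold with corners (smooth, Hausdorff, locally modelled on $[0,\infty)^n$), let $M^\circ$ be its interior, and equip $M^\circ$ with a measure which in local coordinates is $h\prod_k\rho_k^{-1}\,dx$, where the $\rho_k$ are the local defining functions of the boundary hyperfaces, $dx$ is Lebesgue measure in the coordinates and $h>0$ is continuous up to the boundary; $L^2(M)$ is taken with respect to it. Let $F$ be an open face of $M$ of codimension $d\ge1$ (a connected component of the set of points at which exactly $d$ local coordinates vanish), with a measure of the same kind. Let $NF\to F$ be the logarithmic normal bundle (its fibre at $x$ is the space of real functions on the set of the $d$ local hyperfaces at $x$), let $\widetilde F\to F$ be a connected component of the covering of $F$ formed by the numberings of the local hyperfaces, and let $\mathfrak S_F\subset\mathfrak S_d$ be the group of the renumberings preserving $\widetilde F$; thus $\widetilde F\to F$ is a principal $\mathfrak S_F$-covering, the lift of $NF$ to $\widetilde F$ is $\widetilde F\times\mathbb R^d$, and $L^2(NF)$ is the space of $\mathfrak S_F$-invariant functions in $L^2(\widetilde F\times\mathbb R^d)$. Let $C(M^\#)$ be the algebra of bounded continuous functions on $M^\circ$ which near every boundary point with vanishing coordinates $\rho_1,\dots,\rho_k$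 converge, as $|t|\to\infty$, where $t=(-\ln\rho_1,\dots,-\ln\rho_k)$, to a continuous function of the direction $t/|t|$, uniformly in this direction and in the remaining coordinates. Let $F^\#$ be the quotient of the open simplex $\{\theta\in\mathbb R^d:\theta_i>0,\ \sum\theta_i=1\}$ by $\mathfrak S_F$; a point $z\in F^\#$ defines the character of $C(M^\#)$ which takes a function to its limit at points of $F$ in the direction $z$. For $s\ge0$ let $\mathcal A$ be the algebra of bounded norm-continuous families $A(q)\in\mathcal B L^2(M)$, $q\in\mathbb R^s$, such that for each $\varphi\in C(M^\#)$ the commutator $[A(q),\varphi]$ is compact for all $q$ and tends to zero in norm as $q\to\infty$; let $\mathcal J_z\subset\mathcal A$ be the closed two-sided ideal generated by the functions $\varphi\in C(M^\#)$ with $\varphi(z)=0$, and let $\mathcal A_z=\mathcal A/\mathcal J_z$. Fix an exponential map $f$ of the normal bundle of $F$ into $M$: a map defined for fibre coordinates $0\le\rho_i\le\varepsilon$, equal to the identity on the zero section, mapping $\{\rho_i=0\}$ into the $i$th local hyperface near the zero section, and extending to a smooth local diffeomorphism on the corresponding part of the normal bundle of the closed face. Via $f$ and $\rho_i=e^{-t_i}$,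 functions on $M$ supported near $z$ are identified with functions on $NF$. Let $A\in\mathcal A$ be a family of slow compact variation: $A(q)-A(q')$ is compact for all $q,q'$, and for all $\delta,\eta>0$ there is an $R>0$ such that $\|A(q)-A(q')\|\le\eta$ whenever $|q-q'|<\delta$ and $|q|>R$. A translation-invariant infinitesimal operator of $A$ at $z\in F^\#$ is a bounded norm-continuous family $A_\infty(q)\in\mathcal B L^2(NF)$, $q\in\mathbb R^s$, such that (i) each $A_\infty(q)$ is the restriction to $L^2(NF)$ of a bounded operator $\widetilde A_\infty(q)$ on $L^2(\widetilde F\times\mathbb R^d)$ commuting with $\mathfrak S_F$ and with all translations of $\mathbb R^d$; (ii) for some cutoff function $\psi\in C(M^\#)$, equal to $1$ near $z$ and vanishing outside the image of a neighbourhood of the zero section on which $f$ is one-to-one, the family $\psi A_\infty(q)\psi$ transported to $L^2(M)$ by $f$ belongs to $\mathcal A$ and lies in the same coset modulo $\mathcal J_z$ as $A$. A symbol $\sigma_z(A)$ is a bounded function $B:\mathbb R^d\times\mathbb R^s\to\mathcal B L^2(\widetilde F)$, strongly measurable in $\xi\in\mathbb R^d$ for each $q\in\mathbb R^s$, such that,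 for some translation-invariant infinitesimal operator $A_\infty$ of $A$ at $z$, one has $\widetilde A_\infty(q)=B(-i\,\partial/\partial t,\,q)$ for each $q$ and some $\widetilde A_\infty(q)$ as in (i). Theorem. Suppose that $A$ has a translation-invariant infinitesimal operator at $z\in F^\#$. Then this operator is unique. The symbol $\sigma_z(A)$ exists and is well defined: if $B$ and $B'$ are two symbols, then for each $q\in\mathbb R^s$ one has $B(\xi,q)=B'(\xi,q)$ for almost all $\xi\in\mathbb R^d$. It is $\mathfrak S_F$-invariant: for all $\sigma\in\mathfrak S_F$ and $q\in\mathbb R^s$, $$B(\sigma\xi,q)\,S_\sigma=S_\sigma\,B(\xi,q)\quad\text{for almost all }\xi\in\mathbb R^d,$$ where $(\sigma\xi)_i=\xi_{\sigma^{-1}(i)}$ and $(S_\sigma u)(x)=u(\sigma^{-1}x)$ on $L^2(\widetilde F)$. -/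

import Mathlib

open Set Filter Topology MeasureTheory
open scoped Manifold ContDiff NNReal ENNReal Pointwise FourierTransform BoundedContinuousFunction

noncomputable section

namespace Corners

/-- The parameter spaces `ℝᵈ` and `ℝˢ`. -/
abbrev E (d : ℕ) := EuclideanSpace ℝ (Fin d)

/-! ### Manifolds with corners, strata, faces

A manifold with corners of dimension `n` is a manifold modelled on the quadrant
`EuclideanQuadrant n = {x ∈ ℝⁿ | ∀ k, 0 ≤ x k}` with smooth transition maps. -/

section Geometry

variable (n : ℕ) (M : Type*) [TopologicalSpace M] [ChartedSpace (EuclideanQuadrant n) M]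

/-- All smooth charts of `M`. -/
abbrev smoothCharts : Set (OpenPartialHomeomorph M (EuclideanQuadrant n)) :=
  IsManifold.maximalAtlas (modelWithCornersEuclideanQuadrant n) ∞ M

variable {n M}

/-- The number `d(x)` of coordinates which vanish at `x`. -/
def depth (x : M) : ℕ :=
  {k : Fin n | (chartAt (EuclideanQuadrant n) x x).1 k = 0}.ncard

variable (n M)

/-- The points of depth `d`. The open faces of codimension `d` are its connected components;
the stratum of depth `0` is the interior `M°`. -/
def stratum (d : ℕ) : Set M := {x | depth (n := n) x = d}

variable {n M}

/-- The germ at `x` of the hypersurface `{e_k = 0}`, encoded as the filter of its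
neighbourhoods of `x`. (Two subsets have the same germ at `x` iff these filters agree.) -/
def wallGerm (e : OpenPartialHomeomorph M (EuclideanQuadrant n)) (k : Fin n) (x : M) : Filter M :=
  𝓝[{y | y ∈ e.source ∧ (e y).1 k = 0}] x

variable (n M)

/-- A frame: a point `pt` of depth `d` with a numbering by `1, …, d` of the `d` local
hyperfaces of `M` at `pt` (that is, of the coordinates which vanish there). Frames form the
principal `S_d`-bundle associated with the logarithmic normal bundles `NF` of the faces `F`
of codimension `d`: the fibre of `NF` at a point is the space of real functions on the set of
local hyperfaces at that point. -/
@[ext]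
structure Frame (d : ℕ) where
  pt : M
  idx : Fin d ↪ Fin n
  zero_iff : ∀ k, (chartAt (EuclideanQuadrant n) pt pt).1 k = 0 ↔ k ∈ range idx

variable {n M} {d : ℕ}

/-- The `i`-th local hyperface (germ) of a frame. -/
def Frame.wall (p : Frame n M d) (i : Fin d) : Filter M :=
  wallGerm (chartAt (EuclideanQuadrant n) p.pt) (p.idx i) p.pt

/-- The frames over the domain of the chart `e` for which the `i`-th hyperface is
`{e_{j i} = 0}`. -/
def sheet (e : OpenPartialHomeomorph M (EuclideanQuadrant n)) (j : Fin d ↪ Fin n) :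
    Set (Frame n M d) :=
  {p | p.pt ∈ e.source ∧ ∀ i, p.wall i = wallGerm e (j i) p.pt}

/-- The topology of the frame bundle, for which it is a covering of the stratum: a basic open
set consists of the frames over an open set which are given by one numbering of the
coordinates of one chart. -/
instance : TopologicalSpace (Frame n M d) :=
  TopologicalSpace.generateFrom
    {S | ∃ e ∈ smoothCharts n M, ∃ j : Fin d ↪ Fin n, ∃ O : Set M, IsOpen O ∧
      S = sheet e j ∩ Frame.pt ⁻¹' O}

/-- Renumbering the hyperfaces: `σ • (x, o) = (x, o ∘ σ⁻¹)`. -/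
instance : MulAction (Equiv.Perm (Fin d)) (Frame n M d) where
  smul σ p := ⟨p.pt, (σ⁻¹).toEmbedding.trans p.idx, fun k => by
    rw [p.zero_iff]
    constructor
    · rintro ⟨i, rfl⟩
      exact ⟨σ i, by simp⟩
    · rintro ⟨i, rfl⟩
      exact ⟨σ⁻¹ i, by simp⟩⟩
  one_smul p := by
    ext
    · rfl
    · rfl
  mul_smul σ τ p := by
    ext
    · rfl
    · simp [HSMul.hSMul]

@[simp]
theorem Frame.smul_pt (σ : Equiv.Perm (Fin d)) (p : Frame n M d) : (σ • p).pt = p.pt := rfl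

theorem Frame.smul_wall (σ : Equiv.Perm (Fin d)) (p : Frame n M d) (i : Fin d) :
    (σ • p).wall i = p.wall (σ⁻¹ i) := rfl

theorem Frame.continuous_smul (σ : Equiv.Perm (Fin d)) :
    Continuous (fun p : Frame n M d => σ • p) := by
  refine continuous_generateFrom_iff.2 ?_
  rintro S ⟨e, he, j, O, hO, rfl⟩
  refine TopologicalSpace.isOpen_generateFrom_of_mem
    ⟨e, he, σ.toEmbedding.trans j, O, hO, ?_⟩
  ext p
  simp only [sheet, mem_preimage, mem_inter_iff, mem_ofPred_eq, Frame.smul_pt, Frame.smul_wall]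
  refine and_congr_left fun _ => and_congr_right fun _ => ?_
  constructor
  · intro h i
    simpa using h (σ i)
  · intro h i
    simpa using h (σ⁻¹ i)

/-- The open face through the base point of a frame. -/
def face (p₀ : Frame n M d) : Set M := connectedComponentIn (stratum n M d) p₀.pt

/-- The covering `F̃ → F`: the connected component of the frame bundle through `p₀`. It is the
reduction of the frame bundle of `NF` to the minimal structure group; over `F̃` the lift of `NF`
is the trivial bundle `F̃ × ℝᵈ`, and `(x, t) ∈ F̃ × ℝᵈ` represents the vector of `NF` whose
component along the `i`-th hyperface of the frame `x` is `t i`. -/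
abbrev Cover (p₀ : Frame n M d) : Type _ := (connectedComponent p₀ : Set (Frame n M d))

/-- The structure group `S_F ⊆ S_d`: the permutations which preserve `F̃`. -/
abbrev structGroup (p₀ : Frame n M d) : Subgroup (Equiv.Perm (Fin d)) :=
  MulAction.stabilizer (Equiv.Perm (Fin d)) (connectedComponent p₀ : Set (Frame n M d))

instance (p₀ : Frame n M d) : MeasurableSpace (Cover p₀) := borel _
instance (p₀ : Frame n M d) : BorelSpace (Cover p₀) := ⟨rfl⟩

theorem Cover.continuous_smul (p₀ : Frame n M d) (σ : structGroup p₀) :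
    Continuous (fun x : Cover p₀ => σ • x) :=
  Continuous.subtype_mk ((Frame.continuous_smul (σ : Equiv.Perm (Fin d))).comp
    continuous_subtype_val) _

/-! ### The dual space `M^#` -/

/-- The face `F^#` of the dual space: the open simplex modulo the structure group. -/
def openSimplex (d : ℕ) : Type := {θ : Fin d → ℝ // (∀ i, 0 < θ i) ∧ ∑ i, θ i = 1}

/-- The dual face `F^#`: the quotient of the open simplex by the action of `S_F`. -/
def DualFace (p₀ : Frame n M d) : Type :=
  Quot fun θ θ' : openSimplex d => ∃ σ : structGroup p₀, ∀ i, θ'.1 i = θ.1 (σ.1⁻¹ i)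

variable (n M)

/-- The algebra `C(M^#)`; only the values on the interior `M°` matter. Near each point of
each chart the function has a limit `Φ(t / |t|)` as `t → ∞`, where `t k = - log e_k` for those
`k` for which the coordinate `e_k` vanishes at the point, uniformly in all other coordinates
and in the direction of `t`. (Directions are taken in the simplex `∑ t k = 1`.) -/
def dualFunctions : Set (M → ℂ) :=
  {φ | ContinuousOn φ (stratum n M 0) ∧ (∃ C : ℝ, ∀ x ∈ stratum n M 0, ‖φ x‖ ≤ C) ∧
    ∀ e ∈ smoothCharts n M, ∀ w ∈ e.source, ∀ Z : Finset (Fin n),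
      (∀ k, k ∈ Z ↔ (e w).1 k = 0) →
      ∃ O ∈ 𝓝 w, ∃ Φ : (Z → ℝ) → ℂ, Continuous Φ ∧ ∀ δ > 0, ∃ R : ℝ,
        ∀ x ∈ O ∩ e.source ∩ stratum n M 0, R < ∑ k : Z, -Real.log ((e x).1 k) →
          ‖φ x - Φ (fun k => (-Real.log ((e x).1 k)) /
            ∑ l : Z, -Real.log ((e x).1 l))‖ < δ}

variable {n M}

/-- Interior points which tend to the base point of a frame given by the coordinates `e_{j i}`,
while `(log e_{j 1} : … : log e_{j d})` tends to the point `θ` of the simplex. -/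
def approach (e : OpenPartialHomeomorph M (EuclideanQuadrant n)) (j : Fin d ↪ Fin n)
    (x : M) (θ : Fin d → ℝ) : Filter M :=
  𝓝[stratum n M 0] x ⊓
    comap (fun y i => Real.log ((e y).1 (j i)) / ∑ k, Real.log ((e y).1 (j k))) (𝓝 θ)

/-- The maximal ideal `I_z ⊆ C(M^#)` of the functions which vanish at `z ∈ F^#`. -/
def vanishingAt {p₀ : Frame n M d} (z : DualFace p₀) : Set (M → ℂ) :=
  {φ | φ ∈ dualFunctions n M ∧ ∀ θ : openSimplex d, Quot.mk _ θ = z →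
    ∀ p : Cover p₀, ∀ e ∈ smoothCharts n M, ∀ j : Fin d ↪ Fin n, p.1 ∈ sheet e j →
      Tendsto φ (approach e j p.1.pt θ.1) (𝓝 0)}

/-! ### Exponential maps -/

/-- The point of the quadrant obtained from `x` by adding `ρ i` to the coordinate `j i`. -/
def place (j : Fin d ↪ Fin n) (x : EuclideanQuadrant n) (ρ : Fin d → ℝ≥0) :
    EuclideanQuadrant n :=
  ⟨WithLp.toLp 2 fun k => x.1 k + ∑ i, if j i = k then (ρ i : ℝ) else 0, fun k =>
    add_nonneg (x.2 k) (Finset.sum_nonneg fun i _ => by split_ifs <;> simp)⟩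

/-- An exponential map of the normal bundle `N₊F` of a face into `M`, as an `S_F`-invariant map
on `F̃ × [0, ∞)ᵈ`, of which only the part `|ρ| ≤ ε` matters. It is the identity on the zero
section and maps `{ρ i = 0}` into the `i`-th hyperface. If `(e, j)` is a chart of `M` with a
numbering of `d` of its coordinates, then `(e_k, k ∉ range j)` are coordinates on the closed
face and `(e + ρ placed at j)` are coordinates on its normal bundle; the map is a smooth local
diffeomorphism on the part `|ρ| ≤ ε` of the normal bundle of the closed face, i.e. in these
coordinates it is locally the inverse of a smooth chart `Φ` of `M`. -/
structure ExpMap (p₀ : Frame n M d) where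
  toFun : Cover p₀ → (Fin d → ℝ≥0) → M
  ε : ℝ≥0
  ε_pos : 0 < ε
  zero_section : ∀ p, toFun p 0 = p.1.pt
  equivariant : ∀ (σ : structGroup p₀) (p : Cover p₀) (ρ : Fin d → ℝ≥0),
    toFun (σ • p) (fun i => ρ (σ.1⁻¹ i)) = toFun p ρ
  wall : ∀ (p : Cover p₀) (i : Fin d), Tendsto (toFun p) (𝓝[{ρ | ρ i = 0}] 0) (p.1.wall i)
  local_diffeo : ∀ e ∈ smoothCharts n M, ∀ j : Fin d ↪ Fin n, ∀ w ∈ e.source,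
    w ∈ closure {x | ∃ p : Cover p₀, p.1 ∈ sheet e j ∧ p.1.pt = x} →
    ∀ ρ₀ : Fin d → ℝ≥0, (∀ i, ρ₀ i ≤ ε) →
      ∃ Φ ∈ smoothCharts n M, place j (e w) ρ₀ ∈ Φ.target ∧
        ∀ p : Cover p₀, p.1 ∈ sheet e j → ∀ ρ : Fin d → ℝ≥0,
          place j (e p.1.pt) ρ ∈ Φ.target →
            toFun p ρ = Φ.symm (place j (e p.1.pt) ρ)

/-- The fibre coordinates `ρ = exp (-t)`. -/
def expNeg (t : E d) : Fin d → ℝ≥0 := fun i => Real.toNNReal (Real.exp (-t i))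

/-- A neighbourhood of the open face `F` in `N₊F` (as an invariant set in `F̃ × [0, ∞)ᵈ`) on
which the exponential map is one-to-one. -/
structure IsCollar {p₀ : Frame n M d} (f : ExpMap p₀) (W : Set (Cover p₀ × (Fin d → ℝ≥0))) :
    Prop where
  isOpen : IsOpen W
  zero_mem : ∀ p, (p, 0) ∈ W
  small : ∀ x ∈ W, ∀ i, x.2 i ≤ f.ε
  invariant : ∀ (σ : structGroup p₀), ∀ x ∈ W, (σ • x.1, fun i => x.2 (σ.1⁻¹ i)) ∈ W
  injective : ∀ x ∈ W, ∀ y ∈ W, f.toFun x.1 x.2 = f.toFun y.1 y.2 →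
    ∃ σ : structGroup p₀, y = (σ • x.1, fun i => x.2 (σ.1⁻¹ i))

/-- `ψ ∈ C(M^#)` is equal to `1` in a neighbourhood of `z` and vanishes outside the image of
the collar `W`. -/
structure IsCutoff {p₀ : Frame n M d} (f : ExpMap p₀) (z : DualFace p₀)
    (W : Set (Cover p₀ × (Fin d → ℝ≥0))) (ψ : M → ℂ) : Prop where
  mem : ψ ∈ dualFunctions n M
  eq_one : ∃ φ ∈ vanishingAt z, ∀ x ∈ stratum n M 0, ‖φ x‖ < 1 → ψ x = 1
  support : ∀ x ∈ stratum n M 0, ψ x ≠ 0 → ∃ y ∈ W, f.toFun y.1 y.2 = x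

end Geometry

/-! ### Measures and spaces `L²` -/

section Measures

variable {n d : ℕ} {M : Type*} [TopologicalSpace M] [ChartedSpace (EuclideanQuadrant n) M]
  [MeasurableSpace M]

/-- The part of the domain of the chart `e` where exactly the coordinates in `J` vanish. -/
def piece (e : OpenPartialHomeomorph M (EuclideanQuadrant n)) (J : Finset (Fin n)) : Set M :=
  {x | x ∈ e.source ∧ ∀ k, (e x).1 k = 0 ↔ k ∈ J}

/-- The coordinates not in `J`. -/
def coords (e : OpenPartialHomeomorph M (EuclideanQuadrant n)) (J : Finset (Fin n)) (x : M) :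
    {k // k ∉ J} → ℝ := fun k => (e x).1 k

variable (n)

/-- The measure on a face `F` of codimension `d` used for `L²(F)` (for `d = 0` and `F = M°`, the
measure on `M`): in each chart it is `h(y) ∏ (y_k)⁻¹ dy`, where `y_k` are the coordinates on the
closed face which is given by the vanishing of the coordinates in `J`, and the positive function
`h` is continuous up to the boundary. -/
structure IsCornerMeasure (d : ℕ) (F : Set M) (μ : Measure M) : Prop where
  compl_null : μ Fᶜ = 0
  density : ∀ e ∈ smoothCharts n M, ∀ J : Finset (Fin n), J.card = d →
    ∃ h : ({k // k ∉ J} → ℝ) → ℝ,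
      ContinuousOn h (coords e J '' {x | x ∈ e.source ∧ ∀ k ∈ J, (e x).1 k = 0}) ∧
      (∀ x ∈ e.source, (∀ k ∈ J, (e x).1 k = 0) → 0 < h (coords e J x)) ∧
      (μ.restrict (F ∩ piece e J)).map (coords e J) =
        (volume.restrict (coords e J '' (F ∩ piece e J))).withDensity
          fun v => ENNReal.ofReal (h v * ∏ k, (v k)⁻¹)

variable {n}

/-- The sum of the Dirac masses at the points of `F̃` over `y`. -/
def fibreMeasure (p₀ : Frame n M d) (y : M) : Measure (Cover p₀) :=
  Measure.sum fun x : {x : Cover p₀ // x.1.pt = y} => Measure.dirac x.1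

/-- The lift to the covering `F̃` of a measure on `F`. -/
def coverMeasure (p₀ : Frame n M d) (μF : Measure M) : Measure (Cover p₀) :=
  μF.bind (fibreMeasure p₀)

theorem fibreMeasure_smul (p₀ : Frame n M d) (σ : structGroup p₀) (y : M)
    {S : Set (Cover p₀)} (hS : MeasurableSet S) :
    fibreMeasure p₀ y ((fun x => σ • x) ⁻¹' S) = fibreMeasure p₀ y S := by
  have hS' : MeasurableSet ((fun x : Cover p₀ => σ • x) ⁻¹' S) :=
    (Cover.continuous_smul p₀ σ).measurable hS
  rw [fibreMeasure, Measure.sum_apply _ hS, Measure.sum_apply _ hS']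
  let g : {x : Cover p₀ // x.1.pt = y} ≃ {x : Cover p₀ // x.1.pt = y} :=
    { toFun := fun x => ⟨σ • x.1, x.2⟩
      invFun := fun x => ⟨σ⁻¹ • x.1, x.2⟩
      left_inv := fun x => by simp
      right_inv := fun x => by simp }
  rw [← g.tsum_eq (fun x => Measure.dirac x.1 S)]
  refine tsum_congr fun x => ?_
  rw [Measure.dirac_apply' _ hS, Measure.dirac_apply' _ hS']
  rfl

theorem measurePreserving_smul (p₀ : Frame n M d) (μF : Measure M) (σ : structGroup p₀) :
    MeasurePreserving (fun x : Cover p₀ => σ • x) (coverMeasure p₀ μF) (coverMeasure p₀ μF) := by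
  have hm := (Cover.continuous_smul p₀ σ).measurable
  refine ⟨hm, ?_⟩
  by_cases h : AEMeasurable (fibreMeasure p₀) μF
  · ext S hS
    rw [Measure.map_apply hm hS, coverMeasure, Measure.bind_apply (hm hS) h,
      Measure.bind_apply hS h]
    simp only [fibreMeasure_smul p₀ σ _ hS]
  · have h0 : coverMeasure p₀ μF = 0 := by
      rw [coverMeasure, Measure.bind, Measure.map_of_not_aemeasurable h, Measure.join_zero]
    simp [h0]

theorem fibreMeasure_univ_le (p₀ : Frame n M d) (y : M) :
    fibreMeasure p₀ y univ ≤ Fintype.card (Fin d ↪ Fin n) := by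
  let g : {x : Cover p₀ // x.1.pt = y} → (Fin d ↪ Fin n) := fun x => x.1.1.idx
  have hg : Function.Injective g := by
    rintro ⟨⟨x, hx⟩, hxy⟩ ⟨⟨x', hx'⟩, hxy'⟩ h
    have h1 : x = x' := Frame.ext (hxy.trans hxy'.symm) h
    subst h1
    rfl
  have : Finite {x : Cover p₀ // x.1.pt = y} := Finite.of_injective g hg
  have := Fintype.ofFinite {x : Cover p₀ // x.1.pt = y}
  rw [fibreMeasure, Measure.sum_apply _ MeasurableSet.univ]
  simp only [measure_univ, tsum_fintype, Finset.sum_const, nsmul_eq_mul, mul_one]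
  exact_mod_cast Fintype.card_le_of_injective g hg

instance (p₀ : Frame n M d) (μF : Measure M) [SFinite μF] : SFinite (coverMeasure p₀ μF) := by
  by_cases h : AEMeasurable (fibreMeasure p₀) μF
  · have hs : coverMeasure p₀ μF
        = Measure.sum fun i => (sfiniteSeq μF i).bind (fibreMeasure p₀) := by
      rw [← Measure.bind_sum]
      · rw [sum_sfiniteSeq, coverMeasure]
      · rwa [sum_sfiniteSeq]
    have hf : ∀ i, IsFiniteMeasure ((sfiniteSeq μF i).bind (fibreMeasure p₀)) := fun i => by
      refine ⟨(Measure.bind_apply_le _ MeasurableSet.univ).trans_lt ?_⟩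
      refine (lintegral_mono fun y => fibreMeasure_univ_le p₀ y).trans_lt ?_
      rw [lintegral_const]
      exact ENNReal.mul_lt_top (by simp) (measure_lt_top _ _)
    rw [hs]
    infer_instance
  · have h0 : coverMeasure p₀ μF = 0 := by
      rw [coverMeasure, Measure.bind, Measure.map_of_not_aemeasurable h, Measure.join_zero]
    rw [h0]
    infer_instance

/-- The space `L²(M)` of a measure on `M`. -/
abbrev L2 (μ : Measure M) := Lp ℂ 2 μ

/-- The space `L²(F̃)`. -/
abbrev L2Cover (p₀ : Frame n M d) (μF : Measure M) := Lp ℂ 2 (coverMeasure p₀ μF)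

/-- The product of the measure on `F̃` and Lebesgue measure on `ℝᵈ`. -/
abbrev liftMeasure (p₀ : Frame n M d) (μF : Measure M) : Measure (Cover p₀ × E d) :=
  (coverMeasure p₀ μF).prod volume

/-- The space `L²(F̃ × ℝᵈ)` of the lift of `NF` to `F̃`. -/
abbrev L2Lift (p₀ : Frame n M d) (μF : Measure M) := Lp ℂ 2 (liftMeasure p₀ μF)

/-- The action of permutations on `ℝᵈ`: `(σ t) i = t (σ⁻¹ i)`. -/
def permVec (σ : Equiv.Perm (Fin d)) : E d ≃ₗᵢ[ℝ] E d :=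
  LinearIsometryEquiv.piLpCongrLeft 2 ℝ ℝ σ

theorem permVec_apply (σ : Equiv.Perm (Fin d)) (t : E d) (i : Fin d) :
    permVec σ t i = t (σ⁻¹ i) := by
  simp [permVec, LinearIsometryEquiv.piLpCongrLeft_apply, Equiv.piCongrLeft']

/-- The action of `S_F` on `L²(F̃)`: `(S_σ u)(x) = u(σ⁻¹ x)`. -/
def permCover (p₀ : Frame n M d) (μF : Measure M) (σ : structGroup p₀) :
    L2Cover p₀ μF →L[ℂ] L2Cover p₀ μF :=
  (Lp.compMeasurePreservingₗᵢ ℂ _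
    (measurePreserving_smul p₀ μF σ⁻¹)).toContinuousLinearMap

theorem measurePreserving_permLift (p₀ : Frame n M d) (μF : Measure M) [SFinite μF]
    (σ : structGroup p₀) :
    MeasurePreserving (Prod.map (fun x : Cover p₀ => σ • x) (permVec (d := d) σ.1))
      (liftMeasure p₀ μF) (liftMeasure p₀ μF) :=
  (measurePreserving_smul p₀ μF σ).prod (permVec (d := d) σ.1).measurePreserving

theorem measurePreserving_shift (p₀ : Frame n M d) (μF : Measure M) [SFinite μF] (a : E d) :
    MeasurePreserving (Prod.map (id : Cover p₀ → Cover p₀) (fun t : E d => t + a))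
      (liftMeasure p₀ μF) (liftMeasure p₀ μF) :=
  (MeasurePreserving.id _).prod (measurePreserving_add_right volume a)

variable (p₀ : Frame n M d) (μF : Measure M) [SFinite μF]

/-- The action of `S_F` on `L²(F̃ × ℝᵈ)`: `(T_σ u)(x, t) = u(σ⁻¹ x, σ⁻¹ t)`. -/
def permLift (σ : structGroup p₀) : L2Lift p₀ μF →L[ℂ] L2Lift p₀ μF :=
  (Lp.compMeasurePreservingₗᵢ ℂ _
    (measurePreserving_permLift p₀ μF σ⁻¹)).toContinuousLinearMap

/-- The translations on `L²(F̃ × ℝᵈ)`: `u(x, t) ↦ u(x, t + a)`. -/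
def shift (a : E d) : L2Lift p₀ μF →L[ℂ] L2Lift p₀ μF :=
  (Lp.compMeasurePreservingₗᵢ ℂ _ (measurePreserving_shift p₀ μF a)).toContinuousLinearMap

/-- The space `L²(NF)`, as the subspace of `S_F`-invariant functions in `L²(F̃ × ℝᵈ)`. -/
def L2Normal : Submodule ℂ (L2Lift p₀ μF) where
  carrier := {u | ∀ σ, permLift p₀ μF σ u = u}
  add_mem' hu hv σ := by rw [map_add, hu σ, hv σ]
  zero_mem' σ := map_zero _
  smul_mem' c u hu σ := by rw [map_smul, hu σ]

/-! ### Translation-invariant operators and their symbols -/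

/-- `T` is an `S_F`-invariant and translation-invariant bounded operator on `L²(F̃ × ℝᵈ)` whose
restriction to `L²(NF)` is `A`. -/
structure IsInvariantLift (A : L2Normal p₀ μF →L[ℂ] L2Normal p₀ μF)
    (T : L2Lift p₀ μF →L[ℂ] L2Lift p₀ μF) : Prop where
  perm : ∀ σ u, T (permLift p₀ μF σ u) = permLift p₀ μF σ (T u)
  shift : ∀ a u, T (shift p₀ μF a u) = shift p₀ μF a (T u)
  restrict : ∀ u : L2Normal p₀ μF, T u = (A u : L2Lift p₀ μF)

/-- Translation-invariant operators on `L²(NF)`. -/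
def IsTranslationInvariant (A : L2Normal p₀ μF →L[ℂ] L2Normal p₀ μF) : Prop :=
  ∃ T, IsInvariantLift p₀ μF A T

theorem memLp_tensor (u : L2Cover p₀ μF) (f : Lp ℂ 2 (volume : Measure (E d))) :
    MemLp (fun x : Cover p₀ × E d => u x.1 * f x.2) 2 (liftMeasure p₀ μF) := by
  have hu := Lp.memLp u
  have hf := Lp.memLp f
  have hm : AEStronglyMeasurable (fun x : Cover p₀ × E d => u x.1 * f x.2)
      (liftMeasure p₀ μF) := hu.1.comp_fst.mul hf.1.comp_snd
  rw [memLp_two_iff_integrable_sq_norm hm]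
  have h1 := (memLp_two_iff_integrable_sq_norm hu.1).1 hu
  have h2 := (memLp_two_iff_integrable_sq_norm hf.1).1 hf
  simpa [mul_pow] using h1.mul_prod h2

/-- The function `u(x) f(t)`. -/
def tensor (u : L2Cover p₀ μF) (f : Lp ℂ 2 (volume : Measure (E d))) : L2Lift p₀ μF :=
  (memLp_tensor p₀ μF u f).toLp

/-- `T = b(-i ∂/∂t)`: the bounded, strongly measurable operator function `b` on `ℝᵈ` with values
in `B(L²(F̃))` is such that `T` is the multiplication by `b` after the Fourier transform in `t`;
this is written out for the matrix elements of `T` between the functions `u(x) f(t)`, whose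
span is dense. (With `𝓕 f(ξ) = ∫ exp(-2πi⟨t, ξ⟩) f(t) dt`, the operator `-i ∂/∂t` is the
multiplication by `2πξ`.) -/
structure IsSymbol (T : L2Lift p₀ μF →L[ℂ] L2Lift p₀ μF)
    (b : E d → (L2Cover p₀ μF →L[ℂ] L2Cover p₀ μF)) : Prop where
  bounded : ∃ C : ℝ, ∀ ξ, ‖b ξ‖ ≤ C
  measurable : ∀ u, AEStronglyMeasurable (fun ξ => b ξ u) volume
  eq : ∀ (u v : L2Cover p₀ μF) (f g : Lp ℂ 2 (volume : Measure (E d))),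
    inner ℂ (tensor p₀ μF v g) (T (tensor p₀ μF u f)) =
      ∫ ξ : E d, inner ℂ ((𝓕 g : Lp ℂ 2 (volume : Measure (E d))) ξ)
        ((𝓕 f : Lp ℂ 2 (volume : Measure (E d))) ξ) *
        inner ℂ v (b ((2 * Real.pi) • ξ) u)

end Measures

/-! ### Local operators with a parameter -/

section Local

variable (n : ℕ) {d : ℕ} (s : ℕ) {M : Type*} [TopologicalSpace M]
  [ChartedSpace (EuclideanQuadrant n) M] [MeasurableSpace M] (μ : Measure M)

/-- Bounded norm-continuous operator families on `L²(M)` with parameter in `ℝˢ`. -/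
abbrev OpFamily := E s →ᵇ (L2 μ →L[ℂ] L2 μ)

variable {s}

/-- `T` is the operator of multiplication by the function `φ`. -/
def IsMultiplication (φ : M → ℂ) (T : L2 μ →L[ℂ] L2 μ) : Prop :=
  ∀ u : L2 μ, T u =ᵐ[μ] fun x => φ x * u x

variable (s)

/-- The ideal `J` of compact-valued families which decay in norm at infinity. -/
def compactFamilies : Set (OpFamily s μ) :=
  {K | (∀ q, IsCompactOperator (K q)) ∧ Tendsto K (cocompact (E s)) (𝓝 0)}

/-- The algebra of families which are local with respect to the action of `C(M^#)`. -/
def localFamilies : Set (OpFamily s μ) :=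
  {A | ∀ φ ∈ dualFunctions n M, ∀ T, IsMultiplication μ φ T →
    A * BoundedContinuousFunction.const _ T - BoundedContinuousFunction.const _ T * A
      ∈ compactFamilies s μ}

/-- The local families of slow compact variation. -/
def slowFamilies : Set (OpFamily s μ) :=
  {A | A ∈ localFamilies n s μ ∧ (∀ q q', IsCompactOperator (A q - A q')) ∧
    ∀ δ > 0, ∀ η > 0, ∃ R > 0, ∀ q q' : E s, ‖q - q'‖ < δ → R < ‖q‖ → ‖A q - A q'‖ ≤ η}

variable {n}

/-- The closed two-sided ideal `J_z` in the algebra of local families which is generated by the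
functions in `C(M^#)` vanishing at `z`. The local algebra at `z` is the quotient by `J_z`. -/
def localIdeal {p₀ : Frame n M d} (z : DualFace p₀) : Set (OpFamily s μ) :=
  closure (Submodule.span ℂ {X : OpFamily s μ | ∃ B ∈ localFamilies n s μ,
    ∃ C ∈ localFamilies n s μ, ∃ φ ∈ vanishingAt z, ∃ T, IsMultiplication μ φ T ∧
      X = B * BoundedContinuousFunction.const _ T * C} : Set (OpFamily s μ))

variable {s}
variable {p₀ : Frame n M d} (μF : Measure M) [SFinite μF]

open Classical in
/-- `P : L²(M) → L²(NF)` is the multiplication by the cutoff function `ψ` followed by the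
pullback by the map `(x, t) ↦ f(x, exp(-t))` (on the collar `W`), and `Q : L²(NF) → L²(M)` is the
push-forward by this map followed by the multiplication by `ψ`. -/
structure IsTransport (f : ExpMap p₀) (W : Set (Cover p₀ × (Fin d → ℝ≥0))) (ψ : M → ℂ)
    (P : L2 μ →L[ℂ] L2Normal p₀ μF) (Q : L2Normal p₀ μF →L[ℂ] L2 μ) : Prop where
  pull : ∀ u : L2 μ, ((P u : L2Lift p₀ μF) : Cover p₀ × E d → ℂ) =ᵐ[liftMeasure p₀ μF]
    fun y => if (y.1, expNeg y.2) ∈ W then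
      ψ (f.toFun y.1 (expNeg y.2)) * u (f.toFun y.1 (expNeg y.2)) else 0
  push : ∀ v : L2Normal p₀ μF, ∀ᵐ y ∂(liftMeasure p₀ μF), (y.1, expNeg y.2) ∈ W →
    Q v (f.toFun y.1 (expNeg y.2)) =
      ψ (f.toFun y.1 (expNeg y.2)) * (v : L2Lift p₀ μF) y
  push_zero : ∀ v : L2Normal p₀ μF, ∀ᵐ x ∂μ, (∀ y ∈ W, f.toFun y.1 y.2 ≠ x) → Q v x = 0

/-- The family `A₁` on `L²(NF)` is a translation-invariant infinitesimal operator of `A` at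
`z ∈ F^#`: its values are translation invariant, and, transported to `M` near `z` by the
exponential map, it is a local family which lies in the same coset modulo `J_z` as `A`. -/
structure IsInfinitesimal (f : ExpMap p₀) (z : DualFace p₀) (A : OpFamily s μ)
    (A₁ : E s →ᵇ (L2Normal p₀ μF →L[ℂ] L2Normal p₀ μF)) : Prop where
  invariant : ∀ q, IsTranslationInvariant p₀ μF (A₁ q)
  same_coset : ∃ W ψ P Q, IsCollar f W ∧ IsCutoff f z W ψ ∧ IsTransport μ μF f W ψ P Q ∧
    ∃ A' ∈ localFamilies n s μ, (∀ q, A' q = Q.comp ((A₁ q).comp P)) ∧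
      A - A' ∈ localIdeal s μ z

/-- `B` is a face symbol `σ_z(A)`: the symbol of a translation-invariant infinitesimal operator
of `A` at `z`, a bounded function on `ℝᵈ × ℝˢ`. -/
def IsFaceSymbol (f : ExpMap p₀) (z : DualFace p₀) (A : OpFamily s μ)
    (B : E d × E s → (L2Cover p₀ μF →L[ℂ] L2Cover p₀ μF)) : Prop :=
  (∃ C : ℝ, ∀ x, ‖B x‖ ≤ C) ∧
  ∃ A₁, IsInfinitesimal μ μF f z A A₁ ∧ ∀ q, ∃ T, IsInvariantLift p₀ μF (A₁ q) T ∧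
    IsSymbol p₀ μF T fun ξ => B (ξ, q)

end Local

end Corners

end

open Corners

/-! Uniqueness is proved by sending functions off to infinity in the direction of z. Fix θ in the
open simplex representing z. For u in L²(NF) let N_R u (`normalShift`) be the sum over S_F of the
translates of u by Rσθ. It is again invariant, and every translation-invariant operator commutes
with N_R. Carried over to M by a push-forward Q, the family Q N_R u is bounded, tends weakly to
zero, and concentrates at z: multiplication by a function vanishing at z sends it to zero in norm
(`tendsto_multiplication_push`). Local families commute with such functions up to compact operators,
and compact operators send bounded weakly null families to norm null ones, so every element of J_z
annihilates Q N_R u in the limit (`tendsto_apply_of_mem_localIdeal`).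

Near z all cutoffs are 1, so pulling back what was pushed forward is asymptotically the identity on
N_R u, even for two different collars and cutoffs (`tendsto_pull_push`). Hence, if A₁ and A₁' are
both infinitesimal operators, N_R(A₁u − A₁'u) tends to zero. Pairing N_R w with a single translate
of w has as limit a positive multiple of ‖w‖², since translates along different directions become
orthogonal (`tendsto_inner_shift_symmShift`); therefore A₁u = A₁'u.

The same asymptotic orthogonality, along a direction with trivial stabilizer, bounds an invariant
lift by |S_F| times the norm of the operator it lifts (`IsInvariantLift.norm_le`). So the lift is
unique and is bounded uniformly in q.

For the symbol, each matrix element of a translation-invariant operator is a scalar Fourier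
multiplier (`exists_multiplier`, `exists_matrix_element`). These scalars are assembled into one
operator function by averaging over shrinking balls and taking a weak limit along an ultrafilter at
every ξ; Lebesgue differentiation identifies its matrix elements almost everywhere
(`exists_isSymbol`). Separability of L²(F̃) gives strong measurability and almost everywhere
uniqueness. Invariance follows from uniqueness, as conjugating the symbol by a renumbering gives
another symbol of the same operator.

The geometric part supplies two facts: translation along θ really approaches z on M
(`tendsto_expPoint_approach`), and the exponential map carries null sets to null sets in both
directions (`liftMeasure_preimage_expPoint`, `measure_image_expPoint`). -/

noncomputable section

namespace Corners

/-! ### Multiplication by bounded functions on L². -/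

section Multiplication

variable {α : Type*} [MeasurableSpace α] {ν : Measure α}

/-- Dominated convergence: the integrand is majorized by (C‖u‖)², which is integrable. -/
theorem tendsto_eLpNorm_mul_of_tendsto_zero {ι : Type*} {l : Filter ι} [l.IsCountablyGenerated]
    {χ : ι → α → ℂ} (hm : ∀ i, AEStronglyMeasurable (χ i) ν) {C : ℝ≥0}
    (hC : ∀ i y, ‖χ i y‖₊ ≤ C) (h : ∀ y, Tendsto (fun i => χ i y) l (𝓝 0)) {u : α → ℂ}
    (hu : MemLp u 2 ν) : Tendsto (fun i => eLpNorm (fun y => χ i y * u y) 2 ν) l (𝓝 0) := by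
  have h2 : (2 : ℝ≥0∞) ≠ 0 := by norm_num
  have h2' : (2 : ℝ≥0∞) ≠ ⊤ := by norm_num
  simp only [eLpNorm_eq_lintegral_rpow_enorm_toReal h2 h2']
  have key : Tendsto (fun i => ∫⁻ y, ‖χ i y * u y‖ₑ ^ (2 : ℝ≥0∞).toReal ∂ν) l
      (𝓝 (∫⁻ _, 0 ∂ν)) := by
    refine tendsto_lintegral_filter_of_dominated_convergence'
      (fun y => ((C : ℝ≥0∞) * ‖u y‖ₑ) ^ (2 : ℝ≥0∞).toReal)
      (Eventually.of_forall fun i => ((hm i).mul hu.1).enorm.pow_const _)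
      (Eventually.of_forall fun i => Eventually.of_forall fun y => ?_) ?_
      (Eventually.of_forall fun y => ?_)
    · rw [enorm_mul]
      gcongr
      exact_mod_cast hC i y
    · have := hu.2
      rw [eLpNorm_lt_top_iff_lintegral_rpow_enorm_lt_top h2 h2'] at this
      simp only [ENNReal.mul_rpow_of_nonneg _ _ ENNReal.toReal_nonneg]
      rw [lintegral_const_mul' _ _ (by simp)]
      exact ENNReal.mul_ne_top (by simp) this.ne
    · have : Tendsto (fun i => χ i y * u y) l (𝓝 0) := by simpa using (h y).mul_const (u y)
      have h3 := (continuous_enorm.tendsto _).comp this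
      have h4 := ((ENNReal.continuous_rpow_const (y := (2 : ℝ≥0∞).toReal)).tendsto _).comp h3
      simpa [Function.comp_def] using h4
  have h4 := ((ENNReal.continuous_rpow_const (y := 1 / (2 : ℝ≥0∞).toReal)).tendsto _).comp key
  simpa [Function.comp_def] using h4

/-- Bounded measurable functions. -/
structure IsBddMeas (ν : Measure α) (χ : α → ℂ) : Prop where
  meas : AEStronglyMeasurable χ ν
  bdd : ∃ C : ℝ≥0, ∀ y, ‖χ y‖₊ ≤ C

theorem IsBddMeas.memLp {χ : α → ℂ} (h : IsBddMeas ν χ) (u : Lp ℂ 2 ν) :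
    MemLp (fun y => χ y * u y) 2 ν := by
  obtain ⟨C, hC⟩ := h.bdd
  exact (Lp.memLp u).of_le_mul (c := C) (h.meas.mul (Lp.memLp u).1)
    (Eventually.of_forall fun y => by
      rw [norm_mul]
      gcongr
      exact_mod_cast hC y)

/-- The product of a bounded measurable function and an element of `L²`. -/
def mulLp {χ : α → ℂ} (h : IsBddMeas ν χ) (u : Lp ℂ 2 ν) : Lp ℂ 2 ν := (h.memLp u).toLp

theorem mulLp_ae {χ : α → ℂ} (h : IsBddMeas ν χ) (u : Lp ℂ 2 ν) :
    mulLp h u =ᵐ[ν] fun y => χ y * u y := (h.memLp u).coeFn_toLp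

theorem tendsto_norm_iff_eLpNorm {ι : Type*} {l : Filter ι} {w : ι → Lp ℂ 2 ν} {F : ι → α → ℂ}
    (hF : ∀ i, w i =ᵐ[ν] F i) (h : Tendsto (fun i => eLpNorm (F i) 2 ν) l (𝓝 0)) :
    Tendsto w l (𝓝 0) := by
  rw [tendsto_zero_iff_norm_tendsto_zero]
  have := (ENNReal.tendsto_toReal (by simp : (0 : ℝ≥0∞) ≠ ⊤)).comp h
  refine this.congr fun i => ?_
  rw [Lp.norm_def, eLpNorm_congr_ae (hF i)]
  rfl

end Multiplication

/-! ### Weakly null families and compact operators. -/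

section Weak

variable {H : Type*} [NormedAddCommGroup H] [InnerProductSpace ℂ H]

/-- The uniform bound makes the pairings equicontinuous in v. This allows weak convergence to be
tested on a dense set. -/
theorem isClosed_setOf_tendsto_inner {ι : Type*} {l : Filter ι} {w : ι → H} {C : ℝ}
    (hC : ∀ i, ‖w i‖ ≤ C) :
    IsClosed {v : H | Tendsto (fun i => inner ℂ v (w i)) l (𝓝 0)} := by
  rw [← isSeqClosed_iff_isClosed]
  intro v v₀ hv hv₀
  simp only [mem_ofPred_eq] at hv ⊢
  have hC' : ∀ i, ‖w i‖ ≤ |C| + 1 := fun i => by linarith [hC i, le_abs_self C]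
  rw [Metric.tendsto_nhds]
  intro ε hε
  have hpos : 0 < |C| + 1 := by positivity
  obtain ⟨k, hk⟩ := ((Metric.tendsto_nhds.1 hv₀) (ε / 2 / (|C| + 1)) (by positivity)).exists
  filter_upwards [(Metric.tendsto_nhds.1 (hv k)) (ε / 2) (by positivity)] with i hi
  rw [dist_zero_right] at hi ⊢
  have h1 : inner ℂ v₀ (w i) = inner ℂ (v k) (w i) - inner ℂ (v k - v₀) (w i) := by
    rw [inner_sub_left]; ring
  rw [h1]
  -- The strict estimate below multiplies by ‖w i‖, which therefore has to be nonzero.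
  have h2 : ‖inner ℂ (v k - v₀) (w i)‖ < ε / 2 ∨ w i = 0 := by
    by_cases h0 : w i = 0
    · exact Or.inr h0
    left
    calc ‖inner ℂ (v k - v₀) (w i)‖ ≤ ‖v k - v₀‖ * ‖w i‖ := norm_inner_le_norm _ _
      _ < ε / 2 / (|C| + 1) * ‖w i‖ := by
        gcongr
        · rw [← dist_eq_norm]; exact hk
      _ ≤ ε / 2 / (|C| + 1) * (|C| + 1) := by gcongr; exact hC' i
      _ = ε / 2 := by field_simp
  rcases h2 with h2 | h2
  · calc _ ≤ _ := norm_sub_le _ _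
      _ < ε := by linarith
  · simpa [h2] using hε

/-- Compact operators map bounded weak null families to norm null families. -/
theorem tendsto_zero_of_isCompactOperator [CompleteSpace H] {K : H →L[ℂ] H} (hK : IsCompactOperator K)
    {ι : Type*} {l : Filter ι} {w : ι → H} {C : ℝ} (hC : ∀ i, ‖w i‖ ≤ C)
    (hw : ∀ v, Tendsto (fun i => inner ℂ v (w i)) l (𝓝 0)) :
    Tendsto (fun i => K (w i)) l (𝓝 0) := by
  obtain ⟨S, hS, hKS⟩ := hK.image_subset_compact_of_bounded
    (S := Metric.closedBall (0 : H) C) Metric.isBounded_closedBall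
  refine hS.tendsto_nhds_of_unique_mapClusterPt
    (Eventually.of_forall fun i => hKS ⟨w i, by simpa using hC i, rfl⟩) ?_
  intro y _ hy
  -- A cluster point y is zero: ⟨y, K w⟩ clusters at ⟨y, y⟩, and it tends to zero because it equals
  -- ⟨K*y, w⟩.
  have h1 : MapClusterPt (inner ℂ y y) l (fun i => inner ℂ y (K (w i))) :=
    hy.continuousAt_comp (f := fun x => inner ℂ y x)
      (Continuous.inner continuous_const continuous_id).continuousAt
  have h2 : Tendsto (fun i => inner ℂ y (K (w i))) l (𝓝 0) := by
    refine (hw (ContinuousLinearMap.adjoint K y)).congr fun i => ?_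
    rw [ContinuousLinearMap.adjoint_inner_left]
  have h3 : inner ℂ y y = (0 : ℂ) := by
    by_contra hne
    have := (disjoint_nhds_nhds.2 hne).mono_right h2
    exact h1.clusterPt.neBot.ne this.eq_bot
  simpa using h3

end Weak

end Corners

namespace Corners

/-! ### Translations, renumberings, and their asymptotic orthogonality. -/

section Translations

variable {n d : ℕ} {M : Type*} [TopologicalSpace M] [ChartedSpace (EuclideanQuadrant n) M]
  [MeasurableSpace M] {p₀ : Frame n M d} {μF : Measure M} [SFinite μF]

theorem shift_ae (a : E d) (u : L2Lift p₀ μF) :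
    shift p₀ μF a u =ᵐ[liftMeasure p₀ μF] fun y => u (y.1, y.2 + a) :=
  Lp.coeFn_compMeasurePreserving u (measurePreserving_shift p₀ μF a)

theorem permLift_ae (σ : structGroup p₀) (u : L2Lift p₀ μF) :
    permLift p₀ μF σ u =ᵐ[liftMeasure p₀ μF]
      fun y => u (σ⁻¹ • y.1, permVec (d := d) (σ⁻¹ : structGroup p₀).1 y.2) :=
  Lp.coeFn_compMeasurePreserving u (measurePreserving_permLift p₀ μF σ⁻¹)

theorem norm_shift (a : E d) (u : L2Lift p₀ μF) : ‖shift p₀ μF a u‖ = ‖u‖ :=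
  Lp.norm_compMeasurePreserving u (measurePreserving_shift p₀ μF a)

theorem norm_permLift (σ : structGroup p₀) (u : L2Lift p₀ μF) : ‖permLift p₀ μF σ u‖ = ‖u‖ :=
  Lp.norm_compMeasurePreserving u (measurePreserving_permLift p₀ μF σ⁻¹)

theorem inner_shift_shift (a : E d) (u v : L2Lift p₀ μF) :
    inner ℂ (shift p₀ μF a u) (shift p₀ μF a v) = inner ℂ u v :=
  (Lp.compMeasurePreservingₗᵢ ℂ _ (measurePreserving_shift p₀ μF a)).inner_map_map u v

theorem inner_permLift_permLift (σ : structGroup p₀) (u v : L2Lift p₀ μF) :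
    inner ℂ (permLift p₀ μF σ u) (permLift p₀ μF σ v) = inner ℂ u v :=
  (Lp.compMeasurePreservingₗᵢ ℂ _ (measurePreserving_permLift p₀ μF σ⁻¹)).inner_map_map u v

theorem compMeasurePreserving_congr {α : Type*} [MeasurableSpace α] {ν : Measure α} {f g : α → α}
    (hf : MeasurePreserving f ν ν) (hg : MeasurePreserving g ν ν) (h : f = g) (u : Lp ℂ 2 ν) :
    Lp.compMeasurePreserving f hf u = Lp.compMeasurePreserving g hg u := by
  subst h; rfl

theorem permVec_mul (σ τ : Equiv.Perm (Fin d)) (t : E d) :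
    permVec (σ * τ) t = permVec σ (permVec τ t) := by
  ext i
  simp only [permVec_apply, mul_inv_rev, Equiv.Perm.mul_apply]

theorem permVec_one (t : E d) : permVec (1 : Equiv.Perm (Fin d)) t = t := by
  ext i
  simp only [permVec_apply, inv_one, Equiv.Perm.one_apply]

theorem shift_shift (a b : E d) (u : L2Lift p₀ μF) :
    shift p₀ μF a (shift p₀ μF b u) = shift p₀ μF (a + b) u := by
  have h := Lp.compMeasurePreserving_comp_apply u (measurePreserving_shift p₀ μF b)
    (measurePreserving_shift p₀ μF a)
  refine h.symm.trans (compMeasurePreserving_congr _ _ ?_ u)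
  funext y
  refine Prod.ext ?_ ?_
  · rfl
  · simp [add_assoc]

theorem shift_zero (u : L2Lift p₀ μF) : shift p₀ μF 0 u = u := by
  refine (compMeasurePreserving_congr _ (MeasurePreserving.id _) ?_ u).trans
    (Lp.compMeasurePreserving_id_apply u)
  funext y
  refine Prod.ext ?_ ?_
  · rfl
  · simp

theorem permLift_permLift (σ τ : structGroup p₀) (u : L2Lift p₀ μF) :
    permLift p₀ μF σ (permLift p₀ μF τ u) = permLift p₀ μF (σ * τ) u := by
  have h := Lp.compMeasurePreserving_comp_apply u (measurePreserving_permLift p₀ μF τ⁻¹)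
    (measurePreserving_permLift p₀ μF σ⁻¹)
  refine h.symm.trans (compMeasurePreserving_congr _ _ ?_ u)
  funext y
  refine Prod.ext ?_ ?_
  · simp [mul_smul]
  · simp [permVec_mul]

theorem permLift_one (u : L2Lift p₀ μF) : permLift p₀ μF 1 u = u := by
  refine (compMeasurePreserving_congr _ (MeasurePreserving.id _) ?_ u).trans
    (Lp.compMeasurePreserving_id_apply u)
  funext y
  refine Prod.ext ?_ ?_
  · simp
  · simp [permVec_one]

/-- The semidirect product relation between S_F and ℝᵈ; it is the reason why a sum over S_F of
translates appears instead of a single translation. -/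
theorem permLift_shift (σ : structGroup p₀) (a : E d) (u : L2Lift p₀ μF) :
    permLift p₀ μF σ (shift p₀ μF a u)
      = shift p₀ μF (permVec (d := d) σ.1 a) (permLift p₀ μF σ u) := by
  have h1 := Lp.compMeasurePreserving_comp_apply u (measurePreserving_shift p₀ μF a)
    (measurePreserving_permLift p₀ μF σ⁻¹)
  have h2 := Lp.compMeasurePreserving_comp_apply u (measurePreserving_permLift p₀ μF σ⁻¹)
    (measurePreserving_shift p₀ μF (permVec (d := d) σ.1 a))
  refine h1.symm.trans (Eq.trans (compMeasurePreserving_congr _ _ ?_ u) h2)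
  funext y
  refine Prod.ext ?_ ?_
  · simp
  · simp [← permVec_mul, permVec_one]

/-- A bounded function tending to zero along a direction annihilates in the limit the functions
translated in this direction. -/
theorem tendsto_mulLp_shift {χ : Cover p₀ × E d → ℂ} (hχ : IsBddMeas (liftMeasure p₀ μF) χ)
    (a : E d) (h : ∀ y : Cover p₀ × E d, Tendsto (fun R : ℝ => χ (y.1, y.2 + R • a)) atTop (𝓝 0))
    (u : L2Lift p₀ μF) :
    Tendsto (fun R : ℝ => mulLp hχ (shift p₀ μF (-(R • a)) u)) atTop (𝓝 0) := by
  obtain ⟨C, hC⟩ := hχ.bdd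
  refine tendsto_norm_iff_eLpNorm (fun R => mulLp_ae hχ _) ?_
  -- By invariance of the measure the translation can be moved from u to χ, and then u is fixed and
  -- χ tends to zero pointwise.
  have key := tendsto_eLpNorm_mul_of_tendsto_zero (ν := liftMeasure p₀ μF) (l := atTop)
    (χ := fun (R : ℝ) y => χ (y.1, y.2 + R • a)) (C := C)
    (fun R => hχ.meas.comp_measurePreserving (measurePreserving_shift p₀ μF (R • a)))
    (fun R y => hC _) h (Lp.memLp u)
  refine key.congr fun R => ?_
  have hm : AEStronglyMeasurable (fun y => χ y * shift p₀ μF (-(R • a)) u y)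
      (liftMeasure p₀ μF) := hχ.meas.mul (Lp.memLp _).1
  rw [← eLpNorm_comp_measurePreserving hm (measurePreserving_shift p₀ μF (R • a))]
  refine eLpNorm_congr_ae ?_
  have h1 := (measurePreserving_shift p₀ μF (R • a)).quasiMeasurePreserving.ae
    (shift_ae (-(R • a)) u)
  filter_upwards [h1] with y hy
  simp only [Function.comp_apply, hy]
  simp only [Prod.map_fst, Prod.map_snd, id_eq, add_neg_cancel_right]
  rfl

theorem tendsto_norm_add_smul_atTop (t : E d) {a : E d} (ha : a ≠ 0) :
    Tendsto (fun R : ℝ => ‖t + R • a‖) atTop atTop := by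
  have ha' : 0 < ‖a‖ := norm_pos_iff.2 ha
  refine tendsto_atTop_mono' atTop (f₁ := fun R => R * ‖a‖ - ‖t‖) ?_ ?_
  · filter_upwards [eventually_ge_atTop 0] with R hR
    have := norm_sub_norm_le (R • a) (-t)
    rw [norm_smul, Real.norm_of_nonneg hR, norm_neg, sub_neg_eq_add, add_comm (R • a)] at this
    exact this
  · exact tendsto_atTop_add_const_right _ _ (tendsto_id.atTop_mul_const ha')

/-- Translations to infinity tend weakly to zero. -/
theorem tendsto_inner_shift {a : E d} (ha : a ≠ 0) (v u : L2Lift p₀ μF) :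
    Tendsto (fun R : ℝ => inner ℂ v (shift p₀ μF (-(R • a)) u)) atTop (𝓝 0) := by
  have hcl := isClosed_setOf_tendsto_inner (l := atTop)
    (w := fun R : ℝ => shift p₀ μF (-(R • a)) u) (C := ‖u‖) (fun R => (norm_shift _ _).le)
  -- Functions supported in bounded t are dense, and a translate leaves every such region.
  let χ : ℕ → Cover p₀ × E d → ℂ := fun k => {y | ‖y.2‖ ≤ k}.indicator 1
  have hmeas : ∀ k : ℕ, MeasurableSet {y : Cover p₀ × E d | ‖y.2‖ ≤ k} := fun k =>
    measurableSet_le measurable_snd.norm measurable_const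
  have hb : ∀ k y, ‖χ k y‖₊ ≤ 1 := fun k y => by
    by_cases hy : y ∈ {y : Cover p₀ × E d | ‖y.2‖ ≤ k} <;> simp [χ, hy]
  have hχ : ∀ k, IsBddMeas (liftMeasure p₀ μF) (χ k) := fun k =>
    ⟨(stronglyMeasurable_one.indicator (hmeas k)).aestronglyMeasurable, 1, hb k⟩
  have hmem : ∀ k, mulLp (hχ k) v ∈
      {v | Tendsto (fun R : ℝ => inner ℂ v (shift p₀ μF (-(R • a)) u)) atTop (𝓝 0)} := by
    intro k
    have h1 := tendsto_mulLp_shift (hχ k) a (fun y => by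
      refine tendsto_const_nhds.congr' ?_
      filter_upwards [(tendsto_norm_add_smul_atTop y.2 ha).eventually_gt_atTop (k : ℝ)] with R hR
      simp [χ, not_le.2 hR]) u
    have h2 : Tendsto (fun R : ℝ => inner ℂ v (mulLp (hχ k) (shift p₀ μF (-(R • a)) u))) atTop
        (𝓝 (inner ℂ v 0)) := tendsto_const_nhds.inner h1
    rw [inner_zero_right] at h2
    refine h2.congr fun R => ?_
    rw [L2.inner_def, L2.inner_def]
    refine integral_congr_ae ?_
    filter_upwards [mulLp_ae (hχ k) (shift p₀ μF (-(R • a)) u), mulLp_ae (hχ k) v] with y h3 h4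
    rw [h3, h4]
    by_cases hy : y ∈ {y : Cover p₀ × E d | ‖y.2‖ ≤ k}
    · simp [χ, hy]
    · simp [χ, hy]
  have hlim : Tendsto (fun k => mulLp (hχ k) v) atTop (𝓝 v) := by
    rw [tendsto_iff_norm_sub_tendsto_zero, ← tendsto_zero_iff_norm_tendsto_zero]
    refine tendsto_norm_iff_eLpNorm (F := fun k y => (χ k y - 1) * v y) (fun k => ?_) ?_
    · filter_upwards [Lp.coeFn_sub (mulLp (hχ k) v) v, mulLp_ae (hχ k) v] with y h3 h4
      rw [h3, Pi.sub_apply, h4]; ring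
    · refine tendsto_eLpNorm_mul_of_tendsto_zero (C := 2)
        (fun k => (hχ k).meas.sub aestronglyMeasurable_const) (fun k y => ?_) (fun y => ?_)
        (Lp.memLp v)
      · refine (nnnorm_sub_le _ _).trans ?_
        have := hb k y
        rw [nnnorm_one]
        calc ‖χ k y‖₊ + 1 ≤ 1 + 1 := by gcongr
          _ = 2 := one_add_one_eq_two
      · refine tendsto_const_nhds.congr' ?_
        filter_upwards [eventually_ge_atTop ⌈‖y.2‖⌉₊] with k hk
        have : ‖y.2‖ ≤ k := (Nat.le_ceil _).trans (by exact_mod_cast hk)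
        simp [χ, this]
  exact hcl.mem_of_tendsto hlim (Eventually.of_forall hmem)

/-- The symmetrization of a translation. -/
def symmShift (p₀ : Frame n M d) (μF : Measure M) [SFinite μF] (a : E d) :
    L2Lift p₀ μF →L[ℂ] L2Lift p₀ μF :=
  ∑ σ : structGroup p₀, (permLift p₀ μF σ).comp (shift p₀ μF a)

theorem symmShift_apply (a : E d) (u : L2Lift p₀ μF) :
    symmShift p₀ μF a u = ∑ σ : structGroup p₀, permLift p₀ μF σ (shift p₀ μF a u) := by
  simp [symmShift]

theorem symmShift_mem (a : E d) (u : L2Lift p₀ μF) : symmShift p₀ μF a u ∈ L2Normal p₀ μF := by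
  intro τ
  rw [symmShift_apply, map_sum]
  simp only [permLift_permLift]
  exact Fintype.sum_equiv (Equiv.mulLeft τ) _ _ fun σ => rfl

theorem norm_symmShift_le (a : E d) (u : L2Lift p₀ μF) :
    ‖symmShift p₀ μF a u‖ ≤ Fintype.card (structGroup p₀) * ‖u‖ := by
  rw [symmShift_apply]
  refine (norm_sum_le _ _).trans ?_
  simp [norm_permLift, norm_shift]

/-- Moving a renumbering past the translation turns a into σa, and the renumbering is then absorbed
by the invariant function. -/
theorem symmShift_of_mem (a : E d) {u : L2Lift p₀ μF} (hu : u ∈ L2Normal p₀ μF) :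
    symmShift p₀ μF a u = ∑ σ : structGroup p₀, shift p₀ μF (permVec (d := d) σ.1 a) u := by
  rw [symmShift_apply]
  refine Finset.sum_congr rfl fun σ _ => ?_
  rw [permLift_shift, hu σ]

theorem IsInvariantLift.symmShift {A : L2Normal p₀ μF →L[ℂ] L2Normal p₀ μF}
    {T : L2Lift p₀ μF →L[ℂ] L2Lift p₀ μF} (h : IsInvariantLift p₀ μF A T) (a : E d)
    (u : L2Lift p₀ μF) : T (symmShift p₀ μF a u) = Corners.symmShift p₀ μF a (T u) := by
  rw [symmShift_apply, symmShift_apply, map_sum]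
  refine Finset.sum_congr rfl fun σ _ => ?_
  rw [h.perm, h.shift]

/-- After cancelling the common translation, the σ-th term contains a translation by R(σa − a). It
is constant if σ fixes a, and otherwise the translates go weakly to zero. -/
theorem tendsto_inner_shift_symmShift {a : E d} (v u : L2Lift p₀ μF) :
    Tendsto (fun R : ℝ => inner ℂ (shift p₀ μF (-(R • a)) v) (symmShift p₀ μF (-(R • a)) u)) atTop
      (𝓝 (∑ σ : structGroup p₀, if permVec (d := d) σ.1 a = a then
        inner ℂ v (permLift p₀ μF σ u) else 0)) := by
  simp only [symmShift_apply, inner_sum]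
  refine tendsto_finsetSum _ fun σ _ => ?_
  have h1 : ∀ R : ℝ, inner ℂ (shift p₀ μF (-(R • a)) v)
      (permLift p₀ μF σ (shift p₀ μF (-(R • a)) u)) =
      inner ℂ v (shift p₀ μF (-(R • (permVec (d := d) σ.1 a - a))) (permLift p₀ μF σ u)) := by
    intro R
    rw [← inner_shift_shift (R • a), shift_shift, permLift_shift, shift_shift]
    simp only [add_neg_cancel, shift_zero, map_neg, map_smul, smul_sub]
    congr 3
    abel
  simp only [h1]
  split_ifs with h
  · simp only [h, sub_self, smul_zero, neg_zero, shift_zero]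
    exact tendsto_const_nhds
  · exact tendsto_inner_shift (sub_ne_zero.2 h) _ _

/-- An invariant lift is bounded in terms of the operator which it lifts. -/
theorem IsInvariantLift.norm_le {A : L2Normal p₀ μF →L[ℂ] L2Normal p₀ μF}
    {T : L2Lift p₀ μF →L[ℂ] L2Lift p₀ μF} (h : IsInvariantLift p₀ μF A T) :
    ‖T‖ ≤ Fintype.card (structGroup p₀) * ‖A‖ := by
  refine T.opNorm_le_bound (by positivity) fun u => ?_
  -- The coordinates are pairwise distinct, so only the identity fixes a and the limit below is
  -- exactly ⟨Tu, Tu⟩.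
  let a : E d := WithLp.toLp 2 fun i => (i : ℝ)
  have ha : ∀ σ : structGroup p₀, permVec (d := d) σ.1 a = a ↔ σ = 1 := by
    intro σ
    constructor
    · intro hσ
      have : σ.1⁻¹ = 1 := by
        ext i
        have h2 := congrArg (fun t : E d => t i) hσ
        simp only [permVec_apply] at h2
        have h3 : (((σ.1⁻¹ i : Fin d) : ℕ) : ℝ) = ((i : ℕ) : ℝ) := h2
        exact_mod_cast h3
      exact Subtype.ext (inv_eq_one.1 this)
    · rintro rfl
      exact permVec_one a
  have hlim := tendsto_inner_shift_symmShift (a := a) (T u) (T u)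
  simp only [ha, Finset.sum_ite_eq', Finset.mem_univ, if_true, permLift_one] at hlim
  have hbd : ‖inner ℂ (T u) (T u)‖ ≤ ‖T u‖ * (Fintype.card (structGroup p₀) * ‖A‖ * ‖u‖) := by
    refine le_of_tendsto hlim.norm (Eventually.of_forall fun R => ?_)
    refine (norm_inner_le_norm _ _).trans ?_
    rw [norm_shift, ← h.symmShift]
    gcongr
    -- T is controlled by A only on invariant functions; the symmetrized translate of an arbitrary u
    -- is one of them.
    have h1 := h.restrict ⟨_, symmShift_mem (-(R • a)) u⟩
    simp only at h1
    rw [h1]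
    change ‖A _‖ ≤ _
    refine (A.le_opNorm _).trans ?_
    have := norm_symmShift_le (-(R • a)) u
    rw [mul_comm (Fintype.card (structGroup p₀) : ℝ), mul_assoc]
    gcongr
    exact this
  rw [← inner_self_re_eq_norm, inner_self_eq_norm_mul_norm] at hbd
  rcases (norm_nonneg (T u)).eq_or_lt with h0 | h0
  · rw [← h0]; positivity
  · exact le_of_mul_le_mul_left hbd h0

/-- The difference of two lifts is an invariant lift of zero, so the norm bound applies. -/
theorem IsInvariantLift.unique {A : L2Normal p₀ μF →L[ℂ] L2Normal p₀ μF}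
    {T T' : L2Lift p₀ μF →L[ℂ] L2Lift p₀ μF} (h : IsInvariantLift p₀ μF A T)
    (h' : IsInvariantLift p₀ μF A T') : T = T' := by
  have h0 : IsInvariantLift p₀ μF 0 (T - T') :=
    ⟨fun σ u => by simp [h.perm, h'.perm], fun a u => by simp [h.shift, h'.shift],
      fun u => by simp [h.restrict, h'.restrict]⟩
  have := h0.norm_le
  rw [ContinuousLinearMap.opNorm_zero, mul_zero] at this
  exact sub_eq_zero.1 (norm_le_zero_iff.1 this)

/-- Pairing with one translate of w gives in the limit ‖w‖² times the order of the stabilizer of a,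
which is positive because it contains the identity. -/
theorem eq_zero_of_tendsto_symmShift {a : E d} {w : L2Lift p₀ μF} (hw : w ∈ L2Normal p₀ μF)
    (h : Tendsto (fun R : ℝ => symmShift p₀ μF (-(R • a)) w) atTop (𝓝 0)) : w = 0 := by
  have h1 := tendsto_inner_shift_symmShift (a := a) w w
  simp only [hw _] at h1
  have h2 : Tendsto (fun R : ℝ => inner ℂ (shift p₀ μF (-(R • a)) w)
      (symmShift p₀ μF (-(R • a)) w)) atTop (𝓝 0) := by
    rw [tendsto_zero_iff_norm_tendsto_zero] at h ⊢
    have h3 := h.const_mul ‖w‖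
    rw [mul_zero] at h3
    refine squeeze_zero (fun _ => norm_nonneg _) (fun R => ?_) h3
    refine (norm_inner_le_norm _ _).trans ?_
    rw [norm_shift]
  have h3 := tendsto_nhds_unique h1 h2
  rw [Finset.sum_ite, Finset.sum_const_zero, add_zero, Finset.sum_const, smul_eq_zero] at h3
  rcases h3 with h3 | h3
  · rw [Finset.card_eq_zero, Finset.filter_eq_empty_iff] at h3
    refine absurd ?_ (h3 (Finset.mem_univ 1))
    rw [Subgroup.coe_one]
    exact permVec_one a
  · exact inner_self_eq_zero.1 h3

/-- Renumberings are unitary and can be moved to v, which reduces every term to a pure translation.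
-/
theorem tendsto_inner_symmShift {a : E d} (ha : a ≠ 0) (v u : L2Lift p₀ μF) :
    Tendsto (fun R : ℝ => inner ℂ v (symmShift p₀ μF (-(R • a)) u)) atTop (𝓝 0) := by
  simp only [symmShift_apply, inner_sum]
  rw [← Finset.sum_const_zero (s := (Finset.univ : Finset (structGroup p₀)))]
  refine tendsto_finsetSum _ fun σ _ => ?_
  refine (tendsto_inner_shift ha (permLift p₀ μF σ⁻¹ v) u).congr fun R => ?_
  rw [← inner_permLift_permLift σ, permLift_permLift, mul_inv_cancel, permLift_one]

theorem mulLp_sum {α : Type*} [MeasurableSpace α] {ν : Measure α} {χ : α → ℂ}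
    (h : IsBddMeas ν χ) {ι : Type*} (s : Finset ι) (u : ι → Lp ℂ 2 ν) :
    mulLp h (∑ i ∈ s, u i) = ∑ i ∈ s, mulLp h (u i) := by
  classical
  induction s using Finset.induction_on with
  | empty =>
    refine Lp.ext ?_
    simp only [Finset.sum_empty]
    filter_upwards [mulLp_ae h (0 : Lp ℂ 2 ν), Lp.coeFn_zero ℂ 2 ν] with y h1 h2
    rw [h1]
    erw [h2]
    exact mul_zero _
  | insert i s hi ih =>
    rw [Finset.sum_insert hi, Finset.sum_insert hi, ← ih]
    refine Lp.ext ?_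
    filter_upwards [mulLp_ae h (u i + ∑ j ∈ s, u j), mulLp_ae h (u i), mulLp_ae h (∑ j ∈ s, u j),
      Lp.coeFn_add (u i) (∑ j ∈ s, u j),
      Lp.coeFn_add (mulLp h (u i)) (mulLp h (∑ j ∈ s, u j))] with y h1 h2 h3 h4 h5
    rw [h1, h5, Pi.add_apply, h2, h3, h4, Pi.add_apply, mul_add]

/-- On invariant functions the symmetrization is a sum of translations along the vectors σa, so
decay of χ is needed along each of these directions. -/
theorem tendsto_mulLp_symmShift {χ : Cover p₀ × E d → ℂ} (hχ : IsBddMeas (liftMeasure p₀ μF) χ)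
    (a : E d) (h : ∀ (σ : structGroup p₀) (y : Cover p₀ × E d),
      Tendsto (fun R : ℝ => χ (y.1, y.2 + R • permVec (d := d) σ.1 a)) atTop (𝓝 0))
    {u : L2Lift p₀ μF} (hu : u ∈ L2Normal p₀ μF) :
    Tendsto (fun R : ℝ => mulLp hχ (symmShift p₀ μF (-(R • a)) u)) atTop (𝓝 0) := by
  simp only [symmShift_of_mem _ hu, mulLp_sum, map_neg, map_smul]
  have := tendsto_finsetSum (Finset.univ : Finset (structGroup p₀))
    fun σ _ => tendsto_mulLp_shift hχ _ (h σ) u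
  simpa only [Finset.sum_const_zero] using this

end Translations

end Corners

namespace Corners

/-! ### Fourier transform and multipliers on L²(ℝᵈ). -/

section FourierL2

variable {d : ℕ}

/-- The space `L²(ℝᵈ)`. -/
abbrev L2E (d : ℕ) := Lp ℂ 2 (volume : Measure (E d))

/-- Translation on `L²(ℝᵈ)`. -/
def translate (a : E d) : L2E d →ₗᵢ[ℂ] L2E d :=
  Lp.compMeasurePreservingₗᵢ ℂ _ (measurePreserving_add_right volume a)

theorem translate_ae (a : E d) (f : L2E d) : translate a f =ᵐ[volume] fun t => f (t + a) :=
  Lp.coeFn_compMeasurePreserving f (measurePreserving_add_right volume a)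

theorem mulLp_sub {α : Type*} [MeasurableSpace α] {ν : Measure α} {χ : α → ℂ}
    (h : IsBddMeas ν χ) (u v : Lp ℂ 2 ν) : mulLp h u - mulLp h v = mulLp h (u - v) := by
  refine Lp.ext ?_
  filter_upwards [mulLp_ae h u, mulLp_ae h v, mulLp_ae h (u - v), Lp.coeFn_sub u v,
    Lp.coeFn_sub (mulLp h u) (mulLp h v)] with y h1 h2 h3 h4 h5
  rw [h5, h3, Pi.sub_apply, h1, h2, h4, Pi.sub_apply, mul_sub]

theorem continuous_mulLp {α : Type*} [MeasurableSpace α] {ν : Measure α} {χ : α → ℂ}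
    (h : IsBddMeas ν χ) : Continuous (mulLp h) := by
  obtain ⟨C, hC⟩ := h.bdd
  refine (LipschitzWith.of_dist_le_mul (K := C) fun u v => ?_).continuous
  rw [dist_eq_norm, dist_eq_norm, mulLp_sub]
  refine Lp.norm_le_mul_norm_of_ae_le_mul ?_
  filter_upwards [mulLp_ae h (u - v)] with y hy
  rw [hy, norm_mul]
  gcongr
  exact_mod_cast hC y

theorem isBddMeas_char (a : E d) :
    IsBddMeas (volume : Measure (E d)) (fun ξ => (Real.fourierChar (inner ℝ a ξ) : ℂ)) :=
  ⟨by
    have : Continuous fun ξ : E d => (Real.fourierChar (inner ℝ a ξ) : ℂ) := by fun_prop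
    exact this.aestronglyMeasurable, 1, fun y => by
      rw [← NNReal.coe_le_coe]
      exact (Circle.norm_coe _).le⟩

/-- Both sides are continuous in f, so the integral formula for Schwartz functions suffices. -/
theorem fourier_translate (a : E d) (f : L2E d) :
    (𝓕 (translate a f) : L2E d) = mulLp (isBddMeas_char a) (𝓕 f) := by
  refine DenseRange.induction_on (p := fun f : L2E d =>
    (𝓕 (translate a f) : L2E d) = mulLp (isBddMeas_char a) (𝓕 f))
    (SchwartzMap.denseRange_toLpCLM (p := 2) ENNReal.ofNat_ne_top) f ?_ ?_
  · refine isClosed_eq ?_ ?_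
    · exact (Lp.fourierTransformₗᵢ (E d) ℂ).continuous.comp (translate a).continuous
    · exact (continuous_mulLp _).comp (Lp.fourierTransformₗᵢ (E d) ℂ).continuous
  intro φ
  have h1 : translate a (φ.toLp 2) = (SchwartzMap.compSubConstCLM ℂ (-a) φ).toLp 2 := by
    refine Lp.ext ?_
    filter_upwards [translate_ae a (φ.toLp 2),
      (measurePreserving_add_right volume a).quasiMeasurePreserving.ae (φ.coeFn_toLp 2 volume),
      (SchwartzMap.compSubConstCLM ℂ (-a) φ).coeFn_toLp 2 volume] with t h2 h3 h4
    rw [h2, h3, h4]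
    simp
  change (𝓕 (translate a (φ.toLp 2)) : L2E d) = mulLp (isBddMeas_char a) (𝓕 (φ.toLp 2))
  rw [h1, SchwartzMap.toLp_fourier_eq, SchwartzMap.toLp_fourier_eq]
  refine Lp.ext ?_
  filter_upwards [mulLp_ae (isBddMeas_char a) ((𝓕 φ).toLp 2), (𝓕 φ).coeFn_toLp 2 volume,
    (𝓕 (SchwartzMap.compSubConstCLM ℂ (-a) φ)).coeFn_toLp 2 volume] with ξ h2 h3 h4
  rw [h2, h3, h4]
  have h5 := congrFun (VectorFourier.fourierIntegral_comp_add_right Real.fourierChar volume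
    (innerₗ (E d)) (φ : E d → ℂ) a) ξ
  rw [SchwartzMap.fourier_coe, SchwartzMap.fourier_coe]
  refine Eq.trans ?_ h5
  rw [Real.fourier_eq]
  simp [VectorFourier.fourierIntegral]

/-- The permutation of coordinates on `L²(ℝᵈ)`. -/
def permE (σ : Equiv.Perm (Fin d)) : L2E d →ₗᵢ[ℂ] L2E d :=
  Lp.compMeasurePreservingₗᵢ ℂ _ (permVec σ⁻¹).measurePreserving

theorem permE_ae (σ : Equiv.Perm (Fin d)) (f : L2E d) :
    permE σ f =ᵐ[volume] fun t => f (permVec σ⁻¹ t) :=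
  Lp.coeFn_compMeasurePreserving f (permVec σ⁻¹).measurePreserving

theorem fourier_permE (σ : Equiv.Perm (Fin d)) (f : L2E d) :
    (𝓕 (permE σ f) : L2E d) = permE σ (𝓕 f) := by
  refine DenseRange.induction_on (p := fun f : L2E d =>
    (𝓕 (permE σ f) : L2E d) = permE σ (𝓕 f))
    (SchwartzMap.denseRange_toLpCLM (p := 2) ENNReal.ofNat_ne_top) f ?_ ?_
  · refine isClosed_eq ?_ ?_
    · exact (Lp.fourierTransformₗᵢ (E d) ℂ).continuous.comp (permE σ).continuous
    · exact (permE σ).continuous.comp (Lp.fourierTransformₗᵢ (E d) ℂ).continuous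
  intro φ
  let φ' := SchwartzMap.compCLMOfContinuousLinearEquiv ℂ
    (permVec (d := d) σ⁻¹).toContinuousLinearEquiv φ
  have h1 : permE σ (φ.toLp 2) = φ'.toLp 2 := by
    refine Lp.ext ?_
    filter_upwards [permE_ae σ (φ.toLp 2),
      (permVec (d := d) σ⁻¹).measurePreserving.quasiMeasurePreserving.ae
        (φ.coeFn_toLp 2 volume), φ'.coeFn_toLp 2 volume] with t h2 h3 h4
    rw [h2, h3, h4]
    rfl
  change (𝓕 (permE σ (φ.toLp 2)) : L2E d) = permE σ (𝓕 (φ.toLp 2))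
  rw [h1, SchwartzMap.toLp_fourier_eq, SchwartzMap.toLp_fourier_eq]
  refine Lp.ext ?_
  filter_upwards [permE_ae σ ((𝓕 φ).toLp 2),
    (permVec (d := d) σ⁻¹).measurePreserving.quasiMeasurePreserving.ae
      ((𝓕 φ).coeFn_toLp 2 volume), (𝓕 φ').coeFn_toLp 2 volume] with ξ h2 h3 h4
  rw [h2, h3, h4, SchwartzMap.fourier_coe, SchwartzMap.fourier_coe]
  exact Real.fourier_comp_linearIsometry (permVec σ⁻¹) φ ξ

/-- Injectivity of the Fourier transform on `L¹`. -/
theorem ae_eq_zero_of_fourier_eq_zero {h : E d → ℂ} (hi : Integrable h)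
    (h0 : ∀ a : E d, ∫ ξ, (Real.fourierChar (inner ℝ a ξ) : ℂ) * h ξ = 0) :
    ∀ᵐ ξ, h ξ = 0 := by
  refine ae_eq_zero_of_integral_contDiff_smul_eq_zero hi.locallyIntegrable fun g hg hgc => ?_
  have hg₁ : HasCompactSupport (Complex.ofRealCLM ∘ g) := hgc.comp_left rfl
  have hg₂ : ContDiff ℝ ∞ (Complex.ofRealCLM ∘ g) := by fun_prop
  let φ := hg₁.toSchwartzMap hg₂
  let ψ : SchwartzMap (E d) ℂ := 𝓕⁻ φ
  have hF : ∀ ξ, 𝓕 h ξ = 0 := fun ξ => by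
    rw [Real.fourier_eq]
    have := h0 (-ξ)
    simpa [Circle.smul_def, real_inner_comm] using this
  -- The test function g is the Fourier transform of ψ, so shifting the transform from ψ to h gives
  -- ∫ g h = ∫ ψ 𝓕h = 0.
  have key := VectorFourier.integral_fourierIntegral_smul_eq_flip (μ := volume) (ν := volume)
    (e := Real.fourierChar) (L := innerₗ (E d)) (f := h) (g := ψ) Real.continuous_fourierChar
    (by simpa using continuous_inner (𝕜 := ℝ) (E := E d)) hi ψ.integrable
  have hF' : ∀ ξ, VectorFourier.fourierIntegral Real.fourierChar volume (innerₗ (E d)) h ξ = 0 :=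
    hF
  simp only [hF', zero_smul, integral_zero] at key
  have hψ : ∀ x, VectorFourier.fourierIntegral Real.fourierChar volume (innerₗ (E d)).flip ψ x
      = g x := by
    intro x
    rw [flip_innerₗ]
    change 𝓕 (ψ : E d → ℂ) x = _
    rw [← SchwartzMap.fourier_coe]
    simp [ψ, φ]
  rw [key]
  refine integral_congr_ae (Eventually.of_forall fun x => ?_)
  simp only [hψ]
  simp [mul_comm]

/-- The square root of a positive integrable function. Being nonzero almost everywhere, it can be
divided by, so a multiplier can be read off from its effect on this one function. -/
theorem exists_pos_memLp : ∃ g : L2E d, ∀ᵐ t, ∃ r : ℝ, 0 < r ∧ g t = r := by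
  obtain ⟨g, hpos, hm, hlt⟩ := exists_pos_lintegral_lt_of_sigmaFinite
    (volume : Measure (E d)) one_ne_zero
  have hmem : MemLp (fun t => ((Real.sqrt (g t) : ℝ) : ℂ)) 2 (volume : Measure (E d)) := by
    have hmeas : AEStronglyMeasurable (fun t => ((Real.sqrt (g t) : ℝ) : ℂ))
      (volume : Measure (E d)) := by
      refine Measurable.aestronglyMeasurable ?_
      fun_prop
    rw [memLp_two_iff_integrable_sq_norm hmeas]
    have : Integrable (fun t => ((g t : ℝ))) (volume : Measure (E d)) := by
      refine ⟨by fun_prop, ?_⟩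
      rw [hasFiniteIntegral_iff_enorm]
      refine lt_of_le_of_lt ?_ (hlt.trans ENNReal.one_lt_top)
      refine lintegral_mono fun t => ?_
      simp
    refine this.congr (Eventually.of_forall fun t => ?_)
    simp [Real.sq_sqrt]
  refine ⟨hmem.toLp, ?_⟩
  filter_upwards [hmem.coeFn_toLp] with t ht
  exact ⟨_, Real.sqrt_pos.2 (hpos t), ht⟩

/-- A bounded operator commuting with translations is a Fourier multiplier. -/
theorem exists_multiplier (S : L2E d →L[ℂ] L2E d)
    (hS : ∀ a f, S (translate a f) = translate a (S f)) :
    ∃ m : E d → ℂ, AEStronglyMeasurable m volume ∧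
      ∀ f : L2E d, (𝓕 (S f) : L2E d) =ᵐ[volume] fun ξ => m ξ * (𝓕 f : L2E d) ξ := by
  obtain ⟨g₀, hg₀⟩ := exists_pos_memLp (d := d)
  -- If S is multiplication by m on the Fourier side, its adjoint is multiplication by the conjugate
  -- of m, so k must be that conjugate times g₀. This forces the choice of the quotient below.
  let k : L2E d := 𝓕 (ContinuousLinearMap.adjoint S (𝓕⁻ g₀))
  refine ⟨fun ξ => (starRingEnd ℂ) (k ξ) / g₀ ξ,
    ((Complex.continuous_conj.comp_aestronglyMeasurable (Lp.memLp k).1).aemeasurable.div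
      (Lp.memLp g₀).1.aemeasurable).aestronglyMeasurable, ?_⟩
  intro f
  let F : L2E d := 𝓕 f
  let G : L2E d := 𝓕 (S f)
  have hkey : ∀ᵐ ξ : E d, inner ℂ (g₀ ξ) (G ξ) - inner ℂ (k ξ) (F ξ) = 0 := by
    have hi1 := L2.integrable_inner (𝕜 := ℂ) g₀ G
    have hi2 := L2.integrable_inner (𝕜 := ℂ) k F
    -- Multiplication by a character is translation of f, and S commutes with it; so the defining
    -- relation of the adjoint for all translates of f says that this L¹ function has zero Fourier
    -- transform.
    refine ae_eq_zero_of_fourier_eq_zero (hi1.sub hi2) fun a => ?_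
    have e1 : ∀ p q : L2E d, ∫ ξ, (Real.fourierChar (inner ℝ a ξ) : ℂ) * inner ℂ (p ξ) (q ξ) =
        inner ℂ p (mulLp (isBddMeas_char a) q) := by
      intro p q
      rw [L2.inner_def]
      refine integral_congr_ae ?_
      filter_upwards [mulLp_ae (isBddMeas_char a) q] with ξ h1
      rw [h1, ← smul_eq_mul, ← smul_eq_mul, inner_smul_right, smul_eq_mul]
    have e3 : ∀ p q : L2E d, Integrable fun ξ : E d =>
        (Real.fourierChar (inner ℝ a ξ) : ℂ) * inner ℂ (p ξ) (q ξ) := by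
      intro p q
      refine (L2.integrable_inner (𝕜 := ℂ) p (mulLp (isBddMeas_char a) q)).congr ?_
      filter_upwards [mulLp_ae (isBddMeas_char a) q] with ξ h1
      rw [h1, ← smul_eq_mul, ← smul_eq_mul, inner_smul_right, smul_eq_mul]
    simp only [mul_sub]
    rw [integral_sub (e3 _ _) (e3 _ _), e1, e1, sub_eq_zero]
    have e4 : ∀ q : L2E d, inner ℂ g₀ (𝓕 q : L2E d) = inner ℂ (𝓕⁻ g₀ : L2E d) q := fun q => by
      rw [← Lp.inner_fourier_eq (𝓕⁻ g₀) q, FourierTransform.fourier_fourierInv_eq]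
    rw [← fourier_translate, ← fourier_translate, ← hS, Lp.inner_fourier_eq,
      ContinuousLinearMap.adjoint_inner_left, e4]
  filter_upwards [hkey, hg₀] with ξ h1 ⟨r, hr, h2⟩
  have hr' : (r : ℂ) ≠ 0 := by exact_mod_cast hr.ne'
  rw [h2] at h1 ⊢
  simp only [RCLike.inner_apply, Complex.conj_ofReal] at h1
  change G ξ = _ * F ξ
  field_simp
  linear_combination h1

end FourierL2

end Corners

namespace Corners

/-! ### Weak limits of operators and weak measurability. -/

section WeakLimit

variable {K : Type*} [NormedAddCommGroup K] [InnerProductSpace ℂ K] [CompleteSpace K]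

/-- Bounded sequences of operators converge weakly along ultrafilters. -/
theorem exists_weak_limit (b : ℕ → K →L[ℂ] K) {C : ℝ} (h : ∀ k, ‖b k‖ ≤ C)
    (𝒰 : Ultrafilter ℕ) : ∃ c : K →L[ℂ] K, ‖c‖ ≤ C ∧
      ∀ u v, Tendsto (fun k => inner ℂ (b k u) v) 𝒰 (𝓝 (inner ℂ (c u) v)) := by
  have hC0 : 0 ≤ C := (norm_nonneg _).trans (h 0)
  have ex : ∀ u v : K, ∃ ℓ : ℂ, ‖ℓ‖ ≤ C * ‖u‖ * ‖v‖ ∧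
      Tendsto (fun k => inner ℂ (b k u) v) 𝒰 (𝓝 ℓ) := by
    intro u v
    have hb : ∀ k, inner ℂ (b k u) v ∈ Metric.closedBall (0 : ℂ) (C * ‖u‖ * ‖v‖) := by
      intro k
      rw [mem_closedBall_zero_iff]
      refine (norm_inner_le_norm _ _).trans ?_
      gcongr
      exact (b k).le_of_opNorm_le (h k) u
    -- The ultrafilter converges for all u, v at once, so no subsequence has to be extracted.
    obtain ⟨ℓ, hℓ, hl⟩ := (isCompact_closedBall (0 : ℂ) (C * ‖u‖ * ‖v‖)).ultrafilter_le_nhds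
      (𝒰.map fun k => inner ℂ (b k u) v) (by
        rw [le_principal_iff]
        exact Filter.mem_map.2 (univ_mem' hb))
    exact ⟨ℓ, mem_closedBall_zero_iff.1 hℓ, hl⟩
  choose L hL hlim using ex
  -- Sesquilinearity of the limits follows from their uniqueness; the operator then comes from the
  -- Riesz representation of a bounded form.
  let B := LinearMap.mkContinuous₂ (LinearMap.mk₂'ₛₗ (starRingEnd ℂ) (RingHom.id ℂ) L
    (fun u u' v => tendsto_nhds_unique (hlim _ _)
      (((hlim u v).add (hlim u' v)).congr fun k => by rw [map_add, inner_add_left]))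
    (fun c u v => tendsto_nhds_unique (hlim _ _)
      (((hlim u v).const_mul ((starRingEnd ℂ) c)).congr fun k => by
        rw [map_smul, inner_smul_left]))
    (fun u v v' => tendsto_nhds_unique (hlim _ _)
      (((hlim u v).add (hlim u v')).congr fun k => by rw [inner_add_right]))
    (fun c u v => tendsto_nhds_unique (hlim _ _)
      (((hlim u v).const_mul c).congr fun k => by rw [inner_smul_right]))) C hL
  have hB : ∀ u v, inner ℂ (InnerProductSpace.continuousLinearMapOfBilin B u) v = L u v :=
    fun u v => InnerProductSpace.continuousLinearMapOfBilin_apply B u v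
  refine ⟨InnerProductSpace.continuousLinearMapOfBilin B, ?_, fun u v => ?_⟩
  · refine ContinuousLinearMap.opNorm_le_bound _ hC0 fun u => ?_
    set w := InnerProductSpace.continuousLinearMapOfBilin B u with hw
    have h1 : ‖inner ℂ w w‖ ≤ C * ‖u‖ * ‖w‖ := by
      rw [hw, hB]
      exact hL _ _
    rw [← inner_self_re_eq_norm, inner_self_eq_norm_mul_norm] at h1
    rcases (norm_nonneg w).eq_or_lt with h0 | h0
    · rw [← h0]; positivity
    · exact le_of_mul_le_mul_right h1 h0
  · rw [hB]
    exact hlim u v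

/-- Weakly measurable functions with values in a separable Hilbert space are measurable. -/
theorem aestronglyMeasurable_of_inner [TopologicalSpace.SeparableSpace K] {α : Type*}
    [MeasurableSpace α] {ν : Measure α} {h : α → K}
    (hm : ∀ v, AEStronglyMeasurable (fun x => inner ℂ v (h x)) ν) :
    AEStronglyMeasurable h ν := by
  obtain ⟨w, b, hb⟩ := exists_hilbertBasis ℂ K
  have hw : Countable w := by
    have hsep : TopologicalSpace.SeparableSpace w := by
      have : SecondCountableTopology K := UniformSpace.secondCountable_of_separable K
      infer_instance
    -- Distinct basis vectors have distance √2 ≥ 1; a discrete separable space is countable.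
    have hdisc : DiscreteTopology w := by
      refine DiscreteTopology.of_forall_le_dist (r := 1) one_pos fun x y hxy => ?_
      have ho := b.orthonormal
      have h1 : ‖(b x : K) - b y‖ * ‖(b x : K) - b y‖ = 2 := by
        rw [norm_sub_mul_self (𝕜 := ℂ), ho.1 x, ho.1 y, ho.2 hxy]
        norm_num
      change 1 ≤ dist x y
      rw [Subtype.dist_eq, dist_eq_norm, ← congrFun hb x, ← congrFun hb y]
      nlinarith [norm_nonneg ((b x : K) - b y)]
    exact TopologicalSpace.separableSpace_iff_countable.1 hsep
  -- The function is the pointwise limit of its orthogonal expansion, whose coefficients are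
  -- measurable. Countability of the basis makes the filter of finite subsets countably generated.
  refine aestronglyMeasurable_of_tendsto_ae (atTop : Filter (Finset w))
    (f := fun s x => ∑ i ∈ s, inner ℂ (b i) (h x) • b i) (fun s => ?_)
    (Eventually.of_forall fun x => ?_)
  · refine Finset.aestronglyMeasurable_fun_sum _ fun i _ => ?_
    exact (hm (b i)).smul_const _
  · have := b.hasSum_repr (h x)
    simpa [b.repr_apply_apply, HasSum] using this

end WeakLimit

/-! ### Tensor products and matrix elements. -/

section Symbols

variable {n d : ℕ} {M : Type*} [TopologicalSpace M] [ChartedSpace (EuclideanQuadrant n) M]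
  [MeasurableSpace M] {p₀ : Frame n M d} {μF : Measure M} [SFinite μF]

theorem tensor_ae (u : L2Cover p₀ μF) (f : L2E d) :
    tensor p₀ μF u f =ᵐ[liftMeasure p₀ μF] fun x => u x.1 * f x.2 :=
  (memLp_tensor p₀ μF u f).coeFn_toLp

theorem inner_tensor (v u : L2Cover p₀ μF) (g f : L2E d) :
    inner ℂ (tensor p₀ μF v g) (tensor p₀ μF u f) = inner ℂ v u * inner ℂ g f := by
  rw [L2.inner_def, L2.inner_def, L2.inner_def, ← integral_prod_mul]
  refine integral_congr_ae ?_
  filter_upwards [tensor_ae v g, tensor_ae u f] with x h1 h2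
  rw [h1, h2]
  simp only [RCLike.inner_apply, map_mul]
  ring

theorem norm_tensor (u : L2Cover p₀ μF) (f : L2E d) : ‖tensor p₀ μF u f‖ = ‖u‖ * ‖f‖ := by
  have h := inner_tensor u u f f
  rw [inner_self_eq_norm_sq_to_K, inner_self_eq_norm_sq_to_K, inner_self_eq_norm_sq_to_K] at h
  have h2 : ‖tensor p₀ μF u f‖ ^ 2 = (‖u‖ * ‖f‖) ^ 2 := by
    rw [mul_pow]
    exact_mod_cast h
  exact (pow_left_inj₀ (norm_nonneg _) (by positivity) two_ne_zero).1 h2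

theorem tensor_add_left (u u' : L2Cover p₀ μF) (f : L2E d) :
    tensor p₀ μF (u + u') f = tensor p₀ μF u f + tensor p₀ μF u' f := by
  refine Lp.ext ?_
  filter_upwards [tensor_ae (u + u') f, tensor_ae u f, tensor_ae u' f,
    Lp.coeFn_add (tensor p₀ μF u f) (tensor p₀ μF u' f),
    Measure.quasiMeasurePreserving_fst.ae (Lp.coeFn_add u u')] with x h1 h2 h3 h4 h5
  rw [h1, h4, Pi.add_apply, h2, h3, h5, Pi.add_apply, add_mul]

theorem tensor_smul_left (c : ℂ) (u : L2Cover p₀ μF) (f : L2E d) :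
    tensor p₀ μF (c • u) f = c • tensor p₀ μF u f := by
  refine Lp.ext ?_
  filter_upwards [tensor_ae (c • u) f, tensor_ae u f, Lp.coeFn_smul c (tensor p₀ μF u f),
    Measure.quasiMeasurePreserving_fst.ae (Lp.coeFn_smul c u)] with x h1 h2 h3 h4
  rw [h1, h3, Pi.smul_apply, h2, h4, Pi.smul_apply, smul_eq_mul, smul_eq_mul, mul_assoc]

theorem tensor_add_right (u : L2Cover p₀ μF) (f f' : L2E d) :
    tensor p₀ μF u (f + f') = tensor p₀ μF u f + tensor p₀ μF u f' := by
  refine Lp.ext ?_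
  filter_upwards [tensor_ae u (f + f'), tensor_ae u f, tensor_ae u f',
    Lp.coeFn_add (tensor p₀ μF u f) (tensor p₀ μF u f'),
    Measure.quasiMeasurePreserving_snd.ae (Lp.coeFn_add f f')] with x h1 h2 h3 h4 h5
  rw [h1, h4, Pi.add_apply, h2, h3, h5, Pi.add_apply, mul_add]

theorem tensor_smul_right (c : ℂ) (u : L2Cover p₀ μF) (f : L2E d) :
    tensor p₀ μF u (c • f) = c • tensor p₀ μF u f := by
  refine Lp.ext ?_
  filter_upwards [tensor_ae u (c • f), tensor_ae u f, Lp.coeFn_smul c (tensor p₀ μF u f),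
    Measure.quasiMeasurePreserving_snd.ae (Lp.coeFn_smul c f)] with x h1 h2 h3 h4
  rw [h1, h3, Pi.smul_apply, h2, h4, Pi.smul_apply, smul_eq_mul, smul_eq_mul]
  ring

variable (p₀ μF) in
/-- The operator `u ↦ u ⊗ f`. -/
def tensorRight (f : L2E d) : L2Cover p₀ μF →L[ℂ] L2Lift p₀ μF :=
  LinearMap.mkContinuous ⟨⟨fun u => tensor p₀ μF u f, fun u u' => tensor_add_left u u' f⟩,
    fun c u => tensor_smul_left c u f⟩ ‖f‖ fun u => by
      change ‖tensor p₀ μF u f‖ ≤ _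
      rw [norm_tensor, mul_comm]

/-- The operator `f ↦ u ⊗ f`. -/
def tensorLeft (u : L2Cover p₀ μF) : L2E d →L[ℂ] L2Lift p₀ μF :=
  LinearMap.mkContinuous ⟨⟨fun f => tensor p₀ μF u f, fun f f' => tensor_add_right u f f'⟩,
    fun c f => tensor_smul_right c u f⟩ ‖u‖ fun f => by
      change ‖tensor p₀ μF u f‖ ≤ _
      rw [norm_tensor]

theorem norm_tensorRight_le (f : L2E d) : ‖tensorRight p₀ μF f‖ ≤ ‖f‖ :=
  LinearMap.mkContinuous_norm_le _ (norm_nonneg _) _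

theorem shift_tensor (a : E d) (u : L2Cover p₀ μF) (f : L2E d) :
    shift p₀ μF a (tensor p₀ μF u f) = tensor p₀ μF u (translate a f) := by
  refine Lp.ext ?_
  filter_upwards [shift_ae a (tensor p₀ μF u f), tensor_ae u (translate a f),
    (measurePreserving_shift p₀ μF a).quasiMeasurePreserving.ae (tensor_ae u f),
    Measure.quasiMeasurePreserving_snd.ae (translate_ae a f)] with x h1 h2 h3 h4
  rw [h1, h2, h4]
  exact h3

theorem permCover_ae (σ : structGroup p₀) (u : L2Cover p₀ μF) :
    permCover p₀ μF σ u =ᵐ[coverMeasure p₀ μF] fun x => u (σ⁻¹ • x) :=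
  Lp.coeFn_compMeasurePreserving u (measurePreserving_smul p₀ μF σ⁻¹)

theorem permLift_tensor (σ : structGroup p₀) (u : L2Cover p₀ μF) (f : L2E d) :
    permLift p₀ μF σ (tensor p₀ μF u f) = tensor p₀ μF (permCover p₀ μF σ u) (permE σ.1 f) := by
  refine Lp.ext ?_
  filter_upwards [permLift_ae σ (tensor p₀ μF u f),
    tensor_ae (permCover p₀ μF σ u) (permE σ.1 f),
    (measurePreserving_permLift p₀ μF σ⁻¹).quasiMeasurePreserving.ae (tensor_ae u f),
    Measure.quasiMeasurePreserving_fst.ae (permCover_ae σ u),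
    Measure.quasiMeasurePreserving_snd.ae (permE_ae σ.1 f)] with x h1 h2 h3 h4 h5
  rw [h1, h2, h4, h5]
  exact h3

/-- The matrix elements of a translation-invariant operator are Fourier multipliers. -/
theorem exists_matrix_element {T : L2Lift p₀ μF →L[ℂ] L2Lift p₀ μF}
    (hT : ∀ a u, T (shift p₀ μF a u) = shift p₀ μF a (T u)) (u v : L2Cover p₀ μF) :
    ∃ m : E d → ℂ, AEStronglyMeasurable m volume ∧ LocallyIntegrable m ∧
      ∀ f g : L2E d, inner ℂ (tensor p₀ μF v g) (T (tensor p₀ μF u f)) =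
        ∫ ξ, inner ℂ ((𝓕 g : L2E d) ξ) ((𝓕 f : L2E d) ξ) * m ξ := by
  -- Compressing T to the functions u ⊗ f and v ⊗ g gives a scalar operator, which inherits the
  -- commutation with translations.
  let S : L2E d →L[ℂ] L2E d :=
    (ContinuousLinearMap.adjoint (tensorLeft v)).comp (T.comp (tensorLeft u))
  have hS : ∀ g f, inner ℂ g (S f) = inner ℂ (tensor p₀ μF v g) (T (tensor p₀ μF u f)) := by
    intro g f
    change inner ℂ g (ContinuousLinearMap.adjoint (tensorLeft v) _) = _
    rw [ContinuousLinearMap.adjoint_inner_right]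
    rfl
  have hcomm : ∀ a f, S (translate a f) = translate a (S f) := by
    intro a f
    refine ext_inner_left ℂ fun g => ?_
    have h0 : g = translate a (translate (-a) g) := by
      refine Lp.ext ?_
      filter_upwards [translate_ae a (translate (-a) g),
        (measurePreserving_add_right volume a).quasiMeasurePreserving.ae
          (translate_ae (-a) g)] with t h1 h2
      rw [h1, h2]
      simp
    rw [hS]
    conv_rhs => rw [h0]
    rw [LinearIsometry.inner_map_map, hS, ← shift_tensor, hT, ← inner_shift_shift (-a),
      shift_shift, neg_add_cancel, shift_zero, shift_tensor]
  obtain ⟨m, hm, hmul⟩ := exists_multiplier S hcomm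
  refine ⟨m, hm, ?_, fun f g => ?_⟩
  · intro x
    refine ⟨Metric.closedBall x 1, Metric.closedBall_mem_nhds x one_pos, ?_⟩
    have hms : MeasurableSet (Metric.closedBall x 1) := measurableSet_closedBall
    have hfin : volume (Metric.closedBall x 1) ≠ ⊤ := measure_closedBall_lt_top.ne
    -- For this f the multiplier coincides on the ball with 𝓕(Sf), which is square integrable and
    -- hence integrable there.
    let f : L2E d := 𝓕⁻ (indicatorConstLp 2 hms hfin (1 : ℂ))
    have h1 := hmul f
    have h2 : IntegrableOn (𝓕 (S f) : L2E d) (Metric.closedBall x 1) := by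
      have : IsFiniteMeasure (volume.restrict (Metric.closedBall x 1)) :=
        ⟨by simpa using measure_closedBall_lt_top⟩
      exact ((Lp.memLp (𝓕 (S f) : L2E d)).restrict _).integrable (by norm_num)
    refine h2.congr ?_
    rw [EventuallyEq, ae_restrict_iff' hms]
    have h3 : (𝓕 f : L2E d) = indicatorConstLp 2 hms hfin (1 : ℂ) :=
      FourierTransform.fourier_fourierInv_eq _
    rw [h3] at h1
    filter_upwards [h1, indicatorConstLp_coeFn (p := 2) (hs := hms) (hμs := hfin)
      (c := (1 : ℂ))] with y h4 h5 hy
    rw [h4, h5, indicator_of_mem hy, mul_one]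
  · rw [← hS, ← Lp.inner_fourier_eq, L2.inner_def]
    refine integral_congr_ae ?_
    filter_upwards [hmul f] with ξ h1
    rw [h1, RCLike.inner_apply, RCLike.inner_apply]
    ring

end Symbols

end Corners

namespace Corners

/-! ### Existence, uniqueness and invariance of the symbol. -/

section SymbolExistence

variable {n d : ℕ} {M : Type*} [TopologicalSpace M] [ChartedSpace (EuclideanQuadrant n) M]
  [MeasurableSpace M] {p₀ : Frame n M d} {μF : Measure M} [SFinite μF]

/-- The function whose Fourier transform is the indicator of a ball. -/
def ballFun (ξ : E d) (r : ℝ) : L2E d :=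
  𝓕⁻ (indicatorConstLp 2 (μ := volume) (measurableSet_closedBall (x := ξ) (ε := r))
    measure_closedBall_lt_top.ne (1 : ℂ))

theorem fourier_ballFun (ξ : E d) (r : ℝ) :
    (𝓕 (ballFun ξ r) : L2E d) =ᵐ[volume] (Metric.closedBall ξ r).indicator fun _ => (1 : ℂ) := by
  rw [ballFun, FourierTransform.fourier_fourierInv_eq]
  exact indicatorConstLp_coeFn

theorem norm_sq_ballFun (ξ : E d) (r : ℝ) :
    ‖ballFun ξ r‖ * ‖ballFun ξ r‖ = volume.real (Metric.closedBall ξ r) := by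
  have h : ‖ballFun ξ r‖ = ‖indicatorConstLp 2 (μ := volume)
      (measurableSet_closedBall (x := ξ) (ε := r)) measure_closedBall_lt_top.ne (1 : ℂ)‖ :=
    (Lp.fourierTransformₗᵢ (E d) ℂ).symm.norm_map _
  rw [h, norm_indicatorConstLp (by norm_num) (by norm_num), norm_one, one_mul,
    ← Real.rpow_add_of_nonneg measureReal_nonneg (by norm_num) (by norm_num)]
  norm_num

/-- The average of the symbol of `T` over the ball with centre `ξ` and radius `r`. -/
def symbolAverage (T : L2Lift p₀ μF →L[ℂ] L2Lift p₀ μF) (ξ : E d) (r : ℝ) :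
    L2Cover p₀ μF →L[ℂ] L2Cover p₀ μF :=
  ((volume.real (Metric.closedBall ξ r))⁻¹ : ℂ) •
    (ContinuousLinearMap.adjoint (tensorRight p₀ μF (ballFun ξ r))).comp
      (T.comp (tensorRight p₀ μF (ballFun ξ r)))

/-- By Plancherel the squared norm of the test function is the volume of the ball, which cancels the
normalization. If the volume is zero, its inverse is zero by convention. -/
theorem norm_symbolAverage_le (T : L2Lift p₀ μF →L[ℂ] L2Lift p₀ μF) (ξ : E d) (r : ℝ) :
    ‖symbolAverage T ξ r‖ ≤ ‖T‖ := by
  set V := volume.real (Metric.closedBall ξ r) with hV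
  have hV0 : 0 ≤ V := measureReal_nonneg
  have h1 : ‖(ContinuousLinearMap.adjoint (tensorRight p₀ μF (ballFun ξ r))).comp
      (T.comp (tensorRight p₀ μF (ballFun ξ r)))‖ ≤ V * ‖T‖ := by
    refine (ContinuousLinearMap.opNorm_comp_le _ _).trans ?_
    have h2 := ContinuousLinearMap.opNorm_comp_le T (tensorRight p₀ μF (ballFun ξ r))
    have h3 := norm_tensorRight_le (p₀ := p₀) (μF := μF) (ballFun ξ r)
    rw [LinearIsometryEquiv.norm_map, hV, ← norm_sq_ballFun]
    calc _ ≤ ‖ballFun ξ r‖ * (‖T‖ * ‖ballFun ξ r‖) := by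
          refine mul_le_mul h3 (h2.trans ?_) (norm_nonneg _) (norm_nonneg _)
          gcongr
      _ = _ := by ring
  rw [symbolAverage, norm_smul, norm_inv, Complex.norm_real, Real.norm_of_nonneg hV0]
  rcases hV0.eq_or_lt with h0 | h0
  · rw [← h0]; simp
  · calc _ ≤ V⁻¹ * (V * ‖T‖) := by gcongr
      _ = ‖T‖ := by field_simp

/-- On the Fourier side the test function is an indicator, equal to its own square, so it only
restricts the integral of the multiplier to the ball. -/
theorem inner_symbolAverage (T : L2Lift p₀ μF →L[ℂ] L2Lift p₀ μF) (ξ : E d) (r : ℝ)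
    (u v : L2Cover p₀ μF) {m : E d → ℂ}
    (hm : ∀ f g : L2E d, inner ℂ (tensor p₀ μF v g) (T (tensor p₀ μF u f)) =
        ∫ ξ, inner ℂ ((𝓕 g : L2E d) ξ) ((𝓕 f : L2E d) ξ) * m ξ) :
    inner ℂ v (symbolAverage T ξ r u) = ⨍ η in Metric.closedBall ξ r, m η := by
  have h1 : inner ℂ v (symbolAverage T ξ r u) =
      ((volume.real (Metric.closedBall ξ r))⁻¹ : ℂ) *
        inner ℂ (tensor p₀ μF v (ballFun ξ r)) (T (tensor p₀ μF u (ballFun ξ r))) := by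
    change inner ℂ v (((volume.real (Metric.closedBall ξ r))⁻¹ : ℂ) •
      ContinuousLinearMap.adjoint (tensorRight p₀ μF (ballFun ξ r)) _) = _
    rw [inner_smul_right, ContinuousLinearMap.adjoint_inner_right]
    rfl
  rw [h1, hm, setAverage_eq, Complex.real_smul, Complex.ofReal_inv,
    ← integral_indicator measurableSet_closedBall]
  congr 1
  refine integral_congr_ae ?_
  filter_upwards [fourier_ballFun ξ r] with η hη
  rw [hη]
  by_cases h : η ∈ Metric.closedBall ξ r <;> simp [h]

/-- A bounded translation-invariant operator has a symbol. -/
theorem exists_isSymbol [TopologicalSpace.SeparableSpace (L2Cover p₀ μF)]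
    {T : L2Lift p₀ μF →L[ℂ] L2Lift p₀ μF}
    (hT : ∀ a u, T (shift p₀ μF a u) = shift p₀ μF a (T u)) :
    ∃ b : E d → (L2Cover p₀ μF →L[ℂ] L2Cover p₀ μF), (∀ ξ, ‖b ξ‖ ≤ ‖T‖) ∧
      IsSymbol p₀ μF T b := by
  let r : ℕ → ℝ := fun k => 1 / ((k : ℝ) + 1)
  have hr : Tendsto r atTop (𝓝[>] 0) :=
    tendsto_nhdsWithin_iff.2 ⟨tendsto_one_div_add_atTop_nhds_zero_nat,
      Eventually.of_forall fun k => by simp only [r, mem_Ioi]; positivity⟩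
  -- The operator c ξ is defined at every ξ, before u and v are chosen; otherwise the exceptional
  -- null sets depending on u and v would obstruct linearity and boundedness.
  choose c hc hlim using fun ξ : E d => exists_weak_limit (fun k => symbolAverage T ξ (r k))
    (fun k => norm_symbolAverage_le T ξ (r k)) (hyperfilter ℕ)
  have key : ∀ u v : L2Cover p₀ μF, ∃ m : E d → ℂ, AEStronglyMeasurable m volume ∧
      (∀ᵐ ξ, inner ℂ v (c ξ u) = m ξ) ∧
      ∀ f g : L2E d, inner ℂ (tensor p₀ μF v g) (T (tensor p₀ μF u f)) =
        ∫ ξ, inner ℂ ((𝓕 g : L2E d) ξ) ((𝓕 f : L2E d) ξ) * m ξ := by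
    intro u v
    obtain ⟨m, hm, hloc, hmul⟩ := exists_matrix_element hT u v
    refine ⟨m, hm, ?_, hmul⟩
    -- At Lebesgue points of m the ball averages converge, so the limit along the ultrafilter has to
    -- be m ξ.
    filter_upwards [IsUnifLocDoublingMeasure.ae_tendsto_average volume hloc 1] with ξ hξ
    have h1 := hξ (fun _ => ξ) r hr (Eventually.of_forall fun k => by
      rw [one_mul]
      exact Metric.mem_closedBall_self (by simp only [r]; positivity))
    have h2 : Tendsto (fun k => inner ℂ v (symbolAverage T ξ (r k) u)) atTop (𝓝 (m ξ)) :=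
      h1.congr fun k => (inner_symbolAverage T ξ (r k) u v hmul).symm
    have h3 := h2.mono_left Nat.hyperfilter_le_atTop
    have h4 := (Complex.continuous_conj.tendsto _).comp (hlim ξ u v)
    rw [inner_conj_symm] at h4
    refine tendsto_nhds_unique (h4.congr fun k => ?_) h3
    exact inner_conj_symm _ _
  have hπ : (2 * Real.pi) ≠ 0 := by positivity
  -- The rescaling compensates for the factor 2π in the exponent of the Fourier transform.
  refine ⟨fun ξ => c ((2 * Real.pi)⁻¹ • ξ), fun ξ => hc _, ⟨‖T‖, fun ξ => hc _⟩, fun u => ?_,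
    fun u v f g => ?_⟩
  · have h1 : AEStronglyMeasurable (fun ξ => c ξ u) volume := by
      refine aestronglyMeasurable_of_inner fun v => ?_
      obtain ⟨m, hm, hcm, -⟩ := key u v
      exact hm.congr (hcm.mono fun ξ h => h.symm)
    exact h1.comp_quasiMeasurePreserving
      (Measure.quasiMeasurePreserving_smul volume (inv_ne_zero hπ))
  · obtain ⟨m, -, hcm, hmul⟩ := key u v
    rw [hmul]
    refine integral_congr_ae ?_
    filter_upwards [hcm] with ξ hξ
    rw [smul_smul, inv_mul_cancel₀ hπ, one_smul, hξ]

/-- Symbols are determined almost everywhere. -/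
theorem IsSymbol.ae_eq [TopologicalSpace.SeparableSpace (L2Cover p₀ μF)]
    {T : L2Lift p₀ μF →L[ℂ] L2Lift p₀ μF}
    {b b' : E d → (L2Cover p₀ μF →L[ℂ] L2Cover p₀ μF)} (h : IsSymbol p₀ μF T b)
    (h' : IsSymbol p₀ μF T b') : ∀ᵐ ξ, b ξ = b' ξ := by
  have hπ : (2 * Real.pi) ≠ 0 := by positivity
  have hq : Measure.QuasiMeasurePreserving (fun ξ : E d => (2 * Real.pi) • ξ) volume volume :=
    Measure.quasiMeasurePreserving_smul volume hπ
  have hq' : Measure.QuasiMeasurePreserving (fun ξ : E d => (2 * Real.pi)⁻¹ • ξ) volume volume :=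
    Measure.quasiMeasurePreserving_smul volume (inv_ne_zero hπ)
  obtain ⟨g₀, hg₀⟩ := exists_pos_memLp (d := d)
  obtain ⟨C, hC⟩ := h.bounded
  obtain ⟨C', hC'⟩ := h'.bounded
  have key : ∀ u v : L2Cover p₀ μF, ∀ᵐ ξ, inner ℂ v (b ξ u) = inner ℂ v (b' ξ u) := by
    intro u v
    let m : E d → ℂ := fun ξ => inner ℂ v (b ((2 * Real.pi) • ξ) u)
    let m' : E d → ℂ := fun ξ => inner ℂ v (b' ((2 * Real.pi) • ξ) u)
    have hm : IsBddMeas volume m := by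
      refine ⟨(aestronglyMeasurable_const.inner (h.measurable u)).comp_quasiMeasurePreserving hq,
        (‖v‖ * (C * ‖u‖)).toNNReal, fun ξ => ?_⟩
      rw [← NNReal.coe_le_coe]
      refine le_trans ?_ (Real.le_coe_toNNReal _)
      refine (norm_inner_le_norm _ _).trans ?_
      gcongr
      exact (b _).le_of_opNorm_le (hC _) u
    have hm' : IsBddMeas volume m' := by
      refine ⟨(aestronglyMeasurable_const.inner (h'.measurable u)).comp_quasiMeasurePreserving hq,
        (‖v‖ * (C' * ‖u‖)).toNNReal, fun ξ => ?_⟩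
      rw [← NNReal.coe_le_coe]
      refine le_trans ?_ (Real.le_coe_toNNReal _)
      refine (norm_inner_le_norm _ _).trans ?_
      gcongr
      exact (b' _).le_of_opNorm_le (hC' _) u
    have e1 : ∀ {k : E d → ℂ} (hk : IsBddMeas volume k) (p q : L2E d),
        ∫ ξ, inner ℂ (p ξ) (q ξ) * k ξ = inner ℂ p (mulLp hk q) := by
      intro k hk p q
      rw [L2.inner_def]
      refine integral_congr_ae ?_
      filter_upwards [mulLp_ae hk q] with ξ h1
      rw [h1, RCLike.inner_apply, RCLike.inner_apply]
      ring
    -- It suffices to compare the two bounded multipliers on one function which is nonzero almost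
    -- everywhere.
    have e2 : mulLp hm g₀ = mulLp hm' g₀ := by
      refine ext_inner_left ℂ fun p => ?_
      have h1 := h.eq u v (𝓕⁻ g₀) (𝓕⁻ p)
      have h2 := h'.eq u v (𝓕⁻ g₀) (𝓕⁻ p)
      rw [h1, FourierTransform.fourier_fourierInv_eq, FourierTransform.fourier_fourierInv_eq] at h2
      rw [← e1 hm, ← e1 hm']
      exact h2
    have e3 : ∀ᵐ ξ, m ξ = m' ξ := by
      have h1 := mulLp_ae hm g₀
      rw [e2] at h1
      filter_upwards [h1, mulLp_ae hm' g₀, hg₀] with ξ h1 h2 ⟨r, hr, h3⟩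
      rw [h1, h3] at h2
      exact mul_right_cancel₀ (by exact_mod_cast hr.ne') h2
    filter_upwards [hq'.ae e3] with ξ hξ
    simpa only [m, m', smul_smul, mul_inv_cancel₀ hπ, one_smul] using hξ
  have : Nonempty (L2Cover p₀ μF) := ⟨0⟩
  let s := TopologicalSpace.denseSeq (L2Cover p₀ μF)
  have hs : DenseRange s := TopologicalSpace.denseRange_denseSeq _
  -- A countable dense sequence allows a single null set for all matrix elements.
  have hall : ∀ᵐ ξ, ∀ i j, inner ℂ (s j) (b ξ (s i)) = inner ℂ (s j) (b' ξ (s i)) := by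
    rw [ae_all_iff]
    intro i
    rw [ae_all_iff]
    exact fun j => key (s i) (s j)
  filter_upwards [hall] with ξ hξ
  refine ContinuousLinearMap.ext fun u => ?_
  refine congrFun (hs.equalizer (b ξ).continuous (b' ξ).continuous (funext fun i => ?_)) u
  refine ext_inner_left ℂ fun v => ?_
  exact congrFun (hs.equalizer (continuous_id.inner continuous_const)
    (continuous_id.inner continuous_const) (funext fun j => hξ i j)) v

theorem permCover_permCover (σ τ : structGroup p₀) (u : L2Cover p₀ μF) :
    permCover p₀ μF σ (permCover p₀ μF τ u) = permCover p₀ μF (σ * τ) u := by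
  have h := Lp.compMeasurePreserving_comp_apply u (measurePreserving_smul p₀ μF τ⁻¹)
    (measurePreserving_smul p₀ μF σ⁻¹)
  refine h.symm.trans (compMeasurePreserving_congr _ _ ?_ u)
  funext y
  simp [mul_smul]

theorem permCover_one (u : L2Cover p₀ μF) : permCover p₀ μF 1 u = u := by
  refine (compMeasurePreserving_congr _ (MeasurePreserving.id _) ?_ u).trans
    (Lp.compMeasurePreserving_id_apply u)
  funext y
  simp

theorem norm_permCover (σ : structGroup p₀) (u : L2Cover p₀ μF) : ‖permCover p₀ μF σ u‖ = ‖u‖ :=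
  Lp.norm_compMeasurePreserving u (measurePreserving_smul p₀ μF σ⁻¹)

theorem inner_permCover_permCover (σ : structGroup p₀) (u v : L2Cover p₀ μF) :
    inner ℂ (permCover p₀ μF σ u) (permCover p₀ μF σ v) = inner ℂ u v :=
  (Lp.compMeasurePreservingₗᵢ ℂ _ (measurePreserving_smul p₀ μF σ⁻¹)).inner_map_map u v

/-- The symbol of an operator which commutes with renumberings is invariant. -/
theorem IsSymbol.comp_permCover [TopologicalSpace.SeparableSpace (L2Cover p₀ μF)]
    {T : L2Lift p₀ μF →L[ℂ] L2Lift p₀ μF}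
    {b : E d → (L2Cover p₀ μF →L[ℂ] L2Cover p₀ μF)} (h : IsSymbol p₀ μF T b)
    (σ : structGroup p₀) (hT : ∀ u, T (permLift p₀ μF σ u) = permLift p₀ μF σ (T u)) :
    ∀ᵐ ξ : E d, (b (permVec σ.1 ξ)).comp (permCover p₀ μF σ) =
      (permCover p₀ μF σ).comp (b ξ) := by
  -- The symbol of T conjugated by the renumbering; as T commutes with it, this is a second symbol
  -- of T and has to agree with b.
  let b' : E d → (L2Cover p₀ μF →L[ℂ] L2Cover p₀ μF) := fun ξ =>
    (permCover p₀ μF σ⁻¹).comp ((b (permVec σ.1 ξ)).comp (permCover p₀ μF σ))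
  have hb' : IsSymbol p₀ μF T b' := by
    obtain ⟨C, hC⟩ := h.bounded
    refine ⟨⟨C, fun ξ => ?_⟩, fun u => ?_, fun u v f g => ?_⟩
    · refine ContinuousLinearMap.opNorm_le_bound _ ((norm_nonneg _).trans (hC 0)) fun u => ?_
      change ‖permCover p₀ μF σ⁻¹ (b (permVec σ.1 ξ) (permCover p₀ μF σ u))‖ ≤ _
      rw [norm_permCover, ← norm_permCover σ u]
      exact (b _).le_of_opNorm_le (hC _) _
    · exact (permCover p₀ μF σ⁻¹).continuous.comp_aestronglyMeasurable
        ((h.measurable (permCover p₀ μF σ u)).comp_quasiMeasurePreserving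
          (permVec (d := d) σ.1).measurePreserving.quasiMeasurePreserving)
    -- A renumbering acts on both tensor factors. On the second one it commutes with the Fourier
    -- transform and is undone by the substitution ξ ↦ σξ.
    · rw [← inner_permLift_permLift σ, ← hT, permLift_tensor, permLift_tensor, h.eq,
        fourier_permE, fourier_permE]
      have hmp := (permVec (d := d) σ.1).measurePreserving
      rw [← hmp.integral_comp (permVec (d := d) σ.1).toHomeomorph.measurableEmbedding]
      refine integral_congr_ae ?_
      filter_upwards [hmp.quasiMeasurePreserving.ae (permE_ae σ.1 (𝓕 f : L2E d)),
        hmp.quasiMeasurePreserving.ae (permE_ae σ.1 (𝓕 g : L2E d))] with ξ h1 h2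
      have h3 : permVec σ.1⁻¹ (permVec (d := d) σ.1 ξ) = ξ := by
        rw [← permVec_mul, inv_mul_cancel, permVec_one]
      rw [h1, h2, h3, ← map_smul]
      congr 1
      change _ = inner ℂ v (permCover p₀ μF σ⁻¹ (b _ (permCover p₀ μF σ u)))
      rw [← inner_permCover_permCover σ v, permCover_permCover, mul_inv_cancel, permCover_one]
  filter_upwards [h.ae_eq hb'] with ξ hξ
  refine ContinuousLinearMap.ext fun u => ?_
  change _ = permCover p₀ μF σ (b ξ u)
  rw [hξ]
  change _ = permCover p₀ μF σ (permCover p₀ μF σ⁻¹ (b _ (permCover p₀ μF σ u)))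
  rw [permCover_permCover, mul_inv_cancel, permCover_one]
  rfl

end SymbolExistence

end Corners

namespace Corners

/-! ### Transition maps of charts and invariance of the depth. -/

section Charts

variable {n : ℕ} {M : Type*} [TopologicalSpace M] [ChartedSpace (EuclideanQuadrant n) M]

/-- The retraction of `ℝⁿ` to the quadrant. -/
def quad (v : E n) : EuclideanQuadrant n := (modelWithCornersEuclideanQuadrant n).symm v

theorem continuous_quad : Continuous (quad (n := n)) :=
  (modelWithCornersEuclideanQuadrant n).continuous_symm

theorem quad_val {v : E n} (hv : ∀ k, 0 ≤ v k) : (quad v).1 = v :=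
  (modelWithCornersEuclideanQuadrant n).right_inv (x := v) (by
    change v ∈ range (Subtype.val : EuclideanQuadrant n → _)
    rw [range_euclideanQuadrant]
    exact hv)

theorem val_quad (q : EuclideanQuadrant n) : quad q.1 = q :=
  (modelWithCornersEuclideanQuadrant n).left_inv q

theorem continuous_val : Continuous (fun q : EuclideanQuadrant n => q.1) :=
  (modelWithCornersEuclideanQuadrant n).continuous

/-- The transition map between two charts, extended to `ℝⁿ`. -/
def transition (e e' : OpenPartialHomeomorph M (EuclideanQuadrant n)) (v : E n) : E n :=
  (e' (e.symm (quad v))).1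

theorem transition_coord {e e' : OpenPartialHomeomorph M (EuclideanQuadrant n)} {x : M}
    (hx : x ∈ e.source) : transition e e' (e x).1 = (e' x).1 := by
  rw [transition, val_quad, e.left_inv hx]

theorem contDiffWithinAt_transition {e e' : OpenPartialHomeomorph M (EuclideanQuadrant n)}
    (he : e ∈ smoothCharts n M) (he' : e' ∈ smoothCharts n M) {x : M} (hx : x ∈ e.source)
    (hx' : x ∈ e'.source) :
    ContDiffWithinAt ℝ ∞ (transition e e') {v | ∀ k, 0 ≤ v k} (e x).1 := by
  have h := (contDiffGroupoid ∞ (modelWithCornersEuclideanQuadrant n)).compatible_of_mem_maximalAtlas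
    he he'
  rw [contDiffGroupoid, mem_groupoid_of_pregroupoid] at h
  have h1 : ContDiffOn ℝ ∞ (transition e e')
      ((modelWithCornersEuclideanQuadrant n).symm ⁻¹' (e.symm ≫ₕ e').source ∩
        range (modelWithCornersEuclideanQuadrant n)) := h.1
  have hr : range (modelWithCornersEuclideanQuadrant n) = {v : E n | ∀ k, 0 ≤ v k} :=
    range_euclideanQuadrant n
  rw [hr] at h1
  have hmem : quad (e x).1 ∈ (e.symm ≫ₕ e').source := by
    rw [val_quad, OpenPartialHomeomorph.trans_source]
    refine ⟨e.map_source hx, ?_⟩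
    rw [mem_preimage, e.left_inv hx]
    exact hx'
  have h2 := h1 (e x).1 ⟨hmem, (e x).2⟩
  refine h2.mono_of_mem_nhdsWithin ?_
  refine inter_mem (mem_nhdsWithin_of_mem_nhds ?_) self_mem_nhdsWithin
  exact continuous_quad.continuousAt ((e.symm ≫ₕ e').open_source.mem_nhds hmem)

/-- Derivatives within the quadrant are unique even at corners, which makes the differentials of
inverse transition maps inverse to each other. -/
theorem uniqueDiffOn_quadrant : UniqueDiffOn ℝ {v : E n | ∀ k, 0 ≤ v k} := by
  have := (modelWithCornersEuclideanQuadrant n).uniqueDiffOn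
  rwa [show range (modelWithCornersEuclideanQuadrant n) = {v : E n | ∀ k, 0 ≤ v k} from
    range_euclideanQuadrant n] at this

/-- The derivative of a transition map annihilates the vanishing coordinates on the vectors
tangent to the corner. -/
theorem fderivWithin_transition_eq_zero {e e' : OpenPartialHomeomorph M (EuclideanQuadrant n)}
    (he : e ∈ smoothCharts n M) (he' : e' ∈ smoothCharts n M) {x : M} (hx : x ∈ e.source)
    (hx' : x ∈ e'.source) {v : E n} (hv : ∀ k, (e x).1 k = 0 → v k = 0) {l : Fin n}
    (hl : (e' x).1 l = 0) :
    fderivWithin ℝ (transition e e') {v | ∀ k, 0 ≤ v k} (e x).1 v l = 0 := by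
  set Q : Set (E n) := {v | ∀ k, 0 ≤ v k} with hQ
  have hd := ((contDiffWithinAt_transition he he' hx hx').differentiableWithinAt
    (by simp)).hasFDerivWithinAt
  rw [← hQ] at hd
  let c : ℝ → E n := fun s => (e x).1 + s • v
  have hc0 : c 0 = (e x).1 := by simp [c]
  have hc : HasDerivAt c v 0 := by
    simpa [c] using ((hasDerivAt_id (0 : ℝ)).smul_const v).const_add (e x).1
  have hcQ : ∀ᶠ s in 𝓝 (0 : ℝ), c s ∈ Q := by
    simp only [hQ, mem_ofPred_eq, eventually_all]
    intro k
    -- The line remains in the quadrant for small s of both signs: v vanishes along the coordinates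
    -- that are zero, and the others are positive.
    rcases ((e x).2 k).eq_or_lt with h0 | h0
    · refine Eventually.of_forall fun s => ?_
      simp [c, ← h0, hv k h0.symm]
    · have hcont : ContinuousAt (fun s => c s k) 0 := by
        simp only [c]
        fun_prop
      have h2 : 0 < c 0 k := by rw [hc0]; exact h0
      filter_upwards [hcont.eventually (lt_mem_nhds h2)] with s hs using hs.le
  rw [← hc0] at hd
  have h1 : HasDerivAt (transition e e' ∘ c)
      (fderivWithin ℝ (transition e e') Q (c 0) v) 0 := by
    have h3 := hd.comp_hasDerivWithinAt (s := c ⁻¹' Q) (0 : ℝ) hc.hasDerivWithinAt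
      (mapsTo_preimage _ _)
    exact h3.hasDerivAt hcQ
  have h2 : HasDerivAt (fun s => (transition e e' (c s)) l)
      (fderivWithin ℝ (transition e e') Q (c 0) v l) 0 := by
    have h4 := ((EuclideanSpace.proj l : E n →L[ℝ] ℝ).hasFDerivAt
      (x := (transition e e' ∘ c) 0)).comp_hasDerivAt 0 h1
    exact h4
  rw [hc0] at h2
  -- A coordinate of a quadrant is nonnegative, and here it is zero at s = 0, so this is a minimum.
  refine IsLocalMin.hasDerivAt_eq_zero (Eventually.of_forall fun s => ?_) h2
  simp only [hc0, transition_coord hx, hl]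
  exact (e' (e.symm (quad (c s)))).2 l

/-- The differential of the transition map is injective and sends vectors tangent to the corner of
`e` to vectors tangent to the corner of `e'`. The dimensions of these tangent spaces are n minus the
numbers of vanishing coordinates. -/
theorem ncard_zeros_le {e e' : OpenPartialHomeomorph M (EuclideanQuadrant n)}
    (he : e ∈ smoothCharts n M) (he' : e' ∈ smoothCharts n M) {x : M} (hx : x ∈ e.source)
    (hx' : x ∈ e'.source) :
    {k | (e' x).1 k = 0}.ncard ≤ {k | (e x).1 k = 0}.ncard := by
  set Q : Set (E n) := {v | ∀ k, 0 ≤ v k} with hQ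
  let L := fderivWithin ℝ (transition e e') Q (e x).1
  let L' := fderivWithin ℝ (transition e' e) Q (e' x).1
  have hL : ∀ v, L' (L v) = v := by
    have hd := ((contDiffWithinAt_transition he he' hx hx').differentiableWithinAt
      (by simp)).hasFDerivWithinAt
    have hd' := ((contDiffWithinAt_transition he' he hx' hx).differentiableWithinAt
      (by simp)).hasFDerivWithinAt
    rw [← hQ] at hd hd'
    have h1 : HasFDerivWithinAt (transition e' e ∘ transition e e') (L'.comp L) Q (e x).1 := by
      refine HasFDerivWithinAt.comp (t := Q) _ ?_ hd (fun v _ => (e' (e.symm (quad v))).2)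
      rw [transition_coord hx]
      exact hd'
    have h2 : HasFDerivWithinAt (transition e' e ∘ transition e e') (.id ℝ (E n)) Q (e x).1 := by
      refine (hasFDerivWithinAt_id (e x).1 Q).congr_of_eventuallyEq ?_ ?_
      · have h3 : ∀ᶠ v in 𝓝 (e x).1, quad v ∈ e.target ∧ e.symm (quad v) ∈ e'.source := by
          have h4 : ∀ᶠ q in 𝓝 (e x), q ∈ e.target ∧ e.symm q ∈ e'.source := by
            refine Eventually.and (e.open_target.mem_nhds (e.map_source hx)) ?_
            have := e.continuousAt_symm (e.map_source hx)
            rw [ContinuousAt, e.left_inv hx] at this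
            exact this.eventually (e'.open_source.mem_nhds hx')
          have h5 : Tendsto quad (𝓝 (e x).1) (𝓝 (e x)) := by
            have := continuous_quad.tendsto (e x).1
            rwa [val_quad] at this
          exact h5.eventually h4
        filter_upwards [mem_nhdsWithin_of_mem_nhds h3, self_mem_nhdsWithin] with v h4 hv
        have h6 : v = (e (e.symm (quad v))).1 := by
          rw [e.right_inv h4.1, quad_val hv]
        change transition e' e (transition e e' v) = v
        conv_lhs => rw [h6]
        have hs : e.symm (quad v) ∈ e.source := e.map_target h4.1
        rw [transition_coord hs, transition_coord h4.2, ← h6]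
      · change transition e' e (transition e e' _) = _
        rw [transition_coord hx, transition_coord hx']
        rfl
    have h3 := (uniqueDiffOn_quadrant (e x).1 (e x).2).eq h1 h2
    intro v
    exact congrArg (fun A : E n →L[ℝ] E n => A v) h3
  classical
  -- ι is the inclusion of the vectors tangent to the corner in `e`; π forgets the coordinates in
  -- which their images in `e'` vanish anyway, so no injectivity is lost.
  let ι : ({k // (e x).1 k ≠ 0} → ℝ) →ₗ[ℝ] E n :=
    { toFun := fun w => WithLp.toLp 2 fun k => if h : (e x).1 k ≠ 0 then w ⟨k, h⟩ else 0
      map_add' := fun w w' => by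
        ext k
        by_cases h : (e x).1 k = 0 <;> simp [h]
      map_smul' := fun c w => by
        ext k
        by_cases h : (e x).1 k = 0 <;> simp [h] }
  let π : E n →ₗ[ℝ] ({k // (e' x).1 k ≠ 0} → ℝ) :=
    { toFun := fun v k => v k.1
      map_add' := fun _ _ => rfl
      map_smul' := fun _ _ => rfl }
  have hinj : Function.Injective (π ∘ₗ (L : E n →ₗ[ℝ] E n) ∘ₗ ι) := by
    rw [← LinearMap.ker_eq_bot, LinearMap.ker_eq_bot']
    intro w hw
    have hLw : L (ι w) = 0 := by
      ext l
      by_cases hl : (e' x).1 l = 0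
      · refine fderivWithin_transition_eq_zero he he' hx hx' (fun k hk => ?_) hl
        simp [ι, hk]
      · exact congrFun hw ⟨l, hl⟩
    have hw0 : ι w = 0 := by rw [← hL (ι w), hLw, map_zero]
    funext k
    have := congrArg (fun v : E n => v k.1) hw0
    simpa [ι, k.2] using this
  have hle := LinearMap.finrank_le_finrank_of_injective hinj
  rw [Module.finrank_fintype_fun_eq_card, Module.finrank_fintype_fun_eq_card] at hle
  have e1 : ∀ (p : Fin n → Prop) [DecidablePred p], Fintype.card {k // ¬ p k} + {k | p k}.ncard = n := by
    intro p _
    rw [← Nat.card_coe_set_eq, Nat.card_eq_fintype_card]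
    have := Fintype.card_subtype_compl p
    have h3 := Fintype.card_subtype_le p
    simp only [Fintype.card_fin] at this h3
    change _ + Fintype.card {k // p k} = n
    omega
  have h1 := e1 fun k => (e x).1 k = 0
  have h2 := e1 fun k => (e' x).1 k = 0
  simp only [ne_eq] at hle
  omega

variable [IsManifold (modelWithCornersEuclideanQuadrant n) ∞ M]

/-- The depth can be computed in any smooth chart. -/
theorem depth_eq {e : OpenPartialHomeomorph M (EuclideanQuadrant n)}
    (he : e ∈ smoothCharts n M) {x : M} (hx : x ∈ e.source) :
    depth (n := n) x = {k | (e x).1 k = 0}.ncard := by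
  have hc : chartAt (EuclideanQuadrant n) x ∈ smoothCharts n M :=
    IsManifold.chart_mem_maximalAtlas x
  exact le_antisymm (ncard_zeros_le he hc hx (mem_chart_source _ x))
    (ncard_zeros_le hc he (mem_chart_source _ x) hx)

end Charts

end Corners

namespace Corners

/-! ### Local hyperfaces in different charts. -/

section Walls

variable {n : ℕ} {M : Type*} [TopologicalSpace M]

theorem tendsto_symm_quad {e : OpenPartialHomeomorph M (EuclideanQuadrant n)} {x : M}
    (hx : x ∈ e.source) : Tendsto (fun v => e.symm (quad v)) (𝓝 (e x).1) (𝓝 x) := by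
  have h1 : Tendsto quad (𝓝 (e x).1) (𝓝 (e x)) := by
    have := continuous_quad.tendsto (e x).1
    rwa [val_quad] at this
  have h2 := e.continuousAt_symm (e.map_source hx)
  rw [ContinuousAt, e.left_inv hx] at h2
  exact h2.comp h1

theorem eventually_quad_mem_target {e : OpenPartialHomeomorph M (EuclideanQuadrant n)} {x : M}
    (hx : x ∈ e.source) : ∀ᶠ v in 𝓝 (e x).1, quad v ∈ e.target := by
  have h1 : Tendsto quad (𝓝 (e x).1) (𝓝 (e x)) := by
    have := continuous_quad.tendsto (e x).1
    rwa [val_quad] at this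
  exact h1.eventually (e.open_target.mem_nhds (e.map_source hx))

theorem continuousAt_coord {e : OpenPartialHomeomorph M (EuclideanQuadrant n)} {x : M}
    (hx : x ∈ e.source) : ContinuousAt (fun y => (e y).1) x :=
  continuous_val.continuousAt.comp (e.continuousAt hx)

theorem continuousAt_coord_apply {e : OpenPartialHomeomorph M (EuclideanQuadrant n)} {x : M}
    (hx : x ∈ e.source) (k : Fin n) : ContinuousAt (fun y => (e y).1 k) x :=
  (EuclideanSpace.proj k : E n →L[ℝ] ℝ).continuous.continuousAt.comp (continuousAt_coord hx)

/-- A point of the hypersurface `{e_k = 0}` is a limit of points at which no other coordinate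
vanishes. -/
theorem frequently_only_zero {e : OpenPartialHomeomorph M (EuclideanQuadrant n)} {x : M}
    (hx : x ∈ e.source) {k : Fin n} (hk : (e x).1 k = 0) :
    ∃ᶠ y in 𝓝 x, y ∈ e.source ∧ (e y).1 k = 0 ∧ ∀ l ≠ k, 0 < (e y).1 l := by
  -- Moving along this vector keeps the k-th coordinate zero and makes all the others positive.
  let c : E n := WithLp.toLp 2 fun l => if l = k then 0 else 1
  have hcont : Tendsto (fun t : ℝ => (e x).1 + t • c) (𝓝[>] 0) (𝓝 (e x).1) := by
    have : Continuous fun t : ℝ => (e x).1 + t • c := by fun_prop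
    have h := this.tendsto 0
    simp only [zero_smul, add_zero] at h
    exact h.mono_left nhdsWithin_le_nhds
  refine ((tendsto_symm_quad hx).comp hcont).frequently (Eventually.frequently ?_)
  filter_upwards [hcont.eventually (eventually_quad_mem_target hx), self_mem_nhdsWithin]
    with t ht ht0
  have h0 : ∀ l, 0 ≤ ((e x).1 + t • c) l := fun l => by
    have := (e x).2 l
    have h2 : 0 ≤ c l := by simp only [c]; split_ifs <;> simp
    have h3 : 0 ≤ t * c l := mul_nonneg (le_of_lt ht0) h2
    simpa using add_nonneg this h3
  simp only [Function.comp_apply]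
  refine ⟨e.map_target ht, ?_⟩
  rw [e.right_inv ht, quad_val h0]
  refine ⟨by simp [c, hk], fun l hl => ?_⟩
  have h1 := (e x).2 l
  have h2 : (0 : ℝ) < t := ht0
  simp only [PiLp.add_apply, PiLp.smul_apply, c, hl, if_false, smul_eq_mul, mul_one]
  linarith

theorem wallGerm_eq_iff {e e' : OpenPartialHomeomorph M (EuclideanQuadrant n)} {x : M}
    (hx : x ∈ e.source) (hx' : x ∈ e'.source) {k k' : Fin n} :
    wallGerm e k x = wallGerm e' k' x ↔ ∀ᶠ y in 𝓝 x, ((e y).1 k = 0 ↔ (e' y).1 k' = 0) := by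
  rw [wallGerm, wallGerm, nhdsWithin_eq_iff_eventuallyEq, eventuallyEq_set]
  refine eventually_congr ?_
  filter_upwards [e.open_source.mem_nhds hx, e'.open_source.mem_nhds hx'] with y h1 h2
  simp [h1, h2]

/-- Arbitrarily close to x there are points where the k-th coordinate vanishes and no other one
does. -/
theorem wallGerm_injective {e : OpenPartialHomeomorph M (EuclideanQuadrant n)} {x : M}
    (hx : x ∈ e.source) {k l : Fin n} (hk : (e x).1 k = 0)
    (h : wallGerm e k x = wallGerm e l x) : k = l := by
  rw [wallGerm_eq_iff hx hx] at h
  obtain ⟨y, ⟨-, hy1, hy2⟩, hy⟩ := ((frequently_only_zero hx hk).and_eventually h).exists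
  by_contra hne
  exact (hy2 l (Ne.symm hne)).ne' (hy.1 hy1)

variable [ChartedSpace (EuclideanQuadrant n) M]
  [IsManifold (modelWithCornersEuclideanQuadrant n) ∞ M]

theorem ncard_zeros_eq {e e' : OpenPartialHomeomorph M (EuclideanQuadrant n)}
    (he : e ∈ smoothCharts n M) (he' : e' ∈ smoothCharts n M) {x : M} (hx : x ∈ e.source)
    (hx' : x ∈ e'.source) :
    {k | (e' x).1 k = 0}.ncard = {k | (e x).1 k = 0}.ncard :=
  le_antisymm (ncard_zeros_le he he' hx hx') (ncard_zeros_le he' he hx' hx)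

/-- Near x, the points where only the k-th coordinate of `e` vanishes form a connected set. At each
of them exactly one coordinate of `e'` vanishes, by equality of the depths, and its index is locally
constant, hence constant. The remaining points of the hypersurface are limits of these. -/
theorem exists_eventually_zero {e e' : OpenPartialHomeomorph M (EuclideanQuadrant n)}
    (he : e ∈ smoothCharts n M) (he' : e' ∈ smoothCharts n M) {x : M} (hx : x ∈ e.source)
    (hx' : x ∈ e'.source) {k : Fin n} (hk : (e x).1 k = 0) :
    ∃ k', ∀ᶠ y in 𝓝 x, (e y).1 k = 0 → (e' y).1 k' = 0 := by
  obtain ⟨r, hr, hball⟩ := Metric.eventually_nhds_iff_ball.1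
    ((eventually_quad_mem_target hx).and
      ((tendsto_symm_quad hx).eventually (e'.open_source.mem_nhds hx')))
  let S : Set (E n) := {v | v ∈ Metric.ball (e x).1 r ∧ v k = 0 ∧ ∀ l ≠ k, 0 < v l}
  have hSc : IsPreconnected S := by
    refine Convex.isPreconnected ?_
    have h1 : Convex ℝ {v : E n | v k = 0} := by
      intro v hv w hw a b _ _ _
      simp only [mem_ofPred_eq] at hv hw ⊢
      simp [hv, hw]
    have h2 : Convex ℝ {v : E n | ∀ l ≠ k, 0 < v l} := by
      intro v hv w hw a b ha hb hab l hl
      have h3 := hv l hl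
      have h4 := hw l hl
      have : 0 < a * v l + b * w l := by
        rcases ha.eq_or_lt with h0 | h0
        · have : b = 1 := by linarith
          rw [← h0, this]; linarith
        · have := mul_pos h0 h3
          have := mul_nonneg hb h4.le
          linarith
      simpa using this
    exact (convex_ball _ _).inter (h1.inter h2)
  have hS : ∀ v ∈ S, e.symm (quad v) ∈ e.source ∧ e.symm (quad v) ∈ e'.source ∧
      (e (e.symm (quad v))).1 = v := by
    intro v hv
    obtain ⟨h1, h2⟩ := hball v hv.1
    refine ⟨e.map_target h1, h2, ?_⟩
    rw [e.right_inv h1, quad_val]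
    intro l
    by_cases hl : l = k
    · rw [hl, hv.2.1]
    · exact (hv.2.2 l hl).le
  have hone : ∀ v ∈ S, ∃ k', {l | (e' (e.symm (quad v))).1 l = 0} = {k'} := by
    intro v hv
    obtain ⟨h1, h2, h3⟩ := hS v hv
    rw [← ncard_eq_one, ncard_zeros_eq he he' h1 h2, h3, ncard_eq_one]
    refine ⟨k, Set.ext fun l => ?_⟩
    simp only [mem_ofPred_eq, mem_singleton_iff]
    constructor
    · intro hl
      by_contra hne
      exact (hv.2.2 l hne).ne' hl
    · rintro rfl
      exact hv.2.1
  have : Nonempty (Fin n) := ⟨k⟩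
  choose! κ hκ using hone
  have hcont : ContinuousOn κ S := by
    intro v hv
    obtain ⟨h1, h2, h3⟩ := hS v hv
    have hY : Tendsto (fun w => e.symm (quad w)) (𝓝 v) (𝓝 (e.symm (quad v))) := by
      have := tendsto_symm_quad h1
      rwa [h3] at this
    refine tendsto_const_nhds.congr' ?_
    -- The coordinates which are nonzero at v stay nonzero nearby, so the only one that vanishes
    -- cannot change.
    have hev : ∀ᶠ w in 𝓝 v, ∀ l, l ≠ κ v → (e' (e.symm (quad w))).1 l ≠ 0 := by
      rw [eventually_all]
      intro l
      by_cases hl : l = κ v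
      · simp [hl]
      · have h4 : (e' (e.symm (quad v))).1 l ≠ 0 := fun h5 => hl (by
          have : l ∈ {l | (e' (e.symm (quad v))).1 l = 0} := h5
          rwa [hκ v hv] at this)
        filter_upwards [((continuousAt_coord_apply h2 l).tendsto.comp hY).eventually_ne h4]
          with w hw _ using hw
    filter_upwards [mem_nhdsWithin_of_mem_nhds hev, self_mem_nhdsWithin] with w hw hwS
    by_contra hne
    have : κ w ∈ {l | (e' (e.symm (quad w))).1 l = 0} := by rw [hκ w hwS]; rfl
    exact hw _ (Ne.symm hne) this
  have hU : ∀ᶠ y in 𝓝 x, (e y).1 ∈ Metric.ball (e x).1 r :=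
    (continuousAt_coord hx).eventually (Metric.ball_mem_nhds _ hr)
  have hmemS : ∀ y ∈ e.source, (e y).1 ∈ Metric.ball (e x).1 r → (e y).1 k = 0 →
      (∀ l ≠ k, 0 < (e y).1 l) → (e y).1 ∈ S := fun y _ h1 h2 h3 => ⟨h1, h2, h3⟩
  obtain ⟨y₁, ⟨hy₁, hy₂, hy₃⟩, hy₄⟩ := ((frequently_only_zero hx hk).and_eventually hU).exists
  have hS₁ := hmemS y₁ hy₁ hy₄ hy₂ hy₃
  refine ⟨κ (e y₁).1, ?_⟩
  filter_upwards [hU.eventually_nhds, e.open_source.mem_nhds hx,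
    e'.open_source.mem_nhds hx'] with y hy hys hys' hyk
  by_contra hne
  have h1 := (continuousAt_coord_apply hys' (κ (e y₁).1)).eventually_ne hne
  obtain ⟨y', ⟨hs, hy'1, hy'2⟩, hy'3, hy'4⟩ :=
    ((frequently_only_zero hys hyk).and_eventually (hy.and h1)).exists
  have hS' := hmemS y' hs hy'3 hy'1 hy'2
  have h2 : κ (e y').1 ∈ {l | (e' (e.symm (quad (e y').1))).1 l = 0} := by rw [hκ _ hS']; rfl
  rw [val_quad, e.left_inv hs, hSc.constant hcont hS' hS₁] at h2
  exact hy'4 h2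

/-- The local hyperfaces do not depend on the chart. -/
theorem exists_wallGerm_eq {e e' : OpenPartialHomeomorph M (EuclideanQuadrant n)}
    (he : e ∈ smoothCharts n M) (he' : e' ∈ smoothCharts n M) {x : M} (hx : x ∈ e.source)
    (hx' : x ∈ e'.source) {k : Fin n} (hk : (e x).1 k = 0) :
    ∃ k', (e' x).1 k' = 0 ∧ wallGerm e k x = wallGerm e' k' x := by
  obtain ⟨k', hk'⟩ := exists_eventually_zero he he' hx hx' hk
  have hk0 := hk'.self_of_nhds hk
  obtain ⟨k'', hk''⟩ := exists_eventually_zero he' he hx' hx hk0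
  obtain ⟨y, ⟨-, hy1, hy2⟩, hy3, hy4⟩ :=
    ((frequently_only_zero hx hk).and_eventually (hk'.and hk'')).exists
  -- Passing from `e` to `e'` and back returns the same index, as seen at a point where only the
  -- k-th coordinate vanishes.
  have heq : k'' = k := by
    by_contra hne
    exact (hy2 _ hne).ne' (hy4 (hy3 hy1))
  rw [heq] at hk''
  refine ⟨k', hk0, (wallGerm_eq_iff hx hx').2 ?_⟩
  filter_upwards [hk', hk''] with y h1 h2 using ⟨h1, h2⟩

/-- Two defining functions of the same local hyperface are comparable. -/
theorem exists_coord_le_mul {e e' : OpenPartialHomeomorph M (EuclideanQuadrant n)}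
    (he : e ∈ smoothCharts n M) (he' : e' ∈ smoothCharts n M) {x : M} (hx : x ∈ e.source)
    (hx' : x ∈ e'.source) {k k' : Fin n} (hk : (e x).1 k = 0)
    (h : wallGerm e k x = wallGerm e' k' x) :
    ∃ C : ℝ, 0 < C ∧ ∀ᶠ y in 𝓝 x, (e' y).1 k' ≤ C * (e y).1 k := by
  rw [wallGerm_eq_iff hx hx'] at h
  have hconv : Convex ℝ {v : E n | ∀ l, 0 ≤ v l} := EuclideanQuadrant.convex
  obtain ⟨K, t, ht, hK⟩ := ((contDiffWithinAt_transition he he' hx hx').of_le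
    (by exact_mod_cast le_top : (1 : ℕ∞ω) ≤ ((⊤ : ℕ∞) : ℕ∞ω))).exists_lipschitzOnWith hconv
  -- The projection to the hypersurface {v k = 0}, where the other defining function vanishes too.
  -- The Lipschitz bound between v and P v then gives the comparison, since their distance is v k.
  let P : E n → E n := fun v => v - (v k) • EuclideanSpace.single k (1 : ℝ)
  have hPk : ∀ v, P v k = 0 := fun v => by simp [P]
  have hPl : ∀ v, ∀ l ≠ k, P v l = v l := fun v l hl => by simp [P, hl]
  have hP0 : P (e x).1 = (e x).1 := by simp [P, hk]
  have hPc : Tendsto P (𝓝 (e x).1) (𝓝 (e x).1) := by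
    have : Continuous P := by fun_prop
    have := this.tendsto (e x).1
    rwa [hP0] at this
  have hPQ : ∀ v : E n, (∀ l, 0 ≤ v l) → ∀ l, 0 ≤ P v l := by
    intro v hv l
    by_cases hl : l = k
    · rw [hl, hPk]
    · rw [hPl v l hl]; exact hv l
  have ht' : ∀ᶠ v in 𝓝 (e x).1, (∀ l, 0 ≤ v l) → v ∈ t := by
    rw [mem_nhdsWithin_iff_eventually] at ht
    exact ht
  have hx1 : Tendsto (fun y => (e y).1) (𝓝 x) (𝓝 (e x).1) := continuousAt_coord hx
  have hz : ∀ᶠ v in 𝓝 (e x).1, quad v ∈ e.target ∧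
      ((e (e.symm (quad v))).1 k = 0 ↔ (e' (e.symm (quad v))).1 k' = 0) :=
    (eventually_quad_mem_target hx).and ((tendsto_symm_quad hx).eventually h)
  refine ⟨K + 1, by positivity, ?_⟩
  filter_upwards [hx1.eventually ht', (hPc.comp hx1).eventually ht',
    (hPc.comp hx1).eventually hz, e.open_source.mem_nhds hx] with y h1 h2 h3 hy
  have hv0 := (e y).2
  have hd := hK.dist_le_mul _ (h1 hv0) _ (h2 (hPQ _ hv0))
  simp only [Function.comp_apply] at hd h3
  have h4 : transition e e' (P (e y).1) k' = 0 := by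
    refine h3.2.1 ?_
    rw [e.right_inv h3.1, quad_val (hPQ _ hv0), hPk]
  have h5 : dist (e y).1 (P (e y).1) = (e y).1 k := by
    rw [dist_eq_norm]
    simp [P, norm_smul, abs_of_nonneg (hv0 k)]
  rw [h5, transition_coord hy] at hd
  have h6 : (e' y).1 k' ≤ dist (e' y).1 (transition e e' (P (e y).1)) := by
    rw [dist_eq_norm]
    have := PiLp.norm_apply_le ((e' y).1 - transition e e' (P (e y).1)) k'
    rw [PiLp.sub_apply, h4, sub_zero] at this
    exact (le_abs_self _).trans this
  have := hv0 k
  nlinarith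

end Walls

end Corners

namespace Corners

/-! ### The frame bundle as a covering; its second countability. -/

section Frames

variable {n d : ℕ} {M : Type*} [TopologicalSpace M] [ChartedSpace (EuclideanQuadrant n) M]

theorem Frame.chart_zero (p : Frame n M d) (i : Fin d) :
    (chartAt (EuclideanQuadrant n) p.pt p.pt).1 (p.idx i) = 0 := (p.zero_iff _).2 ⟨i, rfl⟩

theorem Frame.pt_mem_stratum (p : Frame n M d) : p.pt ∈ stratum n M d := by
  change {k : Fin n | (chartAt (EuclideanQuadrant n) p.pt p.pt).1 k = 0}.ncard = d
  have : {k : Fin n | (chartAt (EuclideanQuadrant n) p.pt p.pt).1 k = 0} = range p.idx :=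
    Set.ext p.zero_iff
  rw [this, ← image_univ, ncard_image_of_injective _ p.idx.injective, ncard_univ]
  simp

theorem mem_sheet_chartAt (p : Frame n M d) :
    p ∈ sheet (chartAt (EuclideanQuadrant n) p.pt) p.idx :=
  ⟨mem_chart_source _ _, fun _ => rfl⟩

/-- The walls of a frame determine its indices, since different vanishing coordinates have different
germs. -/
theorem sheet_inj {e : OpenPartialHomeomorph M (EuclideanQuadrant n)} {j : Fin d ↪ Fin n}
    {p p' : Frame n M d} (hp : p ∈ sheet e j) (hp' : p' ∈ sheet e j) (h : p.pt = p'.pt) :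
    p = p' := by
  refine Frame.ext h (Function.Embedding.ext fun i => ?_)
  have h1 : p.wall i = p'.wall i := by rw [hp.2 i, hp'.2 i, h]
  have h2 : wallGerm (chartAt (EuclideanQuadrant n) p.pt) (p.idx i) p.pt =
      wallGerm (chartAt (EuclideanQuadrant n) p.pt) (p'.idx i) p.pt := by
    refine h1.trans ?_
    rw [Frame.wall, h]
  exact wallGerm_injective (mem_chart_source _ _) (p.chart_zero i) h2

theorem sheet_zero {e : OpenPartialHomeomorph M (EuclideanQuadrant n)} {j : Fin d ↪ Fin n}
    {p : Frame n M d} (hp : p ∈ sheet e j) (i : Fin d) : (e p.pt).1 (j i) = 0 := by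
  have h := hp.2 i
  rw [Frame.wall, wallGerm_eq_iff (mem_chart_source _ _) hp.1] at h
  exact h.self_of_nhds.1 (p.chart_zero i)

theorem isOpen_sheet_inter {e : OpenPartialHomeomorph M (EuclideanQuadrant n)}
    (he : e ∈ smoothCharts n M) (j : Fin d ↪ Fin n) {O : Set M} (hO : IsOpen O) :
    IsOpen (sheet e j ∩ Frame.pt ⁻¹' O) :=
  TopologicalSpace.isOpen_generateFrom_of_mem ⟨e, he, j, O, hO, rfl⟩

theorem isOpen_sheet {e : OpenPartialHomeomorph M (EuclideanQuadrant n)}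
    (he : e ∈ smoothCharts n M) (j : Fin d ↪ Fin n) : IsOpen (sheet (d := d) e j) := by
  simpa using isOpen_sheet_inter he j isOpen_univ

/-- Sections of the frame bundle given by the numbering of the coordinates of a chart are
continuous. -/
theorem continuousOn_of_mem_sheet {e : OpenPartialHomeomorph M (EuclideanQuadrant n)}
    {j : Fin d ↪ Fin n} {s : M → Frame n M d} {A : Set M}
    (h : ∀ x ∈ A, s x ∈ sheet e j ∧ (s x).pt = x) : ContinuousOn s A := by
  rw [continuousOn_to_generateFrom_iff]
  rintro x hx S ⟨e', he', j', O, hO, rfl⟩ ⟨⟨h1, h2⟩, h3⟩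
  obtain ⟨h4, h5⟩ := h x hx
  rw [mem_preimage, h5] at h3
  rw [h5] at h1
  have hxe : x ∈ e.source := by rw [← h5]; exact h4.1
  have hw : ∀ᶠ y in 𝓝 x, ∀ i, wallGerm e (j i) y = wallGerm e' (j' i) y := by
    rw [eventually_all]
    intro i
    have h6 : wallGerm e (j i) x = wallGerm e' (j' i) x := by
      have := (h4.2 i).symm.trans (h2 i)
      rwa [h5] at this
    filter_upwards [((wallGerm_eq_iff hxe h1).1 h6).eventually_nhds,
      e.open_source.mem_nhds hxe, e'.open_source.mem_nhds h1] with y hy hy1 hy2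
    exact (wallGerm_eq_iff hy1 hy2).2 hy
  filter_upwards [mem_nhdsWithin_of_mem_nhds hw, self_mem_nhdsWithin,
    mem_nhdsWithin_of_mem_nhds (hO.mem_nhds h3),
    mem_nhdsWithin_of_mem_nhds (e'.open_source.mem_nhds h1)] with y hy hyA hyO hys
  obtain ⟨h7, h8⟩ := h y hyA
  refine ⟨⟨by rw [h8]; exact hys, fun i => ?_⟩, by rw [mem_preimage, h8]; exact hyO⟩
  rw [h7.2 i, h8, hy i]

variable [IsManifold (modelWithCornersEuclideanQuadrant n) ∞ M]

theorem Frame.continuous_pt : Continuous (Frame.pt : Frame n M d → M) := by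
  refine ⟨fun O hO => ?_⟩
  have : (Frame.pt : Frame n M d → M) ⁻¹' O =
      ⋃ x : M, ⋃ j, sheet (chartAt (EuclideanQuadrant n) x) j ∩ Frame.pt ⁻¹' O := by
    ext p
    simp only [mem_preimage, mem_iUnion, mem_inter_iff]
    exact ⟨fun h => ⟨p.pt, p.idx, mem_sheet_chartAt p, h⟩, fun ⟨_, _, _, h⟩ => h⟩
  rw [this]
  exact isOpen_iUnion fun x => isOpen_iUnion fun j =>
    isOpen_sheet_inter (IsManifold.chart_mem_maximalAtlas x) j hO

/-- The base point has depth d in every chart, so the d coordinates numbered by `j` are all that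
vanish. -/
theorem sheet_zero_iff {e : OpenPartialHomeomorph M (EuclideanQuadrant n)}
    (he : e ∈ smoothCharts n M) {j : Fin d ↪ Fin n} {p : Frame n M d} (hp : p ∈ sheet e j)
    (k : Fin n) : (e p.pt).1 k = 0 ↔ k ∈ range j := by
  have h1 : range j ⊆ {k | (e p.pt).1 k = 0} := by
    rintro _ ⟨i, rfl⟩
    exact sheet_zero hp i
  have h2 : {k | (e p.pt).1 k = 0}.ncard = d := (depth_eq he hp.1).symm.trans p.pt_mem_stratum
  have h3 : (range j).ncard = d := by
    rw [← image_univ, ncard_image_of_injective _ j.injective, ncard_univ]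
    simp
  have h4 := eq_of_subset_of_ncard_le h1 (by rw [h2, h3])
  rw [h4]
  rfl

/-- Each wall of the frame is a wall of `e`, and the resulting indices are distinct because the
germs are. -/
theorem exists_mem_sheet {e : OpenPartialHomeomorph M (EuclideanQuadrant n)}
    (he : e ∈ smoothCharts n M) {p : Frame n M d} (hp : p.pt ∈ e.source) :
    ∃ j : Fin d ↪ Fin n, p ∈ sheet e j := by
  choose j hj0 hj using fun i => exists_wallGerm_eq (IsManifold.chart_mem_maximalAtlas p.pt) he
    (mem_chart_source _ _) hp (p.chart_zero i)
  refine ⟨⟨j, fun i i' h => ?_⟩, hp, hj⟩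
  refine p.idx.injective (wallGerm_injective (mem_chart_source _ _) (p.chart_zero i) ?_)
  rw [hj i, h, hj i']

theorem exists_frame {e : OpenPartialHomeomorph M (EuclideanQuadrant n)}
    (he : e ∈ smoothCharts n M) {x : M} (hx : x ∈ e.source) {j : Fin d ↪ Fin n}
    (hj : ∀ k, (e x).1 k = 0 ↔ k ∈ range j) : ∃ p : Frame n M d, p.pt = x ∧ p ∈ sheet e j := by
  have hc : chartAt (EuclideanQuadrant n) x ∈ smoothCharts n M :=
    IsManifold.chart_mem_maximalAtlas x
  choose c hc0 hcw using fun i => exists_wallGerm_eq he hc hx (mem_chart_source _ x)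
    ((hj (j i)).2 ⟨i, rfl⟩)
  have hinj : Function.Injective c := fun i i' h => by
    refine j.injective (wallGerm_injective hx ((hj (j i)).2 ⟨i, rfl⟩) ?_)
    rw [hcw i, h, hcw i']
  refine ⟨⟨x, ⟨c, hinj⟩, fun k => ⟨fun hk => ?_, ?_⟩⟩, rfl, hx, fun i => (hcw i).symm⟩
  · obtain ⟨k', hk', hw⟩ := exists_wallGerm_eq hc he (mem_chart_source _ x) hx hk
    obtain ⟨i, rfl⟩ := (hj k').1 hk'
    refine ⟨i, ?_⟩
    rw [hcw i] at hw
    exact (wallGerm_injective (mem_chart_source _ x) hk hw).symm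
  · rintro ⟨i, rfl⟩
    exact hc0 i

instance : SecondCountableTopology (EuclideanQuadrant n) :=
  inferInstanceAs (SecondCountableTopology {x : E n // ∀ i, 0 ≤ x i})

/-- The projection of a sheet to M has a continuous inverse on its image, namely the section given
by the numbering of the coordinates. -/
theorem isInducing_pt_sheet (e : OpenPartialHomeomorph M (EuclideanQuadrant n))
    (j : Fin d ↪ Fin n) : IsInducing (fun p : sheet (d := d) e j => p.1.pt) := by
  rw [isInducing_iff_nhds]
  intro p
  refine le_antisymm (((Frame.continuous_pt.comp continuous_subtype_val).tendsto p).le_comap) ?_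
  have : Nonempty (Frame n M d) := ⟨p⟩
  let A : Set M := Frame.pt '' sheet (d := d) e j
  have hA : ∀ x ∈ A, ∃ q : Frame n M d, q ∈ sheet e j ∧ q.pt = x := fun x hx => hx
  choose! s hs using hA
  have hsp : ∀ q ∈ sheet e j, s q.pt = q := fun q hq =>
    sheet_inj (hs _ ⟨q, hq, rfl⟩).1 hq (hs _ ⟨q, hq, rfl⟩).2
  have hc := continuousOn_of_mem_sheet hs p.1.pt ⟨p.1, p.2, rfl⟩
  rw [ContinuousWithinAt, hsp _ p.2] at hc
  rw [nhds_subtype_eq_comap, ← tendsto_iff_comap]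
  have h1 : Tendsto (fun q : sheet (d := d) e j => q.1.pt)
      (comap (fun q : sheet (d := d) e j => q.1.pt) (𝓝 p.1.pt)) (𝓝[A] p.1.pt) :=
    tendsto_nhdsWithin_iff.2 ⟨tendsto_comap, Eventually.of_forall fun q => ⟨q.1, q.2, rfl⟩⟩
  exact (hc.comp h1).congr fun q => hsp _ q.2

/-- By compactness finitely many charts suffice, each with finitely many numberings, and every sheet
inherits a countable base from M. -/
theorem secondCountable_frame [CompactSpace M] : SecondCountableTopology (Frame n M d) := by
  have : SecondCountableTopology M :=
    ChartedSpace.secondCountable_of_sigmaCompact (EuclideanQuadrant n) M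
  obtain ⟨t, ht⟩ := isCompact_univ.elim_finite_subcover
    (fun x : M => (chartAt (EuclideanQuadrant n) x).source)
    (fun x => (chartAt _ x).open_source) (fun x _ => mem_iUnion.2 ⟨x, mem_chart_source _ x⟩)
  have : ∀ a : t × (Fin d ↪ Fin n), SecondCountableTopology
      (sheet (d := d) (chartAt (EuclideanQuadrant n) a.1.1) a.2) := fun a =>
    (isInducing_pt_sheet _ _).secondCountableTopology
  refine TopologicalSpace.secondCountableTopology_of_countable_cover
    (U := fun a : t × (Fin d ↪ Fin n) => sheet (d := d) (chartAt (EuclideanQuadrant n) a.1.1) a.2)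
    (fun a => isOpen_sheet (IsManifold.chart_mem_maximalAtlas a.1.1) a.2) ?_
  refine eq_univ_of_forall fun p => ?_
  obtain ⟨x, hx, hxp⟩ := mem_iUnion₂.1 (ht (mem_univ p.pt))
  obtain ⟨j, hj⟩ := exists_mem_sheet (IsManifold.chart_mem_maximalAtlas x) hxp
  exact mem_iUnion.2 ⟨(⟨x, hx⟩, j), hj⟩

end Frames

end Corners

namespace Corners

/-! ### The exponential map in logarithmic coordinates and the approach to z. -/

section Exponential

variable {n d : ℕ} {M : Type*} [TopologicalSpace M] [ChartedSpace (EuclideanQuadrant n) M]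
  {p₀ : Frame n M d}

theorem expNeg_apply (t : E d) (i : Fin d) : ((expNeg t i : ℝ≥0) : ℝ) = Real.exp (-t i) :=
  Real.coe_toNNReal _ (Real.exp_pos _).le

theorem continuous_expNeg : Continuous (expNeg (d := d)) := by
  unfold expNeg
  fun_prop

theorem continuous_place (j : Fin d ↪ Fin n) :
    Continuous fun a : EuclideanQuadrant n × (Fin d → ℝ≥0) => place j a.1 a.2 := by
  refine Continuous.subtype_mk ?_ _
  refine (PiLp.continuous_toLp 2 _).comp (continuous_pi fun k => ?_)
  refine Continuous.add ?_ (continuous_finsetSum _ fun i _ => ?_)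
  · exact (EuclideanSpace.proj k : E n →L[ℝ] ℝ).continuous.comp
      (continuous_val.comp continuous_fst)
  · split_ifs
    · fun_prop
    · fun_prop

theorem place_apply_mem (j : Fin d ↪ Fin n) (q : EuclideanQuadrant n) (ρ : Fin d → ℝ≥0)
    (i : Fin d) : (place j q ρ).1 (j i) = q.1 (j i) + ρ i := by
  change q.1 (j i) + _ = _
  simp

theorem place_apply_not_mem (j : Fin d ↪ Fin n) (q : EuclideanQuadrant n) (ρ : Fin d → ℝ≥0)
    {k : Fin n} (hk : k ∉ range j) : (place j q ρ).1 k = q.1 k := by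
  change q.1 k + _ = _
  rw [Finset.sum_eq_zero, add_zero]
  intro i _
  rw [if_neg]
  rintro rfl
  exact hk ⟨i, rfl⟩

theorem place_zero (j : Fin d ↪ Fin n) (q : EuclideanQuadrant n) : place j q 0 = q := by
  refine EuclideanQuadrant.ext _ _ ?_
  ext k
  by_cases hk : k ∈ range j
  · obtain ⟨i, rfl⟩ := hk
    rw [place_apply_mem]
    simp
  · rw [place_apply_not_mem _ _ _ hk]

/-- The map `(x, t) ↦ f(x, exp(-t))`. -/
def expPoint (f : ExpMap p₀) (y : Cover p₀ × E d) : M := f.toFun y.1 (expNeg y.2)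

/-- The part of `F̃ × ℝᵈ` on which `expPoint` is given by the numbering `j` of the coordinates of
`e` and by the chart `Φ` of `M`. -/
def expPatch (p₀ : Frame n M d) (e : OpenPartialHomeomorph M (EuclideanQuadrant n))
    (j : Fin d ↪ Fin n) (Φ : OpenPartialHomeomorph M (EuclideanQuadrant n)) :
    Set (Cover p₀ × E d) :=
  {y | y.1.1 ∈ sheet e j ∧ place j (e y.1.1.pt) (expNeg y.2) ∈ Φ.target}

variable [IsManifold (modelWithCornersEuclideanQuadrant n) ∞ M]

/-- The coordinates in the image of `j` receive a positive ρ; the others are already positive on the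
open face. -/
theorem place_pos {e : OpenPartialHomeomorph M (EuclideanQuadrant n)}
    (he : e ∈ smoothCharts n M) {j : Fin d ↪ Fin n} {p : Frame n M d} (hp : p ∈ sheet e j)
    {ρ : Fin d → ℝ≥0} (hρ : ∀ i, 0 < ρ i) (k : Fin n) : 0 < (place j (e p.pt) ρ).1 k := by
  by_cases hk : k ∈ range j
  · obtain ⟨i, rfl⟩ := hk
    rw [place_apply_mem]
    exact add_pos_of_nonneg_of_pos ((e p.pt).2 _) (hρ i)
  · rw [place_apply_not_mem _ _ _ hk]
    exact lt_of_le_of_ne ((e p.pt).2 k) fun h => hk ((sheet_zero_iff he hp k).1 h.symm)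

/-- The coordinates in which the exponential map is the identity. -/
theorem ExpMap.exists_chart (f : ExpMap p₀) {e : OpenPartialHomeomorph M (EuclideanQuadrant n)}
    (he : e ∈ smoothCharts n M) {j : Fin d ↪ Fin n} {p : Cover p₀} (hp : p.1 ∈ sheet e j)
    {ρ : Fin d → ℝ≥0} (hρ : ∀ i, ρ i ≤ f.ε) :
    ∃ Φ ∈ smoothCharts n M, place j (e p.1.pt) ρ ∈ Φ.target ∧
      ∀ p : Cover p₀, p.1 ∈ sheet e j → ∀ ρ : Fin d → ℝ≥0, place j (e p.1.pt) ρ ∈ Φ.target →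
        f.toFun p ρ = Φ.symm (place j (e p.1.pt) ρ) :=
  f.local_diffeo e he j p.1.pt hp.1 (subset_closure ⟨p, hp, rfl⟩) ρ hρ

theorem continuousOn_coord_pt (e : OpenPartialHomeomorph M (EuclideanQuadrant n))
    (j : Fin d ↪ Fin n) :
    ContinuousOn (fun p : Cover p₀ => e p.1.pt) {p | p.1 ∈ sheet e j} :=
  e.continuousOn.comp (Frame.continuous_pt.comp continuous_subtype_val).continuousOn
    fun _ hp => hp.1

theorem isOpen_coverSheet {e : OpenPartialHomeomorph M (EuclideanQuadrant n)}
    (he : e ∈ smoothCharts n M) (j : Fin d ↪ Fin n) :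
    IsOpen {p : Cover p₀ | p.1 ∈ sheet e j} :=
  (isOpen_sheet he j).preimage continuous_subtype_val

theorem continuousOn_place_pt (e : OpenPartialHomeomorph M (EuclideanQuadrant n))
    (j : Fin d ↪ Fin n) :
    ContinuousOn (fun a : Cover p₀ × (Fin d → ℝ≥0) => place j (e a.1.1.pt) a.2)
      {a | a.1.1 ∈ sheet e j} :=
  (continuous_place j).comp_continuousOn
    (((continuousOn_coord_pt e j).comp continuousOn_fst fun _ h => h).prodMk continuousOn_snd)

theorem isOpen_expPatch {e : OpenPartialHomeomorph M (EuclideanQuadrant n)}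
    (he : e ∈ smoothCharts n M) (j : Fin d ↪ Fin n)
    (Φ : OpenPartialHomeomorph M (EuclideanQuadrant n)) : IsOpen (expPatch p₀ e j Φ) := by
  have h1 : ContinuousOn (fun y : Cover p₀ × E d => place j (e y.1.1.pt) (expNeg y.2))
      {y | y.1.1 ∈ sheet e j} :=
    (continuousOn_place_pt e j).comp
      (continuous_fst.prodMk (continuous_expNeg.comp continuous_snd)).continuousOn fun _ h => h
  exact h1.isOpen_inter_preimage ((isOpen_coverSheet he j).preimage continuous_fst) Φ.open_target

/-- Near a point of the zero section the exponential map is continuous. -/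
theorem ExpMap.continuousAt (f : ExpMap p₀) {a : Cover p₀ × (Fin d → ℝ≥0)}
    (ha : ∀ i, a.2 i ≤ f.ε) :
    ContinuousAt (fun a : Cover p₀ × (Fin d → ℝ≥0) => f.toFun a.1 a.2) a := by
  have he : chartAt (EuclideanQuadrant n) a.1.1.pt ∈ smoothCharts n M :=
    IsManifold.chart_mem_maximalAtlas _
  have hp := mem_sheet_chartAt a.1.1
  obtain ⟨Φ, hΦ, hmem, hf⟩ := f.exists_chart he hp ha
  set e := chartAt (EuclideanQuadrant n) a.1.1.pt
  have hopen : {a : Cover p₀ × (Fin d → ℝ≥0) | a.1.1 ∈ sheet e _} ∈ 𝓝 a :=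
    ((isOpen_coverSheet he _).preimage continuous_fst).mem_nhds hp
  have h1 := (continuousOn_place_pt (p₀ := p₀) e a.1.1.idx).continuousAt hopen
  have h2 : ContinuousAt (fun a' : Cover p₀ × (Fin d → ℝ≥0) =>
      Φ.symm (place a.1.1.idx (e a'.1.1.pt) a'.2)) a :=
    ContinuousAt.comp (f := fun a' : Cover p₀ × (Fin d → ℝ≥0) =>
      place a.1.1.idx (e a'.1.1.pt) a'.2) (Φ.continuousAt_symm hmem) h1
  refine h2.congr ?_
  filter_upwards [hopen, h1 (Φ.open_target.mem_nhds hmem)] with a' h3 h4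
  exact (hf a'.1 h3 a'.2 h4).symm

theorem expPoint_mem_stratum (f : ExpMap p₀) {y : Cover p₀ × E d}
    (hy : ∀ i, expNeg y.2 i ≤ f.ε) : expPoint f y ∈ stratum n M 0 := by
  have he : chartAt (EuclideanQuadrant n) y.1.1.pt ∈ smoothCharts n M :=
    IsManifold.chart_mem_maximalAtlas _
  have hp := mem_sheet_chartAt y.1.1
  obtain ⟨Φ, hΦ, hmem, hf⟩ := f.exists_chart he hp hy
  change depth (n := n) (f.toFun y.1 (expNeg y.2)) = 0
  rw [hf _ hp _ hmem, depth_eq hΦ (Φ.map_target hmem), Φ.right_inv hmem, ncard_eq_zero]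
  refine eq_empty_of_forall_notMem fun k hk => ?_
  have := place_pos he hp (ρ := expNeg y.2) (fun i => by
    rw [← NNReal.coe_pos, expNeg_apply]; exact Real.exp_pos _) k
  exact this.ne' hk

/-- The points of the interior in the image of the exponential map. -/
theorem exists_expNeg_eq (f : ExpMap p₀) {p : Cover p₀} {ρ : Fin d → ℝ≥0}
    (hρ : ∀ i, ρ i ≤ f.ε) (h : f.toFun p ρ ∈ stratum n M 0) : ∃ t : E d, expNeg t = ρ := by
  have he : chartAt (EuclideanQuadrant n) p.1.pt ∈ smoothCharts n M :=
    IsManifold.chart_mem_maximalAtlas _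
  have hp := mem_sheet_chartAt p.1
  obtain ⟨Φ, hΦ, hmem, hf⟩ := f.exists_chart he hp hρ
  -- If some ρ i were zero, a coordinate of the image point in the chart Φ would vanish and the
  -- point would not be interior.
  have hpos : ∀ i, 0 < ρ i := by
    intro i
    rw [pos_iff_ne_zero]
    intro h0
    have h1 : depth (n := n) (f.toFun p ρ) = 0 := h
    rw [hf _ hp _ hmem, depth_eq hΦ (Φ.map_target hmem), Φ.right_inv hmem, ncard_eq_zero] at h1
    have h2 : p.1.idx i ∈ {k | (place p.1.idx
        ((chartAt (EuclideanQuadrant n) p.1.pt) p.1.pt) ρ).1 k = 0} := by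
      rw [mem_ofPred_eq, place_apply_mem, h0, sheet_zero hp i]
      simp
    rw [h1] at h2
    exact h2
  refine ⟨WithLp.toLp 2 fun i => -Real.log (ρ i), funext fun i => NNReal.coe_injective ?_⟩
  rw [expNeg_apply]
  simp [Real.exp_log (NNReal.coe_pos.2 (hpos i))]

/-- The exponential chart at a point of the face has the same walls as the chart used to define
it. -/
theorem wallGerm_expChart (f : ExpMap p₀) {e Φ : OpenPartialHomeomorph M (EuclideanQuadrant n)}
    (he : e ∈ smoothCharts n M) (hΦ : Φ ∈ smoothCharts n M) {j : Fin d ↪ Fin n} {p : Cover p₀}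
    (hp : p.1 ∈ sheet e j) (hmem : e p.1.pt ∈ Φ.target)
    (hf : ∀ ρ : Fin d → ℝ≥0, place j (e p.1.pt) ρ ∈ Φ.target →
        f.toFun p ρ = Φ.symm (place j (e p.1.pt) ρ)) (i : Fin d) :
    p.1.pt ∈ Φ.source ∧ Φ p.1.pt = e p.1.pt ∧
      wallGerm Φ (j i) p.1.pt = wallGerm e (j i) p.1.pt := by
  have h0 : Φ.symm (e p.1.pt) = p.1.pt := by
    have := hf 0 (by rwa [place_zero])
    rw [place_zero, f.zero_section] at this
    exact this.symm
  have hs : p.1.pt ∈ Φ.source := by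
    rw [← h0]; exact Φ.map_target hmem
  have hval : Φ p.1.pt = e p.1.pt := by
    conv_lhs => rw [← h0]
    exact Φ.right_inv hmem
  refine ⟨hs, hval, ?_⟩
  obtain ⟨k', hk', hw⟩ := exists_wallGerm_eq he hΦ hp.1 hs (sheet_zero hp i)
  have hw' := (wallGerm_eq_iff hp.1 hs).1 hw
  suffices h : k' = j i by rw [hw, h]
  have h1 := f.wall p i
  rw [hp.2 i] at h1
  have h2 : ∀ᶠ y in wallGerm e (j i) p.1.pt, (e y).1 (j i) = 0 :=
    mem_of_superset self_mem_nhdsWithin fun y hy => hy.2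
  have h3 : ∀ᶠ y in wallGerm e (j i) p.1.pt,
      ((e y).1 (j i) = 0 ↔ (Φ y).1 k' = 0) := mem_nhdsWithin_of_mem_nhds hw'
  -- Along this curve the exponential map stays in the i-th wall, while in Φ the only vanishing
  -- coordinate is the one with index `j i`. Hence k' can only be `j i`.
  let ρ : ℝ≥0 → Fin d → ℝ≥0 := fun s l => if l = i then 0 else s
  have hρ : Tendsto ρ (𝓝[>] 0) (𝓝[{ρ | ρ i = 0}] 0) := by
    refine tendsto_nhdsWithin_iff.2 ⟨?_, Eventually.of_forall fun s => by simp [ρ]⟩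
    refine Tendsto.mono_left ?_ nhdsWithin_le_nhds
    rw [tendsto_pi_nhds]
    intro l
    by_cases hl : l = i
    · simp [ρ, hl]
    · simp only [ρ, hl, if_false]
      exact tendsto_id
  have h4 : ∀ᶠ ρ in 𝓝 (0 : Fin d → ℝ≥0), place j (e p.1.pt) ρ ∈ Φ.target := by
    have hc : Continuous fun ρ : Fin d → ℝ≥0 => place j (e p.1.pt) ρ :=
      (continuous_place j).comp (continuous_const.prodMk continuous_id)
    refine hc.continuousAt (Φ.open_target.mem_nhds ?_)
    rwa [place_zero]
  have hne : (𝓝[>] (0 : ℝ≥0)).NeBot := inferInstance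
  obtain ⟨s, ⟨h5, h6⟩, h7, hs0⟩ := (((h1.comp hρ).eventually (h2.and h3)).and
    (((hρ.mono_right nhdsWithin_le_nhds).eventually h4).and self_mem_nhdsWithin)).exists
  have h8 := h6.1 h5
  simp only [Function.comp_apply] at h8
  rw [hf _ h7, Φ.right_inv h7] at h8
  by_contra hne'
  by_cases hk : k' ∈ range j
  · obtain ⟨l, rfl⟩ := hk
    have hl : l ≠ i := fun h => hne' (by rw [h])
    rw [place_apply_mem, sheet_zero hp l, zero_add] at h8
    have : ρ s l = s := by simp [ρ, hl]
    rw [this] at h8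
    exact (NNReal.coe_pos.2 hs0).ne' h8
  · rw [place_apply_not_mem _ _ _ hk] at h8
    exact hk ((sheet_zero_iff he hp k').1 h8)

theorem tendsto_expNeg_add_smul (t θ : E d) (hθ : ∀ i, 0 < θ i) :
    Tendsto (fun R : ℝ => expNeg (t + R • θ)) atTop (𝓝 0) := by
  rw [tendsto_pi_nhds]
  intro i
  rw [← NNReal.tendsto_coe]
  simp only [expNeg_apply, Pi.zero_apply, NNReal.coe_zero]
  refine Real.tendsto_exp_atBot.comp (tendsto_neg_atTop_atBot.comp ?_)
  simp only [PiLp.add_apply, PiLp.smul_apply, smul_eq_mul]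
  exact tendsto_atTop_add_const_left _ _ (tendsto_id.atTop_mul_const (hθ i))

theorem eventually_expNeg_le (f : ExpMap p₀) (t θ : E d) (hθ : ∀ i, 0 < θ i) :
    ∀ᶠ R : ℝ in atTop, ∀ i, expNeg (t + R • θ) i ≤ f.ε := by
  have h := tendsto_expNeg_add_smul t θ hθ
  rw [tendsto_pi_nhds] at h
  rw [eventually_all]
  intro i
  exact (h i).eventually (eventually_le_nhds f.ε_pos)

/-- Translations along `θ` approach the point of `F^#` given by `θ`. -/
theorem tendsto_expPoint_approach (f : ExpMap p₀) (p : Cover p₀) (t θ : E d)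
    (hθ : ∀ i, 0 < θ i) (hsum : ∑ i, θ i = 1) :
    Tendsto (fun R : ℝ => expPoint f (p, t + R • θ)) atTop
      (approach (chartAt (EuclideanQuadrant n) p.1.pt) p.1.idx p.1.pt (fun i => θ i)) := by
  have he : chartAt (EuclideanQuadrant n) p.1.pt ∈ smoothCharts n M :=
    IsManifold.chart_mem_maximalAtlas _
  have hp := mem_sheet_chartAt p.1
  obtain ⟨Φ, hΦ, hmem, hf⟩ := f.exists_chart he hp (ρ := 0) (fun i => by simp)
  set e := chartAt (EuclideanQuadrant n) p.1.pt with he_def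
  set j := p.1.idx with hj_def
  rw [place_zero] at hmem
  have hwalls := wallGerm_expChart f he hΦ hp hmem (hf p hp)
  have hρ := tendsto_expNeg_add_smul t θ hθ
  have hlim : Tendsto (fun R : ℝ => expPoint f (p, t + R • θ)) atTop (𝓝 p.1.pt) := by
    have h1 := (f.continuousAt (a := (p, 0)) (fun i => by simp)).tendsto
    rw [f.zero_section] at h1
    exact h1.comp (tendsto_const_nhds.prodMk_nhds hρ)
  -- In the chart Φ adapted to the exponential map the relevant coordinates are exactly exp(−(t +
  -- Rθ)).
  have hΦval : ∀ᶠ R : ℝ in atTop, ∀ i,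
      (Φ (expPoint f (p, t + R • θ))).1 (j i) = Real.exp (-(t i + R * θ i)) := by
    have hc : Continuous fun ρ : Fin d → ℝ≥0 => place j (e p.1.pt) ρ :=
      (continuous_place j).comp (continuous_const.prodMk continuous_id)
    have h2 : ∀ᶠ ρ in 𝓝 (0 : Fin d → ℝ≥0), place j (e p.1.pt) ρ ∈ Φ.target := by
      refine hc.continuousAt (Φ.open_target.mem_nhds ?_)
      rwa [place_zero]
    filter_upwards [hρ.eventually h2] with R hR i
    rw [expPoint, hf p hp _ hR, Φ.right_inv hR, place_apply_mem, sheet_zero hp i, zero_add,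
      expNeg_apply]
    simp
  -- Φ and `e` have the same walls, so their coordinates are comparable in both directions and the
  -- logarithms differ by a bounded amount. This disappears after division by R.
  have hlog : ∀ i, ∃ B : ℝ, ∀ᶠ R : ℝ in atTop,
      |Real.log ((e (expPoint f (p, t + R • θ))).1 (j i)) + R * θ i| ≤ B := by
    intro i
    obtain ⟨hs, hval, hw⟩ := hwalls i
    have hz : (e p.1.pt).1 (j i) = 0 := sheet_zero hp i
    obtain ⟨C, hC0, hC⟩ := exists_coord_le_mul hΦ he hs hp.1 (by rw [hval]; exact hz) hw
    obtain ⟨C', hC0', hC'⟩ := exists_coord_le_mul he hΦ hp.1 hs hz hw.symm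
    refine ⟨|Real.log C| + |Real.log C'| + |t i|, ?_⟩
    filter_upwards [hΦval, hlim.eventually hC, hlim.eventually hC'] with R h1 h2 h3
    rw [h1 i] at h2 h3
    set a := (e (expPoint f (p, t + R • θ))).1 (j i)
    have hexp := Real.exp_pos (-(t i + R * θ i))
    have ha : 0 < a := by
      by_contra hneg
      have : C' * a ≤ 0 := mul_nonpos_of_nonneg_of_nonpos hC0'.le (not_lt.1 hneg)
      linarith
    have h4 := Real.log_le_log ha h2
    have h5 := Real.log_le_log hexp h3
    rw [Real.log_mul hC0.ne' hexp.ne', Real.log_exp] at h4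
    rw [Real.log_mul hC0'.ne' ha.ne', Real.log_exp] at h5
    rw [abs_le]
    have b1 := le_abs_self (Real.log C)
    have b2 := le_abs_self (Real.log C')
    have b3 := le_abs_self (t i)
    have b4 := neg_abs_le (t i)
    have b5 := abs_nonneg (Real.log C)
    have b6 := abs_nonneg (Real.log C')
    constructor <;> linarith
  have hdiv : ∀ i, Tendsto (fun R : ℝ =>
      Real.log ((e (expPoint f (p, t + R • θ))).1 (j i)) / R) atTop (𝓝 (-θ i)) := by
    intro i
    obtain ⟨B, hB⟩ := hlog i
    have h0 : Tendsto (fun R : ℝ => (Real.log ((e (expPoint f (p, t + R • θ))).1 (j i)) +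
        R * θ i) / R) atTop (𝓝 0) := by
      rw [tendsto_zero_iff_norm_tendsto_zero]
      refine squeeze_zero' (Eventually.of_forall fun _ => norm_nonneg _) ?_
        (tendsto_const_nhds.div_atTop tendsto_id : Tendsto (fun R : ℝ => B / R) atTop (𝓝 0))
      filter_upwards [hB, eventually_gt_atTop 0] with R h1 h2
      rw [norm_div, Real.norm_eq_abs, Real.norm_of_nonneg h2.le]
      gcongr
    have h1 := h0.sub_const (θ i)
    rw [zero_sub] at h1
    refine h1.congr' ?_
    filter_upwards [eventually_gt_atTop 0] with R h2
    field_simp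
    ring
  have hratio : Tendsto (fun R : ℝ => fun i =>
      Real.log ((e (expPoint f (p, t + R • θ))).1 (j i)) /
        ∑ k, Real.log ((e (expPoint f (p, t + R • θ))).1 (j k))) atTop (𝓝 (fun i => θ i)) := by
    rw [tendsto_pi_nhds]
    intro i
    have h1 := tendsto_finsetSum Finset.univ fun k _ => hdiv k
    have h2 : ∑ k, -θ k = -1 := by rw [Finset.sum_neg_distrib, hsum]
    rw [h2] at h1
    have h3 := (hdiv i).div h1 (by norm_num)
    rw [neg_div_neg_eq, div_one] at h3
    refine h3.congr' ?_
    filter_upwards [eventually_gt_atTop 0] with R hR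
    rw [Pi.div_apply, ← Finset.sum_div, div_div_div_cancel_right₀ hR.ne']
  refine tendsto_inf.2 ⟨tendsto_nhdsWithin_iff.2 ⟨hlim, ?_⟩, tendsto_comap_iff.2 hratio⟩
  filter_upwards [eventually_expNeg_le f t θ hθ] with R hR
  exact expPoint_mem_stratum f hR

end Exponential

end Corners

namespace Corners

/-! ### Maps that pull null sets back to null sets. -/

section NullMaps

variable {α α' β β' γ : Type*} [MeasurableSpace α] [MeasurableSpace α'] [MeasurableSpace β]
  [MeasurableSpace β'] [MeasurableSpace γ]

/-- The preimages of null sets under the restriction of `c` to `A` are null sets. -/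
def NullMap (μ : Measure α) (A : Set α) (ν : Measure β) (c : α → β) : Prop :=
  ∀ N, ν N = 0 → μ (A ∩ c ⁻¹' N) = 0

theorem NullMap.mono {μ : Measure α} {A A' : Set α} {ν : Measure β} {c : α → β}
    (h : NullMap μ A ν c) (hA : A' ⊆ A) : NullMap μ A' ν c := fun N hN =>
  measure_mono_null (inter_subset_inter_left _ hA) (h N hN)

theorem NullMap.congr {μ : Measure α} {A : Set α} {ν : Measure β} {c c' : α → β}
    (h : NullMap μ A ν c) (hc : ∀ x ∈ A, c' x = c x) : NullMap μ A ν c' := by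
  intro N hN
  refine measure_mono_null ?_ (h N hN)
  rintro x ⟨hxA, hx⟩
  refine ⟨hxA, ?_⟩
  rwa [mem_preimage, hc x hxA] at hx

theorem NullMap.comp {μ : Measure α} {A : Set α} {ν : Measure β} {B : Set β} {κ : Measure γ}
    {c : α → β} {c' : β → γ} (h' : NullMap ν B κ c') (h : NullMap μ A ν c) (hm : MapsTo c A B) :
    NullMap μ A κ (c' ∘ c) := by
  intro N hN
  refine measure_mono_null ?_ (h _ (h' N hN))
  exact fun _ hx => ⟨hx.1, hm hx.1, hx.2⟩

/-- Every null set lies in a measurable null set. -/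
theorem NullMap.of_measurable {μ : Measure α} {A : Set α} {ν : Measure β} {c : α → β}
    (h : ∀ N, MeasurableSet N → ν N = 0 → μ (A ∩ c ⁻¹' N) = 0) : NullMap μ A ν c := fun N hN =>
  measure_mono_null (inter_subset_inter_right _ (preimage_mono (subset_toMeasurable ν N)))
    (h _ (measurableSet_toMeasurable ν N) ((measure_toMeasurable N).trans hN))

theorem NullMap.of_quasiMeasurePreserving {μ : Measure α} {ν : Measure β} {c : α → β}
    (h : Measure.QuasiMeasurePreserving c μ ν) (A : Set α) : NullMap μ A ν c := fun _ hN =>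
  measure_mono_null inter_subset_right (h.preimage_null hN)

theorem measurableSet_inter_preimage [TopologicalSpace α] [OpensMeasurableSpace α]
    [TopologicalSpace β] [BorelSpace β] {A : Set α} {c : α → β} (hc : ContinuousOn c A)
    (hA : MeasurableSet A) {N : Set β} (hN : MeasurableSet N) : MeasurableSet (A ∩ c ⁻¹' N) := by
  have h := (continuousOn_iff_continuous_domRestrict.1 hc).measurable hN
  have h' := hA.subtype_image h
  convert h' using 1
  ext x
  simp [and_comm]

/-- Fubini for null sets: almost all slices of N are null, and this is pulled back first in the
slices and then in the base. The measurability assumption is what the slice criterion requires. -/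
theorem NullMap.prod {μ : Measure α} {A : Set α} {ν : Measure β} {c : α → β}
    {μ' : Measure α'} {A' : Set α'} {ν' : Measure β'} {c' : α' → β'} [SFinite μ'] [SFinite ν']
    (h : NullMap μ A ν c) (h' : NullMap μ' A' ν' c')
    (hm : ∀ N, MeasurableSet N → MeasurableSet ((A ×ˢ A') ∩ Prod.map c c' ⁻¹' N)) :
    NullMap (μ.prod μ') (A ×ˢ A') (ν.prod ν') (Prod.map c c') := by
  refine NullMap.of_measurable fun N hN h0 => ?_
  rw [Measure.measure_prod_null (hm N hN)]
  rw [Measure.measure_prod_null hN, EventuallyEq, ae_iff] at h0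
  rw [EventuallyEq, ae_iff]
  refine measure_mono_null ?_ (h _ h0)
  intro x hx
  by_cases hxA : x ∈ A
  · refine ⟨hxA, fun h1 => hx ?_⟩
    simp only [Pi.zero_apply] at h1 ⊢
    refine measure_mono_null ?_ (h' _ h1)
    exact fun y hy => ⟨hy.1.2, hy.2⟩
  · refine absurd ?_ hx
    have : Prod.mk x ⁻¹' ((A ×ˢ A') ∩ Prod.map c c' ⁻¹' N) = ∅ :=
      eq_empty_of_forall_notMem fun y hy => hxA hy.1.1
    rw [this, measure_empty, Pi.zero_apply]

end NullMaps

/-! ### Null sets under the exponential and logarithm in the fibres. -/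

section Orthant

variable {d : ℕ}

/-- The map `t ↦ exp(-t)` in each coordinate. -/
def expCoord (t : E d) : Fin d → ℝ := fun i => Real.exp (-t i)

/-- The map `ρ ↦ - log ρ` in each coordinate. -/
def logCoord (v : Fin d → ℝ) : E d := WithLp.toLp 2 fun i => -Real.log (v i)

theorem expCoord_pos (t : E d) (i : Fin d) : 0 < expCoord t i := Real.exp_pos _

theorem logCoord_expCoord (t : E d) : logCoord (expCoord t) = t := by
  ext i
  simp [logCoord, expCoord]

theorem continuous_expCoord : Continuous (expCoord (d := d)) := by
  unfold expCoord
  fun_prop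

/-- The preimage of N is the image of its positive part under the coordinatewise −log, and
differentiable maps between spaces of equal dimension send Lebesgue null sets to null sets. -/
theorem nullMap_expCoord :
    NullMap (volume : Measure (E d)) univ (volume : Measure (Fin d → ℝ)) expCoord := by
  intro N hN
  have h1 : DifferentiableOn ℝ (fun v : Fin d → ℝ => fun i => -Real.log (v i))
      (N ∩ {v | ∀ i, 0 < v i}) := by
    refine differentiableOn_pi.2 fun i => ?_
    refine DifferentiableOn.neg (DifferentiableOn.log ?_ fun v hv => (hv.2 i).ne')
    fun_prop
  have h2 := addHaar_image_eq_zero_of_differentiableOn_of_addHaar_eq_zero volume h1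
    (measure_mono_null inter_subset_left hN)
  have h3 := (PiLp.volume_preserving_ofLp (Fin d)).quasiMeasurePreserving.preimage_null h2
  refine measure_mono_null ?_ h3
  rintro t ⟨-, ht⟩
  refine ⟨expCoord t, ⟨ht, expCoord_pos t⟩, ?_⟩
  ext i
  simp [expCoord]

theorem nullMap_logCoord :
    NullMap (volume : Measure (Fin d → ℝ)) {v | ∀ i, 0 < v i} (volume : Measure (E d))
      logCoord := by
  intro N hN
  have h0 := (PiLp.volume_preserving_toLp (Fin d)).quasiMeasurePreserving.preimage_null hN
  have h1 : DifferentiableOn ℝ (fun v : Fin d → ℝ => fun i => Real.exp (-v i))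
      (WithLp.toLp 2 ⁻¹' N) := by
    fun_prop
  have h2 := addHaar_image_eq_zero_of_differentiableOn_of_addHaar_eq_zero volume h1 h0
  refine measure_mono_null ?_ h2
  rintro v ⟨hv, hvN⟩
  refine ⟨fun i => -Real.log (v i), hvN, ?_⟩
  ext i
  simp [Real.exp_log (hv i)]

theorem continuousOn_logCoord : ContinuousOn (logCoord (d := d)) {v | ∀ i, 0 < v i} := by
  refine (PiLp.continuous_toLp 2 _).comp_continuousOn (continuousOn_pi.2 fun i => ?_)
  exact (ContinuousOn.log (by fun_prop) fun v hv => (hv i).ne').neg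

theorem measurableSet_orthant : MeasurableSet {v : Fin d → ℝ | ∀ i, 0 < v i} := by
  simp only [ofPred_forall]
  exact MeasurableSet.iInter fun i => measurableSet_lt measurable_const (measurable_pi_apply i)

end Orthant

/-! ### Splitting the coordinates into those along the face and those in the fibre. -/

section Combine

variable {n d : ℕ}

/-- The coordinates which are not in the image of `j`, and those in the image. -/
def splitEquiv (j : Fin d ↪ Fin n) :
    {k // k ∉ Finset.univ.map j} ⊕ Fin d ≃ {k : Fin n // k ∉ (∅ : Finset (Fin n))} :=
  Equiv.ofBijective
    (Sum.elim (fun k => ⟨k.1, Finset.notMem_empty _⟩) fun i => ⟨j i, Finset.notMem_empty _⟩) <| by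
  have hj : ∀ i, j i ∈ Finset.univ.map j := fun i => Finset.mem_map_of_mem j (Finset.mem_univ i)
  constructor
  · rintro (k | i) (k' | i') h
    · have h' : k.1 = k'.1 := Subtype.mk.inj h
      exact congrArg _ (Subtype.ext h')
    · have h' : k.1 = j i' := congrArg Subtype.val h
      exact absurd (hj i') (h' ▸ k.2)
    · have h' : j i = k'.1 := congrArg Subtype.val h
      exact absurd (hj i) (h' ▸ k'.2)
    · exact congrArg _ (j.injective (congrArg Subtype.val h))
  · rintro ⟨k, hk⟩
    by_cases h : k ∈ Finset.univ.map j
    · obtain ⟨i, -, rfl⟩ := Finset.mem_map.1 h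
      exact ⟨.inr i, rfl⟩
    · exact ⟨.inl ⟨k, h⟩, rfl⟩

/-- Assemble the coordinates on the face and the fibre coordinates. -/
def combine (j : Fin d ↪ Fin n) :
    (({k // k ∉ Finset.univ.map j} → ℝ) × (Fin d → ℝ)) ≃ᵐ
      ({k : Fin n // k ∉ (∅ : Finset (Fin n))} → ℝ) :=
  (MeasurableEquiv.sumPiEquivProdPi fun _ => ℝ).symm.trans
    (MeasurableEquiv.piCongrLeft (fun _ => ℝ) (splitEquiv j))

theorem measurePreserving_combine (j : Fin d ↪ Fin n) : MeasurePreserving (combine j) :=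
  (volume_measurePreserving_piCongrLeft (fun _ => ℝ) (splitEquiv j)).comp
    (volume_measurePreserving_sumPiEquivProdPi_symm fun _ => ℝ)

theorem combine_apply_mem (j : Fin d ↪ Fin n)
    (x : ({k // k ∉ Finset.univ.map j} → ℝ) × (Fin d → ℝ)) (i : Fin d) (h) :
    combine j x ⟨j i, h⟩ = x.2 i := by
  have := MeasurableEquiv.piCongrLeft_apply_apply (splitEquiv j) (β := fun _ => ℝ)
    ((MeasurableEquiv.sumPiEquivProdPi fun _ => ℝ).symm x) (.inr i)
  exact this

theorem combine_apply_notMem (j : Fin d ↪ Fin n)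
    (x : ({k // k ∉ Finset.univ.map j} → ℝ) × (Fin d → ℝ)) (k : {k // k ∉ Finset.univ.map j})
    (h) : combine j x ⟨k.1, h⟩ = x.1 k := by
  have := MeasurableEquiv.piCongrLeft_apply_apply (splitEquiv j) (β := fun _ => ℝ)
    ((MeasurableEquiv.sumPiEquivProdPi fun _ => ℝ).symm x) (.inl k)
  exact this

end Combine

end Corners

namespace Corners

/-! ### Corner measures and Lebesgue measure have the same null sets in charts. -/

section ChartMeasure

variable {n d : ℕ} {M : Type*} [TopologicalSpace M] [ChartedSpace (EuclideanQuadrant n) M]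

/-- The point of `ℝⁿ` with the coordinates `v` off `J`, and the coordinates `0` in `J`. -/
def extendZero (J : Finset (Fin n)) (v : {k // k ∉ J} → ℝ) : E n :=
  WithLp.toLp 2 fun k => if h : k ∈ J then 0 else v ⟨k, h⟩

theorem extendZero_mem {J : Finset (Fin n)} (v : {k // k ∉ J} → ℝ) {k : Fin n} (hk : k ∈ J) :
    extendZero J v k = 0 := dif_pos hk

theorem extendZero_notMem {J : Finset (Fin n)} (v : {k // k ∉ J} → ℝ) {k : Fin n} (hk : k ∉ J) :
    extendZero J v k = v ⟨k, hk⟩ := dif_neg hk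

theorem continuous_extendZero (J : Finset (Fin n)) : Continuous (extendZero J) := by
  refine (PiLp.continuous_toLp 2 _).comp (continuous_pi fun k => ?_)
  split_ifs <;> fun_prop

/-- The point of the face `{e_k = 0, k ∈ J}` with given coordinates. -/
def chartPoint (e : OpenPartialHomeomorph M (EuclideanQuadrant n)) (J : Finset (Fin n))
    (v : {k // k ∉ J} → ℝ) : M := e.symm (quad (extendZero J v))

/-- The range of the coordinates on the part of the chart where exactly the coordinates in `J`
vanish. -/
def coordRange (e : OpenPartialHomeomorph M (EuclideanQuadrant n)) (J : Finset (Fin n)) :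
    Set ({k // k ∉ J} → ℝ) :=
  {v | (∀ k, 0 < v k) ∧ quad (extendZero J v) ∈ e.target}

variable (e : OpenPartialHomeomorph M (EuclideanQuadrant n)) (J : Finset (Fin n))

theorem extendZero_coords {x : M} (hx : x ∈ piece e J) :
    extendZero J (coords e J x) = (e x).1 := by
  ext k
  by_cases hk : k ∈ J
  · rw [extendZero_mem _ hk, (hx.2 k).2 hk]
  · rw [extendZero_notMem _ hk, coords]

theorem chartPoint_coords {x : M} (hx : x ∈ piece e J) :
    chartPoint e J (coords e J x) = x := by
  rw [chartPoint, extendZero_coords e J hx, val_quad, e.left_inv hx.1]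

theorem coords_mem {x : M} (hx : x ∈ piece e J) : coords e J x ∈ coordRange e J := by
  refine ⟨fun k => ?_, ?_⟩
  · exact lt_of_le_of_ne ((e x).2 k.1) fun h => k.2 ((hx.2 k.1).1 h.symm)
  · rw [extendZero_coords e J hx, val_quad]
    exact e.map_source hx.1

theorem val_chartPoint {v : {k // k ∉ J} → ℝ} (hv : v ∈ coordRange e J) :
    (e (chartPoint e J v)).1 = extendZero J v := by
  rw [chartPoint, e.right_inv hv.2, quad_val]
  intro k
  by_cases hk : k ∈ J
  · rw [extendZero_mem _ hk]
  · rw [extendZero_notMem _ hk]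
    exact (hv.1 _).le

theorem chartPoint_mem {v : {k // k ∉ J} → ℝ} (hv : v ∈ coordRange e J) :
    chartPoint e J v ∈ piece e J := by
  refine ⟨e.map_target hv.2, fun k => ?_⟩
  rw [val_chartPoint e J hv]
  by_cases hk : k ∈ J
  · simp [extendZero_mem _ hk, hk]
  · simp [extendZero_notMem _ hk, hk, (hv.1 ⟨k, hk⟩).ne']

theorem coords_chartPoint {v : {k // k ∉ J} → ℝ} (hv : v ∈ coordRange e J) :
    coords e J (chartPoint e J v) = v := by
  ext k
  rw [coords, val_chartPoint e J hv, extendZero_notMem _ k.2]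

theorem image_coords_piece : coords e J '' piece e J = coordRange e J :=
  Subset.antisymm (image_subset_iff.2 fun _ hx => coords_mem e J hx) fun _ hv =>
    ⟨_, chartPoint_mem e J hv, coords_chartPoint e J hv⟩

theorem isOpen_coordRange : IsOpen (coordRange e J) := by
  have h : IsOpen {v : {k // k ∉ J} → ℝ | ∀ k, 0 < v k} := by
    simp only [ofPred_forall]
    exact isOpen_iInter_of_finite fun k => isOpen_lt continuous_const (continuous_apply k)
  exact h.inter (e.open_target.preimage (continuous_quad.comp (continuous_extendZero J)))

theorem continuousOn_chartPoint : ContinuousOn (chartPoint e J) (coordRange e J) :=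
  e.continuousOn_symm.comp (continuous_quad.comp (continuous_extendZero J)).continuousOn
    fun _ hv => hv.2

theorem continuousOn_coords : ContinuousOn (coords e J) e.source :=
  continuousOn_pi.2 fun k => fun _ hx => (continuousAt_coord_apply hx k.1).continuousWithinAt

variable [MeasurableSpace M] [BorelSpace M]

theorem measurableSet_piece : MeasurableSet (piece e J) := by
  have hc : ContinuousOn (fun x => (e x).1) e.source := fun x hx =>
    (continuousAt_coord hx).continuousWithinAt
  have hN : MeasurableSet {v : E n | ∀ k, v k = 0 ↔ k ∈ J} := by
    simp only [ofPred_forall]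
    refine MeasurableSet.iInter fun k => ?_
    have h1 : MeasurableSet {v : E n | v k = 0} :=
      (isClosed_eq (EuclideanSpace.proj k : E n →L[ℝ] ℝ).continuous
        continuous_const).measurableSet
    by_cases hk : k ∈ J
    · simpa [hk] using h1
    · convert h1.compl using 1
      ext v
      simp [hk]
  exact measurableSet_inter_preimage hc e.open_source.measurableSet hN

variable {e J} {F : Set M} {μ : Measure M}

theorem aemeasurable_coords (μ : Measure M) (F : Set M) :
    AEMeasurable (coords e J) (μ.restrict (F ∩ piece e J)) :=
  (((continuousOn_coords e J).mono fun _ hx => hx.1).aemeasurable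
    (measurableSet_piece e J)).mono_measure (Measure.restrict_mono inter_subset_right le_rfl)

theorem IsCornerMeasure.nullMeasurableSet (h : IsCornerMeasure n d F μ) :
    NullMeasurableSet (F ∩ piece e J) μ :=
  (NullMeasurableSet.of_null h.compl_null).of_compl.inter
    (measurableSet_piece e J).nullMeasurableSet

theorem IsCornerMeasure.nullMap_coords (h : IsCornerMeasure n d F μ) (he : e ∈ smoothCharts n M)
    (hJ : J.card = d) : NullMap μ (F ∩ piece e J) volume (coords e J) := by
  refine NullMap.of_measurable fun N hN h0 => ?_
  obtain ⟨g, -, -, hg⟩ := h.density e he J hJ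
  have h1 : (μ.restrict (F ∩ piece e J)).map (coords e J) N = 0 := by
    rw [hg]
    refine withDensity_absolutelyContinuous _ _ ?_
    rw [Measure.restrict_apply hN]
    exact measure_mono_null inter_subset_left h0
  rwa [Measure.map_apply_of_aemeasurable (aemeasurable_coords μ F) hN,
    Measure.restrict_apply₀' h.nullMeasurableSet, inter_comm] at h1

/-- Positivity of the density on the open coordinate range makes Lebesgue measure there absolutely
continuous with respect to the image of μ. -/
theorem IsCornerMeasure.nullMap_chartPoint (h : IsCornerMeasure n d F μ)
    (he : e ∈ smoothCharts n M) (hJ : J.card = d) :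
    NullMap volume (coords e J '' (F ∩ piece e J)) μ (chartPoint e J) := by
  refine NullMap.of_measurable fun N hN h0 => ?_
  obtain ⟨g, hgc, hg0, hg⟩ := h.density e he J hJ
  have hsub : coords e J '' (F ∩ piece e J) ⊆ coordRange e J := by
    rw [← image_coords_piece]
    exact image_mono inter_subset_right
  have hV := (isOpen_coordRange e J).measurableSet
  have hgc' : ContinuousOn g (coordRange e J) := by
    refine hgc.mono ?_
    rw [← image_coords_piece]
    exact image_mono fun x hx => ⟨hx.1, fun k hk => (hx.2 k).2 hk⟩
  have hpos : ∀ v ∈ coordRange e J, 0 < g v * ∏ k, (v k)⁻¹ := by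
    intro v hv
    refine mul_pos ?_ (Finset.prod_pos fun k _ => inv_pos.2 (hv.1 k))
    have hx := chartPoint_mem e J hv
    have := hg0 _ hx.1 fun k hk => (hx.2 k).2 hk
    rwa [coords_chartPoint e J hv] at this
  have hmeas : AEMeasurable (fun v => ENNReal.ofReal (g v * ∏ k, (v k)⁻¹))
      (volume.restrict (coordRange e J)) := by
    refine ContinuousOn.aemeasurable ?_ hV
    refine ENNReal.continuous_ofReal.comp_continuousOn (hgc'.mul ?_)
    exact continuousOn_finsetProd _ fun k _ =>
      (continuous_apply k).continuousOn.inv₀ fun v hv => (hv.1 k).ne'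
  have hac : volume.restrict (coords e J '' (F ∩ piece e J)) ≪
      (μ.restrict (F ∩ piece e J)).map (coords e J) := by
    rw [hg]
    refine withDensity_absolutelyContinuous' (hmeas.mono_measure
      (Measure.restrict_mono hsub le_rfl)) ?_
    refine ae_mono (Measure.restrict_mono hsub le_rfl) ?_
    filter_upwards [ae_restrict_mem hV] with v hv
    exact (ENNReal.ofReal_pos.2 (hpos v hv)).ne'
  have hNV : MeasurableSet (coordRange e J ∩ chartPoint e J ⁻¹' N) :=
    measurableSet_inter_preimage (continuousOn_chartPoint e J) hV hN
  have h1 : (μ.restrict (F ∩ piece e J)).map (coords e J)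
      (coordRange e J ∩ chartPoint e J ⁻¹' N) = 0 := by
    rw [Measure.map_apply_of_aemeasurable (aemeasurable_coords μ F) hNV,
      Measure.restrict_apply₀' h.nullMeasurableSet]
    refine measure_mono_null ?_ h0
    rintro x ⟨⟨-, hx⟩, -, hx'⟩
    rwa [mem_preimage, chartPoint_coords e J hx'] at hx
  have h2 := hac h1
  rw [Measure.restrict_apply hNV] at h2
  refine measure_mono_null ?_ h2
  exact fun v hv => ⟨⟨hsub hv.1, hv.2⟩, hv.1⟩

end ChartMeasure

end Corners

namespace Corners

/-! ### The measure on the covering, and transfer of null sets by the exponential map. -/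

section CoverMeasure

variable {n d : ℕ} {M : Type*} [TopologicalSpace M] [ChartedSpace (EuclideanQuadrant n) M]
  [IsManifold (modelWithCornersEuclideanQuadrant n) ∞ M]

/-- The projection of the connected component of `p₀` is a connected subset of the stratum through
the base point of `p₀`. -/
theorem pt_mem_face {p₀ : Frame n M d} (p : Cover p₀) : p.1.pt ∈ face p₀ := by
  have h1 : IsPreconnected (Frame.pt '' (connectedComponent p₀ : Set (Frame n M d))) :=
    isPreconnected_connectedComponent.image _ Frame.continuous_pt.continuousOn
  have h2 := h1.subset_connectedComponentIn (F := stratum n M d)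
    (mem_image_of_mem _ mem_connectedComponent)
    (image_subset_iff.2 fun p _ => p.pt_mem_stratum)
  exact h2 (mem_image_of_mem _ p.2)

theorem pt_mem_piece {e : OpenPartialHomeomorph M (EuclideanQuadrant n)}
    (he : e ∈ smoothCharts n M) {j : Fin d ↪ Fin n} {p : Frame n M d} (hp : p ∈ sheet e j) :
    p.pt ∈ piece e (Finset.univ.map j) :=
  ⟨hp.1, fun k => by rw [sheet_zero_iff he hp]; simp⟩

variable (p₀ : Frame n M d)

open Classical in
/-- The frame over a point of the chart `e` given by the numbering `j` of coordinates. -/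
def sheetFrame (e : OpenPartialHomeomorph M (EuclideanQuadrant n)) (j : Fin d ↪ Fin n) (x : M) :
    Frame n M d := if h : ∃ p : Frame n M d, p.pt = x ∧ p ∈ sheet e j then h.choose else p₀

variable {e : OpenPartialHomeomorph M (EuclideanQuadrant n)}

theorem sheetFrame_spec (he : e ∈ smoothCharts n M) {j : Fin d ↪ Fin n} {x : M}
    (hx : x ∈ piece e (Finset.univ.map j)) :
    (sheetFrame p₀ e j x).pt = x ∧ sheetFrame p₀ e j x ∈ sheet e j := by
  have h : ∃ p : Frame n M d, p.pt = x ∧ p ∈ sheet e j :=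
    exists_frame he hx.1 fun k => by rw [hx.2 k]; simp
  rw [sheetFrame, dif_pos h]
  exact h.choose_spec

theorem continuousOn_sheetFrame (he : e ∈ smoothCharts n M) (j : Fin d ↪ Fin n) :
    ContinuousOn (sheetFrame p₀ e j) (piece e (Finset.univ.map j)) :=
  continuousOn_of_mem_sheet (e := e) (j := j) fun _ hx => (sheetFrame_spec p₀ he hx).symm

variable (e) in
/-- The coordinates of the points of the covering over the chart `e` with the numbering `j`. -/
def coverRange (j : Fin d ↪ Fin n) : Set ({k // k ∉ Finset.univ.map j} → ℝ) :=
  coordRange e _ ∩ (fun v => sheetFrame p₀ e j (chartPoint e _ v)) ⁻¹' connectedComponent p₀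

variable (e) in
open Classical in
/-- The point of the covering with given coordinates. -/
def coverPoint (j : Fin d ↪ Fin n) (v : {k // k ∉ Finset.univ.map j} → ℝ) : Cover p₀ :=
  if h : sheetFrame p₀ e j (chartPoint e _ v) ∈ connectedComponent p₀ then ⟨_, h⟩
  else ⟨p₀, mem_connectedComponent⟩

theorem continuousOn_sheetFrame_chartPoint (he : e ∈ smoothCharts n M) (j : Fin d ↪ Fin n) :
    ContinuousOn (fun v => sheetFrame p₀ e j (chartPoint e _ v))
      (coordRange e (Finset.univ.map j)) :=
  (continuousOn_sheetFrame p₀ he j).comp (continuousOn_chartPoint e _)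
    fun _ hv => chartPoint_mem e _ hv

theorem val_coverPoint {j : Fin d ↪ Fin n} {v : {k // k ∉ Finset.univ.map j} → ℝ}
    (hv : v ∈ coverRange p₀ e j) :
    (coverPoint p₀ e j v).1 = sheetFrame p₀ e j (chartPoint e _ v) := by
  have h : sheetFrame p₀ e j (chartPoint e _ v) ∈ connectedComponent p₀ := hv.2
  rw [coverPoint, dif_pos h]

theorem measurableSet_coverRange (he : e ∈ smoothCharts n M) (j : Fin d ↪ Fin n) :
    MeasurableSet (coverRange p₀ e j) := by
  borelize (Frame n M d)
  exact measurableSet_inter_preimage (continuousOn_sheetFrame_chartPoint p₀ he j)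
    (isOpen_coordRange e _).measurableSet isClosed_connectedComponent.measurableSet

theorem continuousOn_coverPoint (he : e ∈ smoothCharts n M) (j : Fin d ↪ Fin n) :
    ContinuousOn (coverPoint p₀ e j) (coverRange p₀ e j) := by
  rw [IsInducing.subtypeVal.continuousOn_iff]
  exact ((continuousOn_sheetFrame_chartPoint p₀ he j).mono inter_subset_left).congr
    fun v hv => val_coverPoint p₀ hv

theorem coverPoint_mem (he : e ∈ smoothCharts n M) {j : Fin d ↪ Fin n}
    {v : {k // k ∉ Finset.univ.map j} → ℝ} (hv : v ∈ coverRange p₀ e j) :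
    (coverPoint p₀ e j v).1.pt = chartPoint e _ v ∧ (coverPoint p₀ e j v).1 ∈ sheet e j := by
  rw [val_coverPoint p₀ hv]
  exact sheetFrame_spec p₀ he (chartPoint_mem e _ hv.1)

variable {p₀}

theorem sheetFrame_pt (he : e ∈ smoothCharts n M) {j : Fin d ↪ Fin n} {p : Frame n M d}
    (hp : p ∈ sheet e j) : sheetFrame p₀ e j p.pt = p :=
  have h := sheetFrame_spec p₀ he (pt_mem_piece he hp)
  sheet_inj h.2 hp h.1

theorem coords_mem_coverRange (he : e ∈ smoothCharts n M) {j : Fin d ↪ Fin n} {p : Cover p₀}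
    (hp : p.1 ∈ sheet e j) : coords e (Finset.univ.map j) p.1.pt ∈ coverRange p₀ e j := by
  refine ⟨coords_mem e _ (pt_mem_piece he hp), ?_⟩
  rw [mem_preimage, chartPoint_coords e _ (pt_mem_piece he hp), sheetFrame_pt he hp]
  exact p.2

theorem coverPoint_coords (he : e ∈ smoothCharts n M) {j : Fin d ↪ Fin n} {p : Cover p₀}
    (hp : p.1 ∈ sheet e j) : coverPoint p₀ e j (coords e (Finset.univ.map j) p.1.pt) = p := by
  refine Subtype.ext ?_
  rw [val_coverPoint p₀ (coords_mem_coverRange he hp),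
    chartPoint_coords e _ (pt_mem_piece he hp), sheetFrame_pt he hp]

variable [MeasurableSpace M] [BorelSpace M] {μF : Measure M}

/-- A fibre over a point outside N carries no mass over N. Only the upper bound for the mixture of
measures enters, and that holds without measurability of the fibre measures. -/
theorem nullMap_pt (A : Set (Cover p₀)) : NullMap (coverMeasure p₀ μF) A μF fun p => p.1.pt := by
  refine NullMap.of_measurable fun N hN h0 => measure_mono_null inter_subset_right ?_
  have hm : MeasurableSet ((fun p : Cover p₀ => p.1.pt) ⁻¹' N) :=
    (Frame.continuous_pt.comp continuous_subtype_val).measurable hN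
  refine nonpos_iff_eq_zero.1 ((Measure.bind_apply_le _ hm).trans (le_of_eq ?_))
  rw [← lintegral_zero (μ := μF)]
  refine lintegral_congr_ae ?_
  filter_upwards [measure_eq_zero_iff_ae_notMem.1 h0] with y hy
  rw [fibreMeasure, Measure.sum_apply _ hm, ENNReal.tsum_eq_zero]
  rintro ⟨x, rfl⟩
  rw [Measure.dirac_apply' _ hm]
  exact indicator_of_notMem (s := (fun p : Cover p₀ => p.1.pt) ⁻¹' N) hy 1

theorem nullMap_coords_pt (hμF : IsCornerMeasure n d (face p₀) μF) (he : e ∈ smoothCharts n M)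
    (j : Fin d ↪ Fin n) : NullMap (coverMeasure p₀ μF) {p | p.1 ∈ sheet e j} volume
      (fun p => coords e (Finset.univ.map j) p.1.pt) :=
  (hμF.nullMap_coords he (by simp)).comp (nullMap_pt _)
    fun p hp => ⟨pt_mem_face p, pt_mem_piece he hp⟩

/-- The fibre measure is a sum of Dirac masses, so a null set of the covering has no points at all
over almost every point of the face. -/
theorem nullMap_coverPoint (hμF : IsCornerMeasure n d (face p₀) μF)
    (hfib : AEMeasurable (fibreMeasure p₀) μF) (he : e ∈ smoothCharts n M) (j : Fin d ↪ Fin n) :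
    NullMap volume (coverRange p₀ e j) (coverMeasure p₀ μF) (coverPoint p₀ e j) := by
  refine NullMap.of_measurable fun N hN h0 => ?_
  rw [coverMeasure, Measure.bind_apply hN hfib] at h0
  replace h0 := (lintegral_eq_zero_iff' ((Measure.measurable_coe hN).comp_aemeasurable hfib)).1 h0
  rw [EventuallyEq, ae_iff] at h0
  refine measure_mono_null ?_ (hμF.nullMap_chartPoint he (by simp) _ h0)
  rintro v ⟨hv, hvN⟩
  obtain ⟨h1, h2⟩ := coverPoint_mem p₀ he hv
  refine ⟨⟨chartPoint e _ v, ⟨h1 ▸ pt_mem_face _, chartPoint_mem e _ hv.1⟩,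
    coords_chartPoint e _ hv.1⟩, fun h => ?_⟩
  simp only [Function.comp_apply, Pi.zero_apply] at h
  rw [fibreMeasure, Measure.sum_apply _ hN, ENNReal.tsum_eq_zero] at h
  have h3 := h ⟨_, h1⟩
  rw [Measure.dirac_apply' _ hN] at h3
  exact one_ne_zero ((indicator_of_mem (mem_preimage.1 hvN) 1).symm.trans h3)

section Transfer

variable [SFinite μF] {f : ExpMap p₀} {Φ : OpenPartialHomeomorph M (EuclideanQuadrant n)}

theorem expPoint_mem_piece (he : e ∈ smoothCharts n M) (hΦ : Φ ∈ smoothCharts n M)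
    {j : Fin d ↪ Fin n}
    (hf : ∀ p : Cover p₀, p.1 ∈ sheet e j → ∀ ρ : Fin d → ℝ≥0, place j (e p.1.pt) ρ ∈ Φ.target →
      f.toFun p ρ = Φ.symm (place j (e p.1.pt) ρ))
    {y : Cover p₀ × E d} (hy : y ∈ expPatch p₀ e j Φ) :
    expPoint f y ∈ stratum n M 0 ∩ piece Φ ∅ ∧
      coords Φ ∅ (expPoint f y) =
        combine j (coords e (Finset.univ.map j) y.1.1.pt, expCoord y.2) := by
  have h1 : expPoint f y = Φ.symm (place j (e y.1.1.pt) (expNeg y.2)) := hf _ hy.1 _ hy.2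
  have hs : expPoint f y ∈ Φ.source := by
    rw [h1]
    exact Φ.map_target hy.2
  have h2 : Φ (expPoint f y) = place j (e y.1.1.pt) (expNeg y.2) := by
    rw [h1, Φ.right_inv hy.2]
  have hpos := place_pos he hy.1 (ρ := expNeg y.2) fun i => by
    rw [← NNReal.coe_pos, expNeg_apply]
    exact Real.exp_pos _
  refine ⟨⟨?_, hs, fun k => ?_⟩, ?_⟩
  · change depth (n := n) (expPoint f y) = 0
    rw [depth_eq hΦ hs, h2, ncard_eq_zero]
    exact eq_empty_of_forall_notMem fun k hk => (hpos k).ne' hk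
  · rw [h2]
    simp [(hpos k).ne']
  · ext ⟨k, hk⟩
    rw [coords, h2]
    by_cases h : k ∈ Finset.univ.map j
    · obtain ⟨i, -, rfl⟩ := Finset.mem_map.1 h
      rw [combine_apply_mem, place_apply_mem, sheet_zero hy.1, zero_add, expNeg_apply]
      rfl
    · rw [combine_apply_notMem j _ ⟨k, h⟩, place_apply_not_mem _ _ _ (by simpa using h)]
      rfl

/-- In the charts the map is the product of the coordinates on the covering with exp(−t), so it is a
composition of maps already known to pull null sets back to null sets. -/
theorem nullMap_expPoint (hμF : IsCornerMeasure n d (face p₀) μF) {μ : Measure M}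
    (hμ : IsCornerMeasure n 0 (stratum n M 0) μ)
    (he : e ∈ smoothCharts n M) (hΦ : Φ ∈ smoothCharts n M) {j : Fin d ↪ Fin n}
    (hf : ∀ p : Cover p₀, p.1 ∈ sheet e j → ∀ ρ : Fin d → ℝ≥0, place j (e p.1.pt) ρ ∈ Φ.target →
      f.toFun p ρ = Φ.symm (place j (e p.1.pt) ρ)) :
    NullMap (liftMeasure p₀ μF) (expPatch p₀ e j Φ) μ (expPoint f) := by
  have hopen := isOpen_coverSheet (p₀ := p₀) he j
  have h1 : NullMap (liftMeasure p₀ μF) ({p | p.1 ∈ sheet e j} ×ˢ univ) volume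
      (Prod.map (fun p : Cover p₀ => coords e (Finset.univ.map j) p.1.pt) (expCoord (d := d))) := by
    refine (nullMap_coords_pt hμF he j).prod nullMap_expCoord fun N hN => ?_
    refine measurableSet_inter_preimage ?_ (hopen.measurableSet.prod MeasurableSet.univ) hN
    refine ContinuousOn.prodMap ?_ continuous_expCoord.continuousOn
    exact (continuousOn_coords e _).comp
      (Frame.continuous_pt.comp continuous_subtype_val).continuousOn fun p hp => hp.1
  have h2 := (NullMap.of_quasiMeasurePreserving
    (measurePreserving_combine j).quasiMeasurePreserving univ).comp h1 (mapsTo_univ _ _)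
  have h3 := (hμ.nullMap_chartPoint (e := Φ) (J := ∅) hΦ rfl).comp
    (h2.mono (A' := expPatch p₀ e j Φ) fun y hy => ⟨hy.1, mem_univ _⟩) fun y hy =>
      ⟨_, (expPoint_mem_piece he hΦ hf hy).1, (expPoint_mem_piece he hΦ hf hy).2⟩
  refine h3.congr fun y hy => ?_
  have h4 := expPoint_mem_piece he hΦ hf hy
  rw [Function.comp_apply, Function.comp_apply, Prod.map_apply', ← h4.2,
    chartPoint_coords _ _ h4.1.2]

/-- The inverse on the patch is again a composition of such maps: coordinates on M, their splitting,
and then the point of the covering paired with −log. -/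
theorem measure_image_expPoint_patch (hμF : IsCornerMeasure n d (face p₀) μF) {μ : Measure M}
    (hμ : IsCornerMeasure n 0 (stratum n M 0) μ) (hfib : AEMeasurable (fibreMeasure p₀) μF)
    (he : e ∈ smoothCharts n M) (hΦ : Φ ∈ smoothCharts n M) {j : Fin d ↪ Fin n}
    (hf : ∀ p : Cover p₀, p.1 ∈ sheet e j → ∀ ρ : Fin d → ℝ≥0, place j (e p.1.pt) ρ ∈ Φ.target →
      f.toFun p ρ = Φ.symm (place j (e p.1.pt) ρ)) {S : Set (Cover p₀ × E d)}
    (hS : S ⊆ expPatch p₀ e j Φ) (h0 : liftMeasure p₀ μF S = 0) :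
    μ (expPoint f '' S) = 0 := by
  have h1 : NullMap volume (coverRange p₀ e j ×ˢ {v : Fin d → ℝ | ∀ i, 0 < v i})
      (liftMeasure p₀ μF) (Prod.map (coverPoint p₀ e j) logCoord) := by
    refine (nullMap_coverPoint hμF hfib he j).prod nullMap_logCoord fun N hN => ?_
    exact measurableSet_inter_preimage
      ((continuousOn_coverPoint p₀ he j).prodMap continuousOn_logCoord)
      ((measurableSet_coverRange p₀ he j).prod measurableSet_orthant) hN
  have hc : NullMap volume (combine j '' (coverRange p₀ e j ×ˢ {v : Fin d → ℝ | ∀ i, 0 < v i}))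
      volume (combine j).symm :=
    NullMap.of_quasiMeasurePreserving
      ((measurePreserving_combine j).symm _).quasiMeasurePreserving _
  have h2 := h1.comp hc (by
    rintro _ ⟨v, hv, rfl⟩
    rwa [MeasurableEquiv.symm_apply_apply])
  have hpatch : ∀ y ∈ expPatch p₀ e j Φ, coords Φ ∅ (expPoint f y) ∈
      combine j '' (coverRange p₀ e j ×ˢ {v : Fin d → ℝ | ∀ i, 0 < v i}) := fun y hy =>
    ⟨(_, _), ⟨coords_mem_coverRange he hy.1, expCoord_pos y.2⟩, (expPoint_mem_piece he hΦ hf hy).2.symm⟩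
  have h3 := h2.comp ((hμ.nullMap_coords (e := Φ) (J := ∅) hΦ rfl).mono
    (A' := expPoint f '' expPatch p₀ e j Φ) (by
      rintro _ ⟨y, hy, rfl⟩
      exact (expPoint_mem_piece he hΦ hf hy).1)) (by
      rintro _ ⟨y, hy, rfl⟩
      exact hpatch y hy)
  refine measure_mono_null ?_ (h3 S h0)
  rintro _ ⟨y, hy, rfl⟩
  refine ⟨mem_image_of_mem _ (hS hy), ?_⟩
  have h4 := expPoint_mem_piece he hΦ hf (hS hy)
  rw [mem_preimage, Function.comp_apply, Function.comp_apply, h4.2,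
    MeasurableEquiv.symm_apply_apply, Prod.map_apply, coverPoint_coords he (hS hy).1,
    logCoord_expCoord]
  exact hy

theorem exists_expPatch (f : ExpMap p₀) {y : Cover p₀ × E d} (hy : ∀ i, expNeg y.2 i ≤ f.ε) :
    ∃ e ∈ smoothCharts n M, ∃ j : Fin d ↪ Fin n, ∃ Φ ∈ smoothCharts n M, y ∈ expPatch p₀ e j Φ ∧
      ∀ p : Cover p₀, p.1 ∈ sheet e j → ∀ ρ : Fin d → ℝ≥0, place j (e p.1.pt) ρ ∈ Φ.target →
        f.toFun p ρ = Φ.symm (place j (e p.1.pt) ρ) := by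
  have he : chartAt (EuclideanQuadrant n) y.1.1.pt ∈ smoothCharts n M :=
    IsManifold.chart_mem_maximalAtlas _
  have hp := mem_sheet_chartAt y.1.1
  obtain ⟨Φ, hΦ, hmem, hf⟩ := f.exists_chart he hp hy
  exact ⟨_, he, _, Φ, hΦ, ⟨hp, hmem⟩, hf⟩

variable [CompactSpace M]

theorem liftMeasure_preimage_expPoint (hμF : IsCornerMeasure n d (face p₀) μF) {μ : Measure M}
    (hμ : IsCornerMeasure n 0 (stratum n M 0) μ) (f : ExpMap p₀) {N : Set M} (hN : μ N = 0) :
    liftMeasure p₀ μF ({y | ∀ i, expNeg y.2 i ≤ f.ε} ∩ expPoint f ⁻¹' N) = 0 := by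
  have := secondCountable_frame (n := n) (M := M) (d := d)
  refine measure_null_of_locally_null _ fun y hy => ?_
  obtain ⟨e, he, j, Φ, hΦ, hyP, hf⟩ := exists_expPatch f hy.1
  refine ⟨expPatch p₀ e j Φ ∩ expPoint f ⁻¹' N, ?_, nullMap_expPoint hμF hμ he hΦ hf N hN⟩
  filter_upwards [mem_nhdsWithin_of_mem_nhds ((isOpen_expPatch he j Φ).mem_nhds hyP),
    self_mem_nhdsWithin] with x h1 h2
  exact ⟨h1, h2.2⟩

theorem measure_image_expPoint (hμF : IsCornerMeasure n d (face p₀) μF) {μ : Measure M}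
    (hμ : IsCornerMeasure n 0 (stratum n M 0) μ) (hfib : AEMeasurable (fibreMeasure p₀) μF)
    (f : ExpMap p₀) {S : Set (Cover p₀ × E d)} (hS : ∀ y ∈ S, ∀ i, expNeg y.2 i ≤ f.ε)
    (h0 : liftMeasure p₀ μF S = 0) : μ (expPoint f '' S) = 0 := by
  have := secondCountable_frame (n := n) (M := M) (d := d)
  -- The measure of the image is an outer measure in S, so countable subadditivity reduces the claim
  -- to single patches.
  change OuterMeasure.comap (expPoint f) μ.toOuterMeasure S = 0
  refine measure_null_of_locally_null _ fun y hy => ?_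
  obtain ⟨e, he, j, Φ, hΦ, hyP, hf⟩ := exists_expPatch f (hS y hy)
  refine ⟨S ∩ expPatch p₀ e j Φ, ?_, ?_⟩
  · exact inter_mem self_mem_nhdsWithin
      (mem_nhdsWithin_of_mem_nhds ((isOpen_expPatch he j Φ).mem_nhds hyP))
  · exact measure_image_expPoint_patch hμF hμ hfib he hΦ hf inter_subset_right
      (measure_mono_null inter_subset_left h0)

/-- `L²(F̃)` is separable. -/
theorem separableSpace_l2Cover (p₀ : Frame n M d) (μF : Measure M) [SFinite μF] :
    TopologicalSpace.SeparableSpace (L2Cover p₀ μF) := by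
  have := secondCountable_frame (n := n) (M := M) (d := d)
  have : Fact ((2 : ℝ≥0∞) ≠ ⊤) := ⟨ENNReal.ofNat_ne_top⟩
  infer_instance

end Transfer

end CoverMeasure

end Corners

namespace Corners

/-! ### Pullback of functions on M to the collar. -/

section Pull

variable {n d : ℕ} {M : Type*} [TopologicalSpace M] [ChartedSpace (EuclideanQuadrant n) M]
  [IsManifold (modelWithCornersEuclideanQuadrant n) ∞ M] {p₀ : Frame n M d} {f : ExpMap p₀}
  {W W' : Set (Cover p₀ × (Fin d → ℝ≥0))}

theorem IsCollar.inter (h : IsCollar f W) (h' : IsCollar f W') : IsCollar f (W ∩ W') where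
  isOpen := h.isOpen.inter h'.isOpen
  zero_mem p := ⟨h.zero_mem p, h'.zero_mem p⟩
  small x hx := h.small x hx.1
  invariant σ x hx := ⟨h.invariant σ x hx.1, h'.invariant σ x hx.2⟩
  injective x hx y hy := h.injective x hx.1 y hy.1

theorem expNeg_permVec (σ : Equiv.Perm (Fin d)) (t : E d) :
    expNeg (permVec σ t) = fun i => expNeg t (σ⁻¹ i) := by
  funext i
  rw [expNeg, expNeg, permVec_apply]

/-- The part of `F̃ × ℝᵈ` which corresponds to the collar `W`. -/
def logCollar (W : Set (Cover p₀ × (Fin d → ℝ≥0))) : Set (Cover p₀ × E d) :=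
  {y | (y.1, expNeg y.2) ∈ W}

/-- One direction is the invariance of the collar; applying it to σ⁻¹ gives the other. -/
theorem IsCollar.smul_mem_iff (h : IsCollar f W) (σ : structGroup p₀) (y : Cover p₀ × E d) :
    ((σ • y.1, permVec (d := d) σ.1 y.2) : Cover p₀ × E d) ∈ logCollar W ↔ y ∈ logCollar W := by
  have key : ∀ (σ : structGroup p₀) (y : Cover p₀ × E d), y ∈ logCollar W →
      ((σ • y.1, permVec (d := d) σ.1 y.2) : Cover p₀ × E d) ∈ logCollar W := by
    intro σ y hy
    have := h.invariant σ _ hy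
    change (σ • y.1, expNeg (permVec (d := d) σ.1 y.2)) ∈ W
    rwa [expNeg_permVec]
  refine ⟨fun h1 => ?_, key σ y⟩
  have h2 := key σ⁻¹ _ h1
  simp only [inv_smul_smul] at h2
  rwa [← permVec_mul, InvMemClass.coe_inv, inv_mul_cancel, permVec_one] at h2

theorem expPoint_smul (f : ExpMap p₀) (σ : structGroup p₀) (y : Cover p₀ × E d) :
    expPoint f (σ • y.1, permVec (d := d) σ.1 y.2) = expPoint f y := by
  rw [expPoint, expNeg_permVec]
  exact f.equivariant σ y.1 (expNeg y.2)

/-- The pullback of a function by the exponential map, restricted to a collar. -/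
def pull (f : ExpMap p₀) (W : Set (Cover p₀ × (Fin d → ℝ≥0))) (φ : M → ℂ) :
    Cover p₀ × E d → ℂ := (logCollar W).indicator (φ ∘ expPoint f)

theorem pull_of_mem {φ : M → ℂ} {y : Cover p₀ × E d} (hy : y ∈ logCollar W) :
    pull f W φ y = φ (expPoint f y) := indicator_of_mem hy _

theorem pull_of_notMem {φ : M → ℂ} {y : Cover p₀ × E d} (hy : y ∉ logCollar W) :
    pull f W φ y = 0 := indicator_of_notMem hy _

theorem pull_smul (h : IsCollar f W) (φ : M → ℂ) (σ : structGroup p₀) (y : Cover p₀ × E d) :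
    pull f W φ (σ • y.1, permVec (d := d) σ.1 y.2) = pull f W φ y := by
  by_cases hy : y ∈ logCollar W
  · rw [pull_of_mem ((h.smul_mem_iff σ y).2 hy), pull_of_mem hy, expPoint_smul]
  · rw [pull_of_notMem (mt (h.smul_mem_iff σ y).1 hy), pull_of_notMem hy]

theorem IsCollar.isOpen_logCollar (h : IsCollar f W) : IsOpen (logCollar W) :=
  h.isOpen.preimage (continuous_fst.prodMk (continuous_expNeg.comp continuous_snd))

theorem IsCollar.expPoint_mem (h : IsCollar f W) {y : Cover p₀ × E d} (hy : y ∈ logCollar W) :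
    expPoint f y ∈ stratum n M 0 := expPoint_mem_stratum f (h.small _ hy)

theorem IsCollar.continuousOn_expPoint (h : IsCollar f W) :
    ContinuousOn (expPoint f) (logCollar W) := by
  intro y hy
  refine ContinuousAt.continuousWithinAt ?_
  exact (f.continuousAt (h.small _ hy)).comp (f := fun y : Cover p₀ × E d => (y.1, expNeg y.2))
    (continuous_fst.prodMk (continuous_expNeg.comp continuous_snd)).continuousAt

theorem IsCollar.eventually_mem (h : IsCollar f W) (p : Cover p₀) (t θ : E d)
    (hθ : ∀ i, 0 < θ i) : ∀ᶠ R : ℝ in atTop, (p, t + R • θ) ∈ logCollar W :=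
  (tendsto_const_nhds.prodMk_nhds (tendsto_expNeg_add_smul t θ hθ)).eventually
    (h.isOpen.mem_nhds (h.zero_mem p))

variable {z : DualFace p₀}

theorem tendsto_of_mem_vanishingAt {φ : M → ℂ} (hφ : φ ∈ vanishingAt z) (f : ExpMap p₀)
    (p : Cover p₀) (t θ : E d) (hθ : ∀ i, 0 < θ i) (hsum : ∑ i, θ i = 1)
    (hz : Quot.mk _ (⟨fun i => θ i, hθ, hsum⟩ : openSimplex d) = z) :
    Tendsto (fun R : ℝ => φ (expPoint f (p, t + R • θ))) atTop (𝓝 0) :=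
  (hφ.2 _ hz p _ (IsManifold.chart_mem_maximalAtlas _) _ (mem_sheet_chartAt p.1)).comp
    (tendsto_expPoint_approach f p t θ hθ hsum)

theorem tendsto_pull_of_mem_vanishingAt {φ : M → ℂ} (hφ : φ ∈ vanishingAt z) (h : IsCollar f W)
    (p : Cover p₀) (t θ : E d) (hθ : ∀ i, 0 < θ i) (hsum : ∑ i, θ i = 1)
    (hz : Quot.mk _ (⟨fun i => θ i, hθ, hsum⟩ : openSimplex d) = z) :
    Tendsto (fun R : ℝ => pull f W φ (p, t + R • θ)) atTop (𝓝 0) := by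
  refine (tendsto_of_mem_vanishingAt hφ f p t θ hθ hsum hz).congr' ?_
  filter_upwards [h.eventually_mem p t θ hθ] with R hR
  exact (pull_of_mem hR).symm

/-- The neighbourhood of z on which ψ is 1 is given by |φ| < 1 for a φ vanishing at z, and φ tends
to zero along the translation. -/
theorem IsCutoff.eventually_eq_one {ψ : M → ℂ} (hψ : IsCutoff f z W ψ)
    (p : Cover p₀) (t θ : E d) (hθ : ∀ i, 0 < θ i) (hsum : ∑ i, θ i = 1)
    (hz : Quot.mk _ (⟨fun i => θ i, hθ, hsum⟩ : openSimplex d) = z) :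
    ∀ᶠ R : ℝ in atTop, ψ (expPoint f (p, t + R • θ)) = 1 := by
  obtain ⟨φ, hφ, h1⟩ := hψ.eq_one
  have h2 := tendsto_of_mem_vanishingAt hφ f p t θ hθ hsum hz
  filter_upwards [h2.eventually (Metric.ball_mem_nhds 0 one_pos),
    eventually_expNeg_le f t θ hθ] with R hR hR'
  exact h1 _ (expPoint_mem_stratum f hR') (by simpa using hR)

/-- The translates of a direction belonging to `z` by the structure group belong to `z`. -/
theorem mk_permVec (θ : openSimplex d) (hz : Quot.mk _ θ = z) (σ : structGroup p₀) :
    let θ' : E d := permVec (d := d) σ.1 (WithLp.toLp 2 θ.1)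
    ∃ (hθ : ∀ i, 0 < θ' i) (hsum : ∑ i, θ' i = 1),
      Quot.mk _ (⟨fun i => θ' i, hθ, hsum⟩ : openSimplex d) = z := by
  intro θ'
  have h1 : ∀ i, θ' i = θ.1 (σ.1⁻¹ i) := fun i => permVec_apply _ _ i
  refine ⟨fun i => ?_, ?_, ?_⟩
  · rw [h1]
    exact θ.2.1 _
  · simp only [h1]
    rw [Equiv.sum_comp (σ.1⁻¹ : Equiv.Perm (Fin d)) θ.1]
    exact θ.2.2
  · rw [← hz]
    exact (Quot.sound ⟨σ, h1⟩).symm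

variable [MeasurableSpace M] [CompactSpace M] {μF : Measure M} [SFinite μF]

theorem IsCollar.isBddMeas_pull (h : IsCollar f W) {φ : M → ℂ}
    (hc : ContinuousOn φ (stratum n M 0)) (hb : ∃ C : ℝ, ∀ x ∈ stratum n M 0, ‖φ x‖ ≤ C) :
    IsBddMeas (liftMeasure p₀ μF) (pull f W φ) := by
  have := secondCountable_frame (n := n) (M := M) (d := d)
  have hW := h.isOpen_logCollar.measurableSet
  refine ⟨?_, ?_⟩
  · rw [pull, aestronglyMeasurable_indicator_iff hW]
    exact ContinuousOn.aestronglyMeasurable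
      (hc.comp h.continuousOn_expPoint fun y hy => h.expPoint_mem hy) hW
  · obtain ⟨C, hC⟩ := hb
    refine ⟨C.toNNReal, fun y => ?_⟩
    rw [← NNReal.coe_le_coe, coe_nnnorm]
    by_cases hy : y ∈ logCollar W
    · rw [pull_of_mem hy]
      exact (hC _ (h.expPoint_mem hy)).trans (Real.le_coe_toNNReal C)
    · rw [pull_of_notMem hy, norm_zero]
      exact NNReal.coe_nonneg _

theorem mulLp_mem_normal {χ : Cover p₀ × E d → ℂ} (hχ : IsBddMeas (liftMeasure p₀ μF) χ)
    (hinv : ∀ (σ : structGroup p₀) (y : Cover p₀ × E d),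
      χ (σ • y.1, permVec (d := d) σ.1 y.2) = χ y)
    {u : L2Lift p₀ μF} (hu : u ∈ L2Normal p₀ μF) : mulLp hχ u ∈ L2Normal p₀ μF := by
  intro σ
  refine Lp.ext ?_
  have h1 := (measurePreserving_permLift p₀ μF σ⁻¹).quasiMeasurePreserving.ae (mulLp_ae hχ u)
  have h2 := permLift_ae σ u
  rw [hu σ] at h2
  filter_upwards [permLift_ae σ (mulLp hχ u), h1, h2, mulLp_ae hχ u] with y a1 a2 a3 a4
  rw [a1, a4, a3]
  refine a2.trans ?_
  exact congrArg (· * _) (hinv σ⁻¹ y)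

end Pull

end Corners

namespace Corners

/-! ### Pushing to M and pulling back near z. -/

section Transport

variable {n d : ℕ} {M : Type*} [TopologicalSpace M] [ChartedSpace (EuclideanQuadrant n) M]
  [IsManifold (modelWithCornersEuclideanQuadrant n) ∞ M] [MeasurableSpace M] [BorelSpace M]
  [CompactSpace M] {μ : Measure M} {p₀ : Frame n M d} {μF : Measure M} [SFinite μF]
  {f : ExpMap p₀} {W W' : Set (Cover p₀ × (Fin d → ℝ≥0))} {z : DualFace p₀}

theorem IsCollar.ae_expPoint (hμ : IsCornerMeasure n 0 (stratum n M 0) μ)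
    (hμF : IsCornerMeasure n d (face p₀) μF) (h : IsCollar f W) {P : M → Prop}
    (hP : ∀ᵐ x ∂μ, P x) : ∀ᵐ y ∂(liftMeasure p₀ μF), y ∈ logCollar W → P (expPoint f y) := by
  rw [ae_iff] at hP ⊢
  refine measure_mono_null ?_ (liftMeasure_preimage_expPoint hμF hμ f hP)
  intro y hy
  rw [mem_ofPred_eq, Classical.not_imp] at hy
  exact ⟨h.small _ hy.1, hy.2⟩

/-- Almost every point of M is interior, and an interior point in the image of the collar has all ρ
positive, hence logarithmic coordinates. The exceptional set there is the image of a null set. -/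
theorem IsCollar.ae_of_ae_expPoint (hμ : IsCornerMeasure n 0 (stratum n M 0) μ)
    (hμF : IsCornerMeasure n d (face p₀) μF) (hfib : AEMeasurable (fibreMeasure p₀) μF)
    (h : IsCollar f W) {P : M → Prop}
    (h1 : ∀ᵐ y ∂(liftMeasure p₀ μF), y ∈ logCollar W → P (expPoint f y))
    (h2 : ∀ᵐ x ∂μ, (∀ y ∈ W, f.toFun y.1 y.2 ≠ x) → P x) : ∀ᵐ x ∂μ, P x := by
  rw [ae_iff] at h1
  have h3 := measure_image_expPoint hμF hμ hfib f (fun y hy => by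
    rw [mem_ofPred_eq, Classical.not_imp] at hy
    exact h.small _ hy.1) h1
  filter_upwards [h2, measure_eq_zero_iff_ae_notMem.1 h3,
    measure_eq_zero_iff_ae_notMem.1 hμ.compl_null] with x a1 a2 a3
  by_contra hx
  by_cases hW : ∀ y ∈ W, f.toFun y.1 y.2 ≠ x
  · exact hx (a1 hW)
  · push Not at hW
    obtain ⟨⟨p, ρ⟩, hy, rfl⟩ := hW
    obtain ⟨t, rfl⟩ := exists_expNeg_eq f (h.small _ hy) (not_not.1 a3)
    refine a2 ⟨(p, t), ?_, rfl⟩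
    rw [mem_ofPred_eq, Classical.not_imp]
    exact ⟨hy, hx⟩

/-- This moves a function on M through Q, so that its behaviour at z can be tested along
translations in F̃ × ℝᵈ. -/
theorem IsMultiplication.apply_push (hμ : IsCornerMeasure n 0 (stratum n M 0) μ)
    (hμF : IsCornerMeasure n d (face p₀) μF) (hfib : AEMeasurable (fibreMeasure p₀) μF)
    (h : IsCollar f W) {ψ : M → ℂ} {P : L2 μ →L[ℂ] L2Normal p₀ μF}
    {Q : L2Normal p₀ μF →L[ℂ] L2 μ} (hT : IsTransport μ μF f W ψ P Q) {φ : M → ℂ}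
    {T : L2 μ →L[ℂ] L2 μ} (hφ : IsMultiplication μ φ T)
    (hb : IsBddMeas (liftMeasure p₀ μF) (pull f W φ)) (v : L2Normal p₀ μF) :
    T (Q v) = Q ⟨mulLp hb v, mulLp_mem_normal hb (pull_smul h φ) v.2⟩ := by
  refine Lp.ext ?_
  set w : L2Normal p₀ μF := ⟨mulLp hb v, mulLp_mem_normal hb (pull_smul h φ) v.2⟩
  have h1 : ∀ᵐ x ∂μ, φ x * Q v x = Q w x := by
    refine h.ae_of_ae_expPoint hμ hμF hfib ?_ ?_
    · filter_upwards [hT.push v, hT.push w, mulLp_ae hb v] with y a1 a2 a3 hy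
      have b1 : Q v (expPoint f y) = ψ (expPoint f y) * (v : L2Lift p₀ μF) y := a1 hy
      have b2 : Q w (expPoint f y) = ψ (expPoint f y) * (w : L2Lift p₀ μF) y := a2 hy
      have b3 : (w : L2Lift p₀ μF) y = pull f W φ y * (v : L2Lift p₀ μF) y := a3
      rw [b1, b2, b3, pull_of_mem hy]
      ring
    · filter_upwards [hT.push_zero v, hT.push_zero w] with x a1 a2 hx
      rw [a1 hx, a2 hx, mul_zero]
  filter_upwards [hφ (Q v), h1] with x a1 a2
  rw [a1, a2]

/-- The two transports may use different collars, so v is first restricted to their intersection;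
there the composition is multiplication by the product of the cutoffs. -/
theorem coe_pull_push (hμ : IsCornerMeasure n 0 (stratum n M 0) μ)
    (hμF : IsCornerMeasure n d (face p₀) μF) (hfib : AEMeasurable (fibreMeasure p₀) μF)
    (h : IsCollar f W) {ψ : M → ℂ} {P : L2 μ →L[ℂ] L2Normal p₀ μF}
    {Q : L2Normal p₀ μF →L[ℂ] L2 μ} (hT : IsTransport μ μF f W ψ P Q)
    (h' : IsCollar f W') {ψ' : M → ℂ} {P' : L2 μ →L[ℂ] L2Normal p₀ μF}
    {Q' : L2Normal p₀ μF →L[ℂ] L2 μ} (hT' : IsTransport μ μF f W' ψ' P' Q')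
    (hb₁ : IsBddMeas (liftMeasure p₀ μF) (pull f (W ∩ W') 1))
    (hb : IsBddMeas (liftMeasure p₀ μF) (pull f (W ∩ W') (ψ' * ψ))) (v : L2Normal p₀ μF) :
    (P' (Q ⟨mulLp hb₁ v, mulLp_mem_normal hb₁ (pull_smul (h.inter h') 1) v.2⟩) : L2Lift p₀ μF) =
      mulLp hb v := by
  set w : L2Normal p₀ μF := ⟨mulLp hb₁ v, mulLp_mem_normal hb₁ (pull_smul (h.inter h') 1) v.2⟩
  have hw : ∀ᵐ y ∂(liftMeasure p₀ μF),
      (w : L2Lift p₀ μF) y = pull f (W ∩ W') 1 y * (v : L2Lift p₀ μF) y := mulLp_ae hb₁ v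
  have h1 : ∀ᵐ x ∂μ, Q w x ≠ 0 → ∃ y ∈ W ∩ W', f.toFun y.1 y.2 = x := by
    refine h.ae_of_ae_expPoint hμ hμF hfib ?_ ?_
    · filter_upwards [hT.push w, hw] with y a1 a2 hy hne
      refine ⟨(y.1, expNeg y.2), ?_, rfl⟩
      by_contra hy'
      have b1 : Q w (expPoint f y) = ψ (expPoint f y) * (w : L2Lift p₀ μF) y := a1 hy
      have hy'' : y ∉ logCollar (W ∩ W') := hy'
      rw [a2, pull_of_notMem hy'', zero_mul, mul_zero] at b1
      exact hne b1
    · filter_upwards [hT.push_zero w] with x a1 hx hne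
      exact absurd (a1 hx) hne
  refine Lp.ext ?_
  filter_upwards [hT'.pull (Q w), h'.ae_expPoint hμ hμF h1, hT.push w, hw, mulLp_ae hb v]
    with y a1 a2 a3 a4 a5
  rw [a1, a5]
  by_cases hy' : y ∈ logCollar W'
  · have hy1 : (y.1, expNeg y.2) ∈ W' := hy'
    rw [if_pos hy1]
    change ψ' (expPoint f y) * Q w (expPoint f y) = _
    by_cases hy : y ∈ logCollar W
    · have b1 : Q w (expPoint f y) = ψ (expPoint f y) * (w : L2Lift p₀ μF) y := a3 hy
      have hyy : y ∈ logCollar (W ∩ W') := ⟨hy, hy'⟩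
      rw [b1, a4, pull_of_mem hyy, pull_of_mem hyy]
      simp only [Pi.one_apply, Pi.mul_apply]
      ring
    · have b2 : Q w (expPoint f y) = 0 := by
        by_contra hne
        obtain ⟨x, hx, hxy⟩ := a2 hy' hne
        -- A point of `W'` with the same image as a point x of the intersection is a renumbering of
        -- x, and therefore lies in the invariant collar `W`.
        obtain ⟨σ, hσ⟩ := h'.injective x hx.2 _ hy1 hxy
        refine hy ?_
        change (y.1, expNeg y.2) ∈ W
        rw [hσ]
        exact h.invariant σ x hx.1
      rw [b2, mul_zero, pull_of_notMem fun h => hy h.1, zero_mul]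
  · have hy1 : (y.1, expNeg y.2) ∉ W' := hy'
    rw [if_neg hy1, pull_of_notMem fun h => hy' h.2, zero_mul]

theorem mulLp_one_sub {α : Type*} [MeasurableSpace α] {ν : Measure α} {χ : α → ℂ}
    (h : IsBddMeas ν χ) (h' : IsBddMeas ν (χ - 1)) (u : Lp ℂ 2 ν) :
    mulLp h u - u = mulLp h' u := by
  refine Lp.ext ?_
  filter_upwards [mulLp_ae h u, mulLp_ae h' u, Lp.coeFn_sub (mulLp h u) u] with y h1 h2 h3
  rw [h3, h2, Pi.sub_apply, h1, Pi.sub_apply, Pi.one_apply]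
  ring

theorem IsBddMeas.sub_one {α : Type*} [MeasurableSpace α] {ν : Measure α} {χ : α → ℂ}
    (h : IsBddMeas ν χ) : IsBddMeas ν (χ - 1) := by
  obtain ⟨C, hC⟩ := h.bdd
  refine ⟨h.meas.sub aestronglyMeasurable_const, C + 1, fun y => ?_⟩
  refine (nnnorm_sub_le _ _).trans (add_le_add (hC y) ?_)
  simp

/-- The sum over the structure group of the translations by `-R σθ`. -/
def normalShift (p₀ : Frame n M d) (μF : Measure M) [SFinite μF] (a : E d)
    (u : L2Normal p₀ μF) : L2Normal p₀ μF := ⟨symmShift p₀ μF a u, symmShift_mem a (u : L2Lift p₀ μF)⟩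

/-- Along all directions σθ the translations eventually enter both collars and the region where both
cutoffs are 1. So restricting to the intersection and multiplying by the cutoffs change the
translated functions by terms tending to zero. -/
theorem tendsto_pull_push (hμ : IsCornerMeasure n 0 (stratum n M 0) μ)
    (hμF : IsCornerMeasure n d (face p₀) μF) (hfib : AEMeasurable (fibreMeasure p₀) μF)
    (h : IsCollar f W) {ψ : M → ℂ} (hψ : IsCutoff f z W ψ) {P : L2 μ →L[ℂ] L2Normal p₀ μF}
    {Q : L2Normal p₀ μF →L[ℂ] L2 μ} (hT : IsTransport μ μF f W ψ P Q)
    (h' : IsCollar f W') {ψ' : M → ℂ} (hψ' : IsCutoff f z W' ψ')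
    {P' : L2 μ →L[ℂ] L2Normal p₀ μF}
    {Q' : L2Normal p₀ μF →L[ℂ] L2 μ} (hT' : IsTransport μ μF f W' ψ' P' Q')
    (θ : openSimplex d) (hz : Quot.mk _ θ = z) (u : L2Normal p₀ μF) :
    Tendsto (fun R : ℝ => P' (Q (normalShift p₀ μF (-(R • WithLp.toLp 2 θ.1)) u)) -
      normalShift p₀ μF (-(R • WithLp.toLp 2 θ.1)) u) atTop (𝓝 0) := by
  have hc := h.inter h'
  have hb₁ : IsBddMeas (liftMeasure p₀ μF) (pull f (W ∩ W') 1) :=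
    hc.isBddMeas_pull continuousOn_const ⟨1, fun x _ => by simp⟩
  have hb : IsBddMeas (liftMeasure p₀ μF) (pull f (W ∩ W') (ψ' * ψ)) := by
    obtain ⟨C, hC⟩ := hψ.mem.2.1
    obtain ⟨C', hC'⟩ := hψ'.mem.2.1
    refine hc.isBddMeas_pull (hψ'.mem.1.mul hψ.mem.1) ⟨C' * C, fun x hx => ?_⟩
    rw [Pi.mul_apply, norm_mul]
    exact mul_le_mul (hC' x hx) (hC x hx) (norm_nonneg _) ((norm_nonneg _).trans (hC' x hx))
  have hlim₁ : Tendsto (fun R : ℝ => mulLp hb₁.sub_one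
      (symmShift p₀ μF (-(R • WithLp.toLp 2 θ.1)) (u : L2Lift p₀ μF))) atTop (𝓝 0) := by
    refine tendsto_mulLp_symmShift _ _ (fun σ y => ?_) u.2
    obtain ⟨hθ, -, -⟩ := mk_permVec θ hz σ
    refine tendsto_const_nhds.congr' ?_
    filter_upwards [hc.eventually_mem y.1 y.2 _ hθ] with R hR
    rw [Pi.sub_apply, pull_of_mem hR]
    simp
  have hlim : Tendsto (fun R : ℝ => mulLp hb.sub_one
      (symmShift p₀ μF (-(R • WithLp.toLp 2 θ.1)) (u : L2Lift p₀ μF))) atTop (𝓝 0) := by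
    refine tendsto_mulLp_symmShift _ _ (fun σ y => ?_) u.2
    obtain ⟨hθ, hsum, hq⟩ := mk_permVec θ hz σ
    refine tendsto_const_nhds.congr' ?_
    filter_upwards [hc.eventually_mem y.1 y.2 _ hθ, hψ.eventually_eq_one y.1 y.2 _ hθ hsum hq,
      hψ'.eventually_eq_one y.1 y.2 _ hθ hsum hq] with R hR h1 h2
    rw [Pi.sub_apply, pull_of_mem hR, Pi.mul_apply, h1, h2]
    simp
  have hlim₁' : Tendsto (fun R : ℝ => (⟨mulLp hb₁ (normalShift p₀ μF
      (-(R • WithLp.toLp 2 θ.1)) u), mulLp_mem_normal hb₁ (pull_smul hc 1)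
        (normalShift p₀ μF (-(R • WithLp.toLp 2 θ.1)) u).2⟩ : L2Normal p₀ μF) -
      normalShift p₀ μF (-(R • WithLp.toLp 2 θ.1)) u) atTop (𝓝 0) := by
    rw [tendsto_subtype_rng]
    refine hlim₁.congr fun R => ?_
    exact (mulLp_one_sub hb₁ hb₁.sub_one _).symm
  have h3 := ((P'.comp Q).continuous.tendsto 0).comp hlim₁'
  rw [map_zero, tendsto_subtype_rng] at h3
  rw [tendsto_subtype_rng]
  have h4 := hlim.sub h3
  rw [ZeroMemClass.coe_zero, sub_zero] at h4
  refine h4.congr fun R => ?_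
  rw [← mulLp_one_sub hb hb.sub_one, Function.comp_apply, map_sub,
    AddSubgroupClass.coe_sub, AddSubgroupClass.coe_sub, ContinuousLinearMap.comp_apply,
    ContinuousLinearMap.comp_apply]
  have h5 := coe_pull_push hμ hμF hfib h hT h' hT' hb₁ hb
    (normalShift p₀ μF (-(R • WithLp.toLp 2 θ.1)) u)
  rw [h5]
  change mulLp hb (normalShift p₀ μF (-(R • WithLp.toLp 2 θ.1)) u : L2Lift p₀ μF) -
    (normalShift p₀ μF (-(R • WithLp.toLp 2 θ.1)) u : L2Lift p₀ μF) - _ = _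
  abel

end Transport

end Corners

namespace Corners

/-! ### Uniqueness of the infinitesimal operator. -/

section Uniqueness

variable {n d s : ℕ} {M : Type*} [TopologicalSpace M] [ChartedSpace (EuclideanQuadrant n) M]
  [MeasurableSpace M] {μ : Measure M} {p₀ : Frame n M d} {μF : Measure M} [SFinite μF]
  {f : ExpMap p₀} {z : DualFace p₀}

theorem tendsto_apply_of_mem_localIdeal {ι : Type*} {l : Filter ι} {U : ι → L2 μ} {C : ℝ}
    (hC : ∀ i, ‖U i‖ ≤ C) (hw : ∀ v, Tendsto (fun i => inner ℂ v (U i)) l (𝓝 0))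
    (hφ : ∀ φ ∈ vanishingAt z, ∀ T, IsMultiplication μ φ T → Tendsto (fun i => T (U i)) l (𝓝 0))
    {D : OpFamily s μ} (hD : D ∈ localIdeal s μ z) (q : E s) :
    Tendsto (fun i => D q (U i)) l (𝓝 0) := by
  have hspan : ∀ D ∈ (Submodule.span ℂ {X : OpFamily s μ | ∃ B ∈ localFamilies n s μ,
      ∃ C ∈ localFamilies n s μ, ∃ φ ∈ vanishingAt z, ∃ T, IsMultiplication μ φ T ∧
        X = B * BoundedContinuousFunction.const _ T * C}),
      Tendsto (fun i => D q (U i)) l (𝓝 0) := by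
    intro D hD
    induction hD using Submodule.span_induction with
    | mem X hX =>
      obtain ⟨B, -, K, hK, φ, hφz, T, hT, rfl⟩ := hX
      -- For a generator BφC the commutator of C with φ is compact and is negligible on a weakly
      -- null family; φ can then act first, where it gives zero in the limit.
      have h1 : Tendsto (fun i => (K q * T - T * K q) (U i)) l (𝓝 0) :=
        tendsto_zero_of_isCompactOperator ((hK φ hφz.1 T hT).1 q) hC hw
      have h2 := ((K q).continuous.tendsto 0).comp (hφ φ hφz T hT)
      rw [map_zero] at h2
      have h3 := h2.sub h1
      rw [sub_zero] at h3
      have h4 := ((B q).continuous.tendsto 0).comp h3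
      rw [map_zero] at h4
      refine h4.congr fun i => ?_
      simp
    | zero => simpa using tendsto_const_nhds
    | add X Y _ _ hX hY => simpa using hX.add hY
    | smul c X _ hX => simpa using hX.const_smul c
  rw [Metric.tendsto_nhds]
  intro ε hε
  have hC' : 0 < |C| + 1 := by positivity
  -- The uniform bound on the family passes the conclusion to the norm closure; |C| + 1 is used
  -- because it is positive.
  obtain ⟨D', hD', hdist⟩ := Metric.mem_closure_iff.1 hD (ε / 2 / (|C| + 1)) (by positivity)
  filter_upwards [Metric.tendsto_nhds.1 (hspan D' hD') (ε / 2) (half_pos hε)] with i hi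
  rw [dist_zero_right] at hi ⊢
  have h1 : ‖(D - D') q (U i)‖ ≤ ε / 2 / (|C| + 1) * (|C| + 1) := by
    refine ((D - D') q).le_of_opNorm_le_of_le ?_ ?_
    · have h3 : ‖D - D'‖ = dist D D' := (dist_eq_norm_sub D D').symm
      exact ((D - D').norm_coe_le_norm q).trans (h3.trans_le hdist.le)
    · exact (hC i).trans (by linarith [le_abs_self C])
  rw [div_mul_cancel₀ _ hC'.ne'] at h1
  have h2 : D q (U i) = (D - D') q (U i) + D' q (U i) := by simp
  rw [h2]
  linarith [norm_add_le ((D - D') q (U i)) (D' q (U i))]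

/-- Closedness makes L²(NF) complete, which is needed to form the adjoint of the push-forward. -/
theorem isClosed_l2Normal : IsClosed (L2Normal p₀ μF : Set (L2Lift p₀ μF)) := by
  have : (L2Normal p₀ μF : Set (L2Lift p₀ μF)) = ⋂ σ, {u | permLift p₀ μF σ u = u} := by
    ext u
    rw [mem_iInter]
    rfl
  rw [this]
  exact isClosed_iInter fun σ => isClosed_eq (permLift p₀ μF σ).continuous continuous_id

theorem norm_normalShift_le (a : E d) (u : L2Normal p₀ μF) :
    ‖normalShift p₀ μF a u‖ ≤ Fintype.card (structGroup p₀) * ‖u‖ :=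
  norm_symmShift_le a (u : L2Lift p₀ μF)

theorem tendsto_inner_normalShift {a : E d} (ha : a ≠ 0)
    (Q : L2Normal p₀ μF →L[ℂ] L2 μ) (v : L2 μ) (u : L2Normal p₀ μF) :
    Tendsto (fun R : ℝ => inner ℂ v (Q (normalShift p₀ μF (-(R • a)) u))) atTop (𝓝 0) := by
  have : CompleteSpace (L2Normal p₀ μF) := isClosed_l2Normal.completeSpace_coe
  simp only [← ContinuousLinearMap.adjoint_inner_left, Submodule.coe_inner]
  exact tendsto_inner_symmShift ha _ _

theorem IsTranslationInvariant.normalShift {A : L2Normal p₀ μF →L[ℂ] L2Normal p₀ μF}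
    (h : IsTranslationInvariant p₀ μF A) (a : E d) (u : L2Normal p₀ μF) :
    A (normalShift p₀ μF a u) = Corners.normalShift p₀ μF a (A u) := by
  obtain ⟨T, hT⟩ := h
  refine Subtype.ext ?_
  rw [← hT.restrict]
  refine (hT.symmShift a u).trans ?_
  rw [hT.restrict]
  rfl

theorem exists_forall_norm_le (A : E s →ᵇ (L2Normal p₀ μF →L[ℂ] L2Normal p₀ μF)) :
    ∃ C, ∀ q, ‖A q‖ ≤ C := by
  have h := @Bornology.IsBounded.exists_norm_le (L2Normal p₀ μF →L[ℂ] L2Normal p₀ μF)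
    ContinuousLinearMap.toSeminormedAddCommGroup.toSeminormedAddGroup _ A.isBounded_range
  simpa using h

variable [IsManifold (modelWithCornersEuclideanQuadrant n) ∞ M] [BorelSpace M] [CompactSpace M]

theorem tendsto_multiplication_push (hμ : IsCornerMeasure n 0 (stratum n M 0) μ)
    (hμF : IsCornerMeasure n d (face p₀) μF) (hfib : AEMeasurable (fibreMeasure p₀) μF)
    {W : Set (Cover p₀ × (Fin d → ℝ≥0))} (h : IsCollar f W) {ψ : M → ℂ}
    {P : L2 μ →L[ℂ] L2Normal p₀ μF} {Q : L2Normal p₀ μF →L[ℂ] L2 μ}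
    (hT : IsTransport μ μF f W ψ P Q) (θ : openSimplex d) (hz : Quot.mk _ θ = z) {φ : M → ℂ}
    (hφ : φ ∈ vanishingAt z) {T : L2 μ →L[ℂ] L2 μ} (hφT : IsMultiplication μ φ T)
    (u : L2Normal p₀ μF) :
    Tendsto (fun R : ℝ => T (Q (normalShift p₀ μF (-(R • WithLp.toLp 2 θ.1)) u))) atTop
      (𝓝 0) := by
  have hb : IsBddMeas (liftMeasure p₀ μF) (pull f W φ) := h.isBddMeas_pull hφ.1.1 hφ.1.2.1
  simp only [hφT.apply_push hμ hμF hfib h hT hb]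
  rw [← map_zero Q]
  refine (Q.continuous.tendsto 0).comp ?_
  rw [tendsto_subtype_rng]
  refine tendsto_mulLp_symmShift hb _ (fun σ y => ?_) u.2
  obtain ⟨hθ, hsum, hq⟩ := mk_permVec θ hz σ
  exact tendsto_pull_of_mem_vanishingAt hφ h y.1 y.2 _ hθ hsum hq

theorem IsInfinitesimal.unique (hd : 1 ≤ d) (hμ : IsCornerMeasure n 0 (stratum n M 0) μ)
    (hμF : IsCornerMeasure n d (face p₀) μF) {A : OpFamily s μ}
    {A₁ A₁' : E s →ᵇ (L2Normal p₀ μF →L[ℂ] L2Normal p₀ μF)}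
    (h : IsInfinitesimal μ μF f z A A₁) (h' : IsInfinitesimal μ μF f z A A₁') : A₁ = A₁' := by
  refine BoundedContinuousFunction.ext fun q => ContinuousLinearMap.ext fun u => ?_
  by_cases hfib : AEMeasurable (fibreMeasure p₀) μF
  · obtain ⟨W, ψ, P, Q, hW, hψ, hT, B, hB, hBq, hBA⟩ := h.same_coset
    obtain ⟨W', ψ', P', Q', hW', hψ', hT', B', hB', hBq', hBA'⟩ := h'.same_coset
    obtain ⟨θ, hz⟩ := Quot.exists_rep z
    set a : E d := WithLp.toLp 2 θ.1 with ha_def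
    -- The direction has positive entries and d ≥ 1; without a nonzero direction the translates
    -- would not tend weakly to zero.
    have ha : a ≠ 0 := by
      intro h0
      have h1 : a ⟨0, hd⟩ = 0 := by rw [h0]; rfl
      exact (θ.2.1 ⟨0, hd⟩).ne' h1
    let N : ℝ → L2Normal p₀ μF → L2Normal p₀ μF := fun R => normalShift p₀ μF (-(R • a))
    have hbdd : ∀ R, ‖Q (N R u)‖ ≤ ‖Q‖ * (Fintype.card (structGroup p₀) * ‖u‖) := fun R =>
      Q.le_opNorm_of_le (norm_normalShift_le _ _)
    have hlocal : ∀ D ∈ localIdeal s μ z, Tendsto (fun R => D q (Q (N R u))) atTop (𝓝 0) :=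
      fun D hD => tendsto_apply_of_mem_localIdeal hbdd (fun v => tendsto_inner_normalShift ha Q v u)
        (fun φ hφ T hφT => tendsto_multiplication_push hμ hμF hfib hW hT θ hz hφ hφT u) hD q
    -- Both transported families lie in the coset of A, so their difference belongs to J_z and
    -- annihilates Q N_R u in the limit.
    have h1 : Tendsto (fun R => P (Q (A₁ q (P (Q (N R u))))) - P (Q' (A₁' q (P' (Q (N R u))))))
        atTop (𝓝 0) := by
      have h2 := (hlocal _ hBA').sub (hlocal _ hBA)
      rw [sub_zero] at h2
      replace h2 := (P.continuous.tendsto 0).comp h2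
      rw [map_zero] at h2
      refine h2.congr fun R => ?_
      simp [hBq, hBq']
    have hQ : ∀ {W₁ W₂ ψ₁ ψ₂} {P₁ P₂ : L2 μ →L[ℂ] L2Normal p₀ μF}
        {Q₁ Q₂ : L2Normal p₀ μF →L[ℂ] L2 μ}, IsCollar f W₁ → IsCutoff f z W₁ ψ₁ →
        IsTransport μ μF f W₁ ψ₁ P₁ Q₁ → IsCollar f W₂ → IsCutoff f z W₂ ψ₂ →
        IsTransport μ μF f W₂ ψ₂ P₂ Q₂ → ∀ v,
        Tendsto (fun R => P₂ (Q₁ (N R v)) - N R v) atTop (𝓝 0) :=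
      fun a1 a2 a3 a4 a5 a6 v => tendsto_pull_push hμ hμF hfib a1 a2 a3 a4 a5 a6 θ hz v
    -- Up to terms tending to zero, P₁Q can be dropped from P₁Q N_R u; then T commutes with N_R, and
    -- PQ₁ can be dropped in turn.
    have key : ∀ {W₁ ψ₁} {P₁ : L2 μ →L[ℂ] L2Normal p₀ μF} {Q₁ : L2Normal p₀ μF →L[ℂ] L2 μ},
        IsCollar f W₁ → IsCutoff f z W₁ ψ₁ → IsTransport μ μF f W₁ ψ₁ P₁ Q₁ →
        ∀ T : L2Normal p₀ μF →L[ℂ] L2Normal p₀ μF, IsTranslationInvariant p₀ μF T →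
        Tendsto (fun R => P (Q₁ (T (P₁ (Q (N R u))))) - N R (T u)) atTop (𝓝 0) := by
      intro W₁ ψ₁ P₁ Q₁ a1 a2 a3 T hTI
      have h3 := ((P.comp (Q₁.comp T)).continuous.tendsto 0).comp (hQ hW hψ hT a1 a2 a3 u)
      rw [map_zero] at h3
      have h4 := h3.add (hQ a1 a2 a3 hW hψ hT (T u))
      rw [add_zero] at h4
      refine h4.congr fun R => ?_
      have h5 : T (N R u) = N R (T u) := hTI.normalShift _ u
      simp [h5]
    have h6 := (h1.sub (key hW hψ hT _ (h.invariant q))).add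
      (key hW' hψ' hT' _ (h'.invariant q))
    rw [sub_zero, add_zero] at h6
    have h7 : Tendsto (fun R : ℝ => symmShift p₀ μF (-(R • a))
        ((A₁ q u - A₁' q u : L2Normal p₀ μF) : L2Lift p₀ μF)) atTop (𝓝 0) := by
      have h8 := (continuous_subtype_val.tendsto (0 : L2Normal p₀ μF)).comp h6
      refine h8.congr fun R => ?_
      have h9 : ∀ x y w v : L2Normal p₀ μF, x - y - (x - w) + (y - v) = w - v := fun x y w v => by
        abel
      rw [Function.comp_apply, h9]
      change symmShift p₀ μF (-(R • a)) _ - symmShift p₀ μF (-(R • a)) _ = _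
      rw [← map_sub]
      rfl
    have h10 := eq_zero_of_tendsto_symmShift (A₁ q u - A₁' q u).2 h7
    exact sub_eq_zero.1 (Subtype.ext h10)
  -- If the fibre measures do not depend measurably on the point, the mixture is by convention the
  -- zero measure, and L²(NF) is trivial.
  · have h0 : liftMeasure p₀ μF = 0 := by
      rw [liftMeasure, coverMeasure, Measure.bind, Measure.map_of_not_aemeasurable hfib,
        Measure.join_zero, Measure.zero_prod]
    refine Subtype.ext (Lp.ext ?_)
    rw [EventuallyEq, ae_iff]
    have h1 : ∀ S, liftMeasure p₀ μF S = 0 := fun S => by simp [h0]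
    exact h1 _

end Uniqueness

end Corners

end

/-! ### The theorem. -/

theorem mainTheorem3 {n d s : ℕ} (hd : 1 ≤ d) {M : Type*} [TopologicalSpace M] [T2Space M]
    [CompactSpace M] [ConnectedSpace M] [ChartedSpace (EuclideanQuadrant n) M]
    [IsManifold (modelWithCornersEuclideanQuadrant n) ∞ M] [MeasurableSpace M] [BorelSpace M]
    (μ : Measure M) (hμ : IsCornerMeasure n 0 (stratum n M 0) μ)
    (p₀ : Frame n M d)
    (μF : Measure M) [SFinite μF] (hμF : IsCornerMeasure n d (face p₀) μF)
    (f : ExpMap p₀) (z : DualFace p₀)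
    (A : OpFamily s μ) (hA : A ∈ slowFamilies n s μ)
    (hex : ∃ A₁, IsInfinitesimal μ μF f z A A₁) :
    (∃! A₁, IsInfinitesimal μ μF f z A A₁) ∧
    (∃ B, IsFaceSymbol μ μF f z A B ∧
      ∀ B', IsFaceSymbol μ μF f z A B' → ∀ q : E s, ∀ᵐ ξ : E d, B' (ξ, q) = B (ξ, q)) ∧
    (∀ B, IsFaceSymbol μ μF f z A B → ∀ (σ : structGroup p₀) (q : E s), ∀ᵐ ξ : E d,
      (B (permVec σ.1 ξ, q)).comp (permCover p₀ μF σ) =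
        (permCover p₀ μF σ).comp (B (ξ, q))) := by
  have hsep : TopologicalSpace.SeparableSpace (L2Cover p₀ μF) := separableSpace_l2Cover p₀ μF
  obtain ⟨A₁, hA₁⟩ := hex
  refine ⟨⟨A₁, hA₁, fun A₁' hA₁' => hA₁'.unique hd hμ hμF hA₁⟩, ?_, ?_⟩
  · choose T hT using hA₁.invariant
    choose b hb hbT using fun q => exists_isSymbol (hT q).shift
    obtain ⟨C, hC⟩ := exists_forall_norm_le A₁
    -- The lifts are chosen separately for each q; the bound by |S_F| times the norm of A₁(q) makes
    -- the symbol bounded jointly in ξ and q.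
    refine ⟨fun x => b x.2 x.1, ⟨⟨Fintype.card (structGroup p₀) * C, fun x => ?_⟩, A₁, hA₁,
      fun q => ⟨T q, hT q, hbT q⟩⟩, ?_⟩
    · refine (hb _ _).trans ((hT _).norm_le.trans ?_)
      gcongr
      exact hC _
    · rintro B' ⟨-, A₁', hA₁', hB'⟩ q
      obtain ⟨T', hT', hsymb⟩ := hB' q
      -- Any other symbol comes from the same infinitesimal operator, hence from the same lift, and
      -- symbols of one operator agree almost everywhere.
      rw [hA₁'.unique hd hμ hμF hA₁] at hT'
      rw [hT'.unique (hT q)] at hsymb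
      exact hsymb.ae_eq (hbT q)
  · rintro B ⟨-, A₁', -, hB⟩ σ q
    obtain ⟨T, hT, hsymb⟩ := hB q
    exact hsymb.comp_permCover σ (hT.perm σ)
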